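/- **Setting.** For $s\in(0,\infty]$ put $\phi_s(z)=\max\{1,|z|\}^{-s}$, where $\phi_\infty$ is the indicator function of the closed unit disk. For real polynomials $f,g$ let $\langle f|g\rangle=\langle f|g\rangle_{\mathbb R}+\langle f|g\rangle_{\mathbb C}$ with $$\langle f|g\rangle_{\mathbb R}=\int_{\mathbb R}\int_{\mathbb R}\phi_s(x)\phi_s(y)f(x)g(y)\,\mathrm{sgn}(y-x)\,dx\,dy,\qquad \langle f|g\rangle_{\mathbb C}=-2i\int_{\mathbb C}\phi_s(z)^2\,\overline{f(z)}\,g(z)\,\mathrm{sgn}(\operatorname{Im}z)\,d\mu_{\mathbb C}(z),$$ where $\mu_{\mathbb C}$ is Lebesgue measure. For a function $f$ on $\mathbb C$ let $\epsilon f(u)=\frac12\int_{\mathbb R}f(t)\,\mathrm{sgn}(t-u)\,dt$ if $u\in\mathbb R$, and $\epsilon f(u)=i\,\mathrm{sgn}(\operatorname{Im}u)f(\overline u)$ if $u\notin\mathbb R$. Let $\mathrm{sgn}(u-v)=0$ if $u$ or $v$ is not real. *Matrix kernel of the real Mahler ensemble.* Let $N$ be a positive integer, $s>N$, and let $p_0,\dots,p_{N-1}$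 be monic real polynomials with $\deg p_n=n$. For $N$ even, let $\mathbf U=[\langle p_{m-1}|p_{n-1}\rangle]_{m,n=1}^N$, let $\mu_{m,n}$ be the entries of $\mathbf U^{-1}$, put $\varkappa_N(u,v)=-2\phi_s(u)\phi_s(v)\sum_{m,n=1}^N\mu_{m,n}p_{m-1}(u)p_{n-1}(v)$ and $$\mathbf K_N(u,v)=\begin{bmatrix}\varkappa_N(u,v)&\varkappa_N\epsilon(u,v)\\ \epsilon\varkappa_N(u,v)&\epsilon\varkappa_N\epsilon(u,v)+\frac12\mathrm{sgn}(u-v)\end{bmatrix},$$ where $\epsilon$ acts on the first variable when written on the left and on the second when written on the right. For $N=2J+1$ odd, let $$\pi_{2n}(z)=\frac2\pi\sum_{k=0}^n\frac{\Gamma(k+\frac32)\Gamma(n-k+\frac12)}{\Gamma(k+1)\Gamma(n-k+1)}z^{2k},\qquad \pi_{2n+1}(z)=-\frac1{2\pi}\sum_{k=0}^n\frac{s-(2k+2)}{2s}\,\frac{\Gamma(k+\frac32)\Gamma(n-k-\frac12)}{\Gamma(k+1)\Gamma(n-k+1)}z^{2k+1}$$ (with $(s-(2k+2))/s=1$ if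 $s=\infty$), $\widetilde\pi_n=\phi_s\pi_n$, $s_{2n}=\int_{\mathbb R}\widetilde\pi_{2n}(x)\,dx$, and let $\chi_{\mathbb R}$ be the indicator function of $\mathbb R$. With $\mathbf K_{2J}$ formed from $p_0,\dots,p_{2J-1}$ and the same $s$, $$\mathbf K^{(1,1)}_{2J+1}(u,v)=\mathbf K^{(1,1)}_{2J}(u,v)-2\sum_{j=0}^{J-1}\frac{s_{2j}}{s_{2J}}\big[\widetilde\pi_{2J}(u)\widetilde\pi_{2j+1}(v)-\widetilde\pi_{2J}(v)\widetilde\pi_{2j+1}(u)\big],$$ $$\mathbf K^{(1,2)}_{2J+1}(u,v)=\mathbf K^{(1,2)}_{2J}(u,v)-2\sum_{j=0}^{J-1}\frac{s_{2j}}{s_{2J}}\big[\widetilde\pi_{2J}(u)\,\epsilon\widetilde\pi_{2j+1}(v)-\epsilon\widetilde\pi_{2J}(v)\,\widetilde\pi_{2j+1}(u)\big]+\frac{\widetilde\pi_{2J}(u)\chi_{\mathbb R}(v)}{s_{2J}},$$ $$\mathbf K^{(2,2)}_{2J+1}(u,v)=\mathbf K^{(2,2)}_{2J}(u,v)-2\sum_{j=0}^{J-1}\frac{s_{2j}}{s_{2J}}\big[\epsilon\widetilde\pi_{2J}(u)\,\epsilon\widetilde\pi_{2j+1}(v)-\epsilon\widetilde\pi_{2J}(v)\,\epsilon\widetilde\pi_{2j+1}(u)\big]+\frac{\epsilon\widetilde\pi_{2J}(u)\chi_{\mathbb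 R}(v)-\epsilon\widetilde\pi_{2J}(v)\chi_{\mathbb R}(u)}{s_{2J}},$$ and $\mathbf K^{(2,1)}_{2J+1}(u,v)=-\mathbf K^{(1,2)}_{2J+1}(v,u)$. *Scalar kernel of the complex Mahler ensemble.* $K_N(z,w)=\phi_s(z)\phi_s(w)\sum_{n=0}^{N-1}\dfrac{z^n\overline w^{\,n}}{h_n}$ with $h_n=\int_{\mathbb C}|z|^{2n}\phi_s(z)^2\,d\mu_{\mathbb C}(z)$. **Theorem.** Let $|\zeta|=1$, $\zeta\neq\pm1$. For every $N\ge1$ let $s=s(N)\in(N,\infty]$, and suppose that $\lambda=\lim_{N\to\infty}N/s(N)\in[0,1]$ exists (with $N/\infty=0$). For each $N$ let $p_0,\dots,p_{N-1}$ (possibly depending on $N$) be as above. Put $\omega(\tau)=\min\{1,e^{-\operatorname{Re}\tau/\lambda}\}$ if $\lambda>0$; if $\lambda=0$, let $\omega(\tau)=1$ for $\operatorname{Re}\tau\le0$ and $\omega(\tau)=0$ for $\operatorname{Re}\tau>0$. Put $$K_\zeta(z,w)=\omega(z\overline\zeta)\,\omega(\overline w\zeta)\,\frac1\pi\int_0^1x(1-\lambda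 x)e^{(z\overline\zeta+\overline w\zeta)x}\,dx .$$ For $n\ge0$ let $D_n=\mathbb C^n$ if $\lambda>0$; if $\lambda=0$, let $D_n$ be the set of all $(z_1,\dots,z_n)\in\mathbb C^n$ such that $\operatorname{Re}(z_j\overline\zeta)>0$ for some $j$ or $\operatorname{Re}(z_j\overline\zeta)<0$ for all $j$. Then: 1. Locally uniformly for $(z,w)\in D_2$, $$\lim_{N\to\infty}\frac1{N^2}\mathbf K_N\Big(\zeta+\frac zN,\zeta+\frac wN\Big)=\begin{bmatrix}0&K_\zeta(z,w)\\-K_\zeta(w,z)&0\end{bmatrix}.$$ 2. $K_\zeta$ is the scaling limit of the scalar kernel of the complex Mahler ensemble: locally uniformly for $(z,w)\in D_2$, $\lim_{N\to\infty}N^{-2}K_N(\zeta+z/N,\zeta+w/N)=K_\zeta(z,w)$. 3. For every $n\ge0$ and all $z_1,\dots,z_n\in\mathbb C$, $$\operatorname{Pf}\begin{bmatrix}0&K_\zeta(z_j,z_k)\\-K_\zeta(z_k,z_j)&0\end{bmatrix}_{j,k=1}^n=\det\big[K_\zeta(z_j,z_k)\big]_{j,k=1}^n ,$$ and the rescaled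 correlations of the real and of the complex ensemble have this same determinantal limit: both $N^{-2n}\operatorname{Pf}\big[\mathbf K_N(\zeta+\frac{z_j}N,\zeta+\frac{z_k}N)\big]_{j,k=1}^n$ and $N^{-2n}\det\big[K_N(\zeta+\frac{z_j}N,\zeta+\frac{z_k}N)\big]_{j,k=1}^n$ converge to $\det[K_\zeta(z_j,z_k)]_{j,k=1}^n$ locally uniformly on $D_n$. -/

import Mathlib

open Filter Topology MeasureTheory
open scoped ENNReal ComplexConjugate

namespace Mahler

noncomputable section

/-- The weight `max {1, |z|} ^ (-s)`; for `s = ∞` it is the indicator of the closed unit disk. -/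
def weight (s : ℝ≥0∞) (z : ℂ) : ℝ :=
  if s = ∞ then (if ‖z‖ ≤ 1 then 1 else 0) else (max 1 ‖z‖) ^ (-s.toReal)

/-- The weighted polynomial `f(u) max {1, |u|} ^ (-s)`. -/
def weighted (s : ℝ≥0∞) (f : Polynomial ℝ) (u : ℂ) : ℂ :=
  Polynomial.aeval u f * (weight s u : ℂ)

/-! ### The real Mahler ensemble: skew-symmetric form and matrix kernel -/

/-- The form `⟨f | g⟩_ℝ = ∫ ∫ max{1,|x|}^(-s) max{1,|y|}^(-s) f(x) g(y) sgn(y - x) dx dy`. -/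
def skewReal (s : ℝ≥0∞) (f g : Polynomial ℝ) : ℝ :=
  ∫ y : ℝ, ∫ x : ℝ, weight s (x : ℂ) * weight s (y : ℂ) * f.eval x * g.eval y * Real.sign (y - x)

/-- The form `⟨f | g⟩_ℂ = -2i ∫_ℂ max{1,|z|}^(-2s) conj (f z) g(z) sgn(Im z) dμ_ℂ(z)`. -/
def skewComplex (s : ℝ≥0∞) (f g : Polynomial ℝ) : ℂ :=
  -2 * Complex.I * ∫ z : ℂ, ((weight s z ^ 2 : ℝ) : ℂ) * conj (Polynomial.aeval z f) *
    Polynomial.aeval z g * (Real.sign z.im : ℂ)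

/-- The form `⟨f | g⟩ = ⟨f | g⟩_ℝ + ⟨f | g⟩_ℂ`. -/
def skew (s : ℝ≥0∞) (f g : Polynomial ℝ) : ℂ :=
  (skewReal s f g : ℂ) + skewComplex s f g

/-- The matrix `U` of the form `⟨· | ·⟩` on `p 0, …, p (N - 1)`. -/
def gram (s : ℝ≥0∞) (N : ℕ) (p : ℕ → Polynomial ℝ) : Matrix (Fin N) (Fin N) ℂ :=
  Matrix.of fun m n => skew s (p m) (p n)

/-- The scalar function `ϰ_N(u, v)` (used for even `N`). -/
def kappa (s : ℝ≥0∞) (N : ℕ) (p : ℕ → Polynomial ℝ) (u v : ℂ) : ℂ :=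
  -2 * (weight s u : ℂ) * (weight s v : ℂ) *
    ∑ m : Fin N, ∑ n : Fin N,
      (gram s N p)⁻¹ m n * Polynomial.aeval u (p m) * Polynomial.aeval v (p n)

/-- The operator `ε`. -/
def eps (f : ℂ → ℂ) (u : ℂ) : ℂ :=
  if u.im = 0 then (1 / 2) * ∫ t : ℝ, f (t : ℂ) * (Real.sign (t - u.re) : ℂ)
  else Complex.I * (Real.sign u.im : ℂ) * f (conj u)

/-- `sgn (u - v)` for real `u, v`, and `0` if one of them is not real. -/
def sgnDiff (u v : ℂ) : ℂ :=
  if u.im = 0 ∧ v.im = 0 then (Real.sign (u.re - v.re) : ℂ) else 0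

/-- The matrix kernel `K_N(u, v)` for even `N`, with entries `ϰ_N`, `ϰ_N ε`, `ε ϰ_N` and
`ε ϰ_N ε + sgn / 2`; `ε` acts on the first variable from the left and on the second variable from
the right. -/
def evenKernel (s : ℝ≥0∞) (N : ℕ) (p : ℕ → Polynomial ℝ) (u v : ℂ) : Matrix (Fin 2) (Fin 2) ℂ :=
  !![kappa s N p u v, eps (fun v' => kappa s N p u v') v;
     eps (fun u' => kappa s N p u' v) u,
     eps (fun u' => eps (fun v' => kappa s N p u' v') v) u + (1 / 2) * sgnDiff u v]

/-- The skew-orthonormal polynomial `π_{2n}` of the form `⟨· | ·⟩`. -/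
def skewPolyEven (n : ℕ) : Polynomial ℝ :=
  ∑ k ∈ Finset.range (n + 1), Polynomial.C
    (2 / Real.pi * (Real.Gamma ((k : ℝ) + 3 / 2) * Real.Gamma ((n : ℝ) - k + 1 / 2) /
      (Real.Gamma ((k : ℝ) + 1) * Real.Gamma ((n : ℝ) - k + 1)))) * Polynomial.X ^ (2 * k)

/-- The factor `(s - m) / s`, which is `1` for `s = ∞`. -/
def relFactor (s : ℝ≥0∞) (m : ℕ) : ℝ :=
  if s = ∞ then 1 else (s.toReal - m) / s.toReal

/-- The skew-orthonormal polynomial `π_{2n+1}` of the form `⟨· | ·⟩`. -/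
def skewPolyOdd (s : ℝ≥0∞) (n : ℕ) : Polynomial ℝ :=
  ∑ k ∈ Finset.range (n + 1), Polynomial.C
    (-(1 / (2 * Real.pi)) * (relFactor s (2 * k + 2) / 2 *
      (Real.Gamma ((k : ℝ) + 3 / 2) * Real.Gamma ((n : ℝ) - k - 1 / 2) /
        (Real.Gamma ((k : ℝ) + 1) * Real.Gamma ((n : ℝ) - k + 1))))) * Polynomial.X ^ (2 * k + 1)

/-- `s_{2n}`, the integral over `ℝ` of the weighted polynomial `π_{2n}`. -/
def skewInt (s : ℝ≥0∞) (n : ℕ) : ℂ :=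
  ∫ x : ℝ, weighted s (skewPolyEven n) (x : ℂ)

/-- The characteristic function of the real line in `ℂ`. -/
def chiReal (u : ℂ) : ℂ := if u.im = 0 then 1 else 0

/-- The `(1,2)` entry of the matrix kernel for `N = 2 J + 1`. -/
def oddKernel12 (s : ℝ≥0∞) (J : ℕ) (p : ℕ → Polynomial ℝ) (u v : ℂ) : ℂ :=
  evenKernel s (2 * J) p u v 0 1
    - 2 * ∑ j ∈ Finset.range J, skewInt s j / skewInt s J *
        (weighted s (skewPolyEven J) u * eps (weighted s (skewPolyOdd s j)) v
          - eps (weighted s (skewPolyEven J)) v * weighted s (skewPolyOdd s j) u)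
    + weighted s (skewPolyEven J) u * chiReal v / skewInt s J

/-- The matrix kernel `K_N(u, v)` for odd `N = 2 J + 1`. -/
def oddKernel (s : ℝ≥0∞) (J : ℕ) (p : ℕ → Polynomial ℝ) (u v : ℂ) : Matrix (Fin 2) (Fin 2) ℂ :=
  !![evenKernel s (2 * J) p u v 0 0
      - 2 * ∑ j ∈ Finset.range J, skewInt s j / skewInt s J *
          (weighted s (skewPolyEven J) u * weighted s (skewPolyOdd s j) v
            - weighted s (skewPolyEven J) v * weighted s (skewPolyOdd s j) u),
     oddKernel12 s J p u v;
     -oddKernel12 s J p v u,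
     evenKernel s (2 * J) p u v 1 1
      - 2 * ∑ j ∈ Finset.range J, skewInt s j / skewInt s J *
          (eps (weighted s (skewPolyEven J)) u * eps (weighted s (skewPolyOdd s j)) v
            - eps (weighted s (skewPolyEven J)) v * eps (weighted s (skewPolyOdd s j)) u)
      + (eps (weighted s (skewPolyEven J)) u * chiReal v
          - eps (weighted s (skewPolyEven J)) v * chiReal u) / skewInt s J]

/-- The `2 × 2` matrix kernel `K_N` of the real Mahler ensemble. -/
def matrixKernel (s : ℝ≥0∞) (N : ℕ) (p : ℕ → Polynomial ℝ) (u v : ℂ) :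
    Matrix (Fin 2) (Fin 2) ℂ :=
  if Even N then evenKernel s N p u v else oddKernel s (N / 2) p u v

/-! ### The complex Mahler ensemble: scalar kernel and its scaling limit -/

/-- The squared norm of `z ^ n` in `L²(max {1, |z|} ^ (-2s) dμ_ℂ)`. -/
def monomialNormSq (s : ℝ≥0∞) (n : ℕ) : ℝ :=
  ∫ z : ℂ, ‖z‖ ^ (2 * n) * weight s z ^ 2

/-- The scalar kernel of the complex Mahler ensemble: the weighted reproducing kernel of the
polynomials of degree less than `N`. The weight is radial, so the monomials are orthogonal. -/
def complexKernel (s : ℝ≥0∞) (N : ℕ) (z w : ℂ) : ℂ :=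
  (weight s z : ℂ) * (weight s w : ℂ) *
    ∑ n ∈ Finset.range N, z ^ n * conj w ^ n / (monomialNormSq s n : ℂ)

/-- `ω(τ) = min {1, exp (-Re τ / lam)}`; for `lam = 0` it is the indicator of `Re τ ≤ 0`. -/
def omega (lam : ℝ) (τ : ℂ) : ℝ :=
  if lam = 0 then (if τ.re ≤ 0 then 1 else 0) else min 1 (Real.exp (-τ.re / lam))

/-- The scaled scalar kernel `K_ζ(z, w)`. -/
def limitKernel (ζ : ℂ) (lam : ℝ) (z w : ℂ) : ℂ :=
  (omega lam (z * conj ζ) : ℂ) * (omega lam (conj w * ζ) : ℂ) * (1 / (Real.pi : ℂ)) *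
    ∫ x in (0 : ℝ)..1, (x : ℂ) * (1 - (lam : ℂ) * x) * Complex.exp ((z * conj ζ + conj w * ζ) * x)

/-- The antidiagonal matrix `[[0, K_ζ(z, w)], [-K_ζ(w, z), 0]]`. -/
def limitMatrix (ζ : ℂ) (lam : ℝ) (z w : ℂ) : Matrix (Fin 2) (Fin 2) ℂ :=
  !![0, limitKernel ζ lam z w; -limitKernel ζ lam w z, 0]

/-! ### Regions of convergence and Pfaffians -/

/-- All of `ℂⁿ` for `lam > 0`; for `lam = 0` the tuples with `max_j Re (z_j conj ζ) ≠ 0`. -/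
def regularSet (ζ : ℂ) (lam : ℝ) (n : ℕ) : Set (Fin n → ℂ) :=
  {z | 0 < lam ∨ (∃ j, 0 < (z j * conj ζ).re) ∨ ∀ j, (z j * conj ζ).re < 0}

/-- The set of pairs `(z, w)` that lie in `regularSet ζ lam 2`. -/
def regularPairs (ζ : ℂ) (lam : ℝ) : Set (ℂ × ℂ) :=
  {q | ![q.1, q.2] ∈ regularSet ζ lam 2}

/-- The Pfaffian of the `2n × 2n` matrix made of the `2 × 2` blocks `K j k`. -/
def blockPfaffian {n : ℕ} (K : Fin n → Fin n → Matrix (Fin 2) (Fin 2) ℂ) : ℂ :=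
  ((2 : ℂ) ^ n * (n.factorial : ℂ))⁻¹ *
    ∑ σ : Equiv.Perm (Fin n × Fin 2), ((Equiv.Perm.sign σ : ℤ) : ℂ) *
      ∏ i : Fin n, K (σ (i, 0)).1 (σ (i, 1)).1 (σ (i, 0)).2 (σ (i, 1)).2

end

end Mahler

/-! On monomials the skew form has a closed value. The real part contains a term with the parameter
2s, and the planar part is exactly its negative, so for even m and odd n only
4/((m+1)(n-m)(1-(n+1)/s)) survives (`skew_monomial_even_odd`). With A, B, C the Taylor coefficients
of (1-t)^(-3/2), (1-t)^(-1/2), (1-t)^(1/2), the π_n have coefficients A_k B_{n-k} and A_k C_{n-k},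
up to elementary factors. Their skew-orthonormality reduces to partial-fraction convolutions that
obey a first-order recurrence with a vanishing factor (`resolventSum_succ`). Hence the inverse Gram
matrix, for any monic family, can be replaced by the sum of π_{2j}(u)π_{2j+1}(v) minus its transpose
(`kappa_eq`).

This sum telescopes to a Christoffel-Darboux type formula (`sum_skewPoly_mul`): a double sum over k,
l in which u^(2k) v^(2l+1) is divided by 2k-2l-1. For u near the unit circle and away from the real
axis, u^(2d-1)/(2d-1) behaves in d like a point mass at d = 0 of weight (iπ/2) sgn Im u, the value
of the Fourier series of a square wave. More precisely it is this mass plus the difference of a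
sequence of size O(1/|d|) (`zpow_div_eq_stepPrimitive`). Summation by parts leaves the diagonal k =
l with error O(A_n^3 log n), that is O(n^(3/2) log n), which is o(N^2) (`norm_sum_skewPoly_sub_le`,
`tendsto_growth`). The correction for odd N is O(A_n^3) by Abel's inequality
(`norm_oddCorrection_le`).

The diagonal part enters the kernel with the factor sgn Im u - sgn Im v. At two points near ζ the
signs agree, so the (1,1) entry vanishes in the limit, and the (2,2) entry likewise near the
conjugate of ζ. Off the real axis ε is complex conjugation with a sign, so in the (1,2) and (2,1)
entries the signs are opposite and the diagonal survives. Its coefficients involve A_l B_l A_{n-l}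
B_{n-l}, which tends to (2/π)^2 by Wallis' product, so it is a Riemann sum (`tendsto_diagSum`) for
the same integral that comes from the monomial norms of the complex ensemble (`tendsto_complexSum`).

The weights factor out of all kernels, Pfaffians and determinants. Only their product over the
points of a tuple needs a limit, and `regularSet` suffices for it (`tendsto_prod_weight`). The
Pfaffian of antidiagonal blocks is a determinant (`blockPfaffian_antidiagonal`). All limits are
proved along arbitrary convergent z i, w i indexed by a filter, and such continuous convergence
gives locally uniform convergence (`tendstoLocallyUniformlyOn_of_forall_tendsto`). -/

namespace Mahler

/-! ### Binomial coefficients `(p)_n / n!` -/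

/-- The coefficient `(p)_n / n!` of `t ^ n` in `(1 - t) ^ (-p)`. -/
noncomputable def risingCoeff (p : ℝ) (n : ℕ) : ℝ :=
  ∏ i ∈ Finset.range n, ((i : ℝ) + p) / ((i : ℝ) + 1)

@[simp] lemma risingCoeff_zero (p : ℝ) : risingCoeff p 0 = 1 := by simp [risingCoeff]

lemma risingCoeff_succ_eq (p : ℝ) (n : ℕ) :
    risingCoeff p (n + 1) = risingCoeff p n * (((n : ℝ) + p) / ((n : ℝ) + 1)) := by
  rw [risingCoeff, Finset.prod_range_succ, risingCoeff]

lemma succ_mul_risingCoeff_succ (p : ℝ) (n : ℕ) :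
    ((n : ℝ) + 1) * risingCoeff p (n + 1) = ((n : ℝ) + p) * risingCoeff p n := by
  rw [risingCoeff_succ_eq]
  have : (n : ℝ) + 1 ≠ 0 := by positivity
  field_simp

lemma risingCoeff_pos {p : ℝ} (hp : 0 < p) (n : ℕ) : 0 < risingCoeff p n :=
  Finset.prod_pos fun i _ => by positivity

/-- `n (p)_n / n! ` as a shift of the numerator. -/
lemma risingCoeff_mul_Gamma {p : ℝ} (hp : ∀ m : ℕ, p ≠ -m) (n : ℕ) :
    Real.Gamma (n + p) / Real.Gamma (n + 1) = Real.Gamma p * risingCoeff p n := by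
  induction n with
  | zero => simp
  | succ n ih =>
    have h1 : (n : ℝ) + p ≠ 0 := fun h => hp n (by linarith)
    have h2 : (n : ℝ) + 1 ≠ 0 := by positivity
    have e1 : ((n + 1 : ℕ) : ℝ) + p = (n + p) + 1 := by push_cast; ring
    have e2 : ((n + 1 : ℕ) : ℝ) + 1 = (n + 1) + 1 := by push_cast; ring
    rw [e1, e2, Real.Gamma_add_one h1, Real.Gamma_add_one h2, risingCoeff_succ_eq, ← mul_assoc,
      ← ih]
    have := (Real.Gamma_pos_of_pos (by positivity : (0 : ℝ) < n + 1)).ne'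
    field_simp

/-- `(1 - t) ^ (-p) (1 - t) ^ (-q) = (1 - t)⁻¹` if `p + q = 1`. -/
lemma sum_risingCoeff_mul {p q : ℝ} (hpq : p + q = 1) (n : ℕ) :
    ∑ k ∈ Finset.range (n + 1), risingCoeff p k * risingCoeff q (n - k) = 1 := by
  induction n with
  | zero => simp
  | succ n ih =>
    have hn : ((n : ℝ) + 1) ≠ 0 := by positivity
    have h1 : ∑ k ∈ Finset.range (n + 2), (k : ℝ) * (risingCoeff p k * risingCoeff q (n + 1 - k)) =
        ∑ k ∈ Finset.range (n + 1), ((k : ℝ) + p) * (risingCoeff p k * risingCoeff q (n - k)) := by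
      rw [Finset.sum_range_succ']
      simp only [Nat.cast_zero, zero_mul, add_zero, Nat.cast_add, Nat.cast_one]
      refine Finset.sum_congr rfl fun k _ => ?_
      rw [← mul_assoc, succ_mul_risingCoeff_succ, Nat.add_sub_add_right]
      ring
    have h2 : ∑ k ∈ Finset.range (n + 2),
          ((n : ℝ) + 1 - k) * (risingCoeff p k * risingCoeff q (n + 1 - k)) =
        ∑ k ∈ Finset.range (n + 1),
          ((n : ℝ) - k + q) * (risingCoeff p k * risingCoeff q (n - k)) := by
      rw [Finset.sum_range_succ]
      simp only [Nat.cast_add, Nat.cast_one, sub_self, zero_mul, add_zero]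
      refine Finset.sum_congr rfl fun k hk => ?_
      have hk' : k ≤ n := by simpa [Nat.lt_succ_iff] using hk
      have h3 := succ_mul_risingCoeff_succ q (n - k)
      rw [Nat.cast_sub hk', ← Nat.sub_add_comm hk'] at h3
      have : (n : ℝ) + 1 - k = n - k + 1 := by ring
      rw [this, mul_left_comm, h3]
      ring
    have h3 : ((n : ℝ) + 1) * ∑ k ∈ Finset.range (n + 2), risingCoeff p k * risingCoeff q (n + 1 - k)
        = ((n : ℝ) + 1) * ∑ k ∈ Finset.range (n + 1), risingCoeff p k * risingCoeff q (n - k) := by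
      rw [Finset.mul_sum, Finset.mul_sum]
      calc _ = ∑ k ∈ Finset.range (n + 2), (k : ℝ) * (risingCoeff p k * risingCoeff q (n + 1 - k)) +
            ∑ k ∈ Finset.range (n + 2),
              ((n : ℝ) + 1 - k) * (risingCoeff p k * risingCoeff q (n + 1 - k)) := by
            rw [← Finset.sum_add_distrib]
            exact Finset.sum_congr rfl fun k _ => by ring
        _ = _ := by
            rw [h1, h2, ← Finset.sum_add_distrib]
            refine Finset.sum_congr rfl fun k _ => ?_
            linear_combination (risingCoeff p k * risingCoeff q (n - k)) * hpq
    exact (mul_left_cancel₀ hn h3).trans ih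

/-- The weighted convolution `∑ (p)_k (q)_{n-k} / (k! (n-k)! (α - k β))`. -/
noncomputable def resolventSum (p q α β : ℝ) (n : ℕ) : ℝ :=
  ∑ k ∈ Finset.range (n + 1), risingCoeff p k * risingCoeff q (n - k) / (α - k * β)

/-- Write α - (n+1)β = (α - kβ) - (n+1-k)β in each term. The first part gives the plain convolution,
which is 1 for n + 1 and for n alike; the second part shifts the second index. The coefficients then
recombine as (α - kβ) - (n-k+q)β = α - (n+q)β. This recurrence governs orthonormality as well as the
growth of s_{2n}. -/
lemma resolventSum_succ {p q : ℝ} (hpq : p + q = 1) {α β : ℝ} {n : ℕ}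
    (h : ∀ k ≤ n + 1, α - (k : ℝ) * β ≠ 0) :
    (α - ((n : ℝ) + 1) * β) * resolventSum p q α β (n + 1) =
      (α - ((n : ℝ) + q) * β) * resolventSum p q α β n := by
  have h1 : (α - ((n : ℝ) + 1) * β) * resolventSum p q α β (n + 1) =
      ∑ k ∈ Finset.range (n + 1 + 1), risingCoeff p k * risingCoeff q (n + 1 - k) -
        ∑ k ∈ Finset.range (n + 1), β * ((n : ℝ) - k + q) *
        (risingCoeff p k * risingCoeff q (n - k) / (α - k * β)) := by
    rw [resolventSum, Finset.mul_sum, eq_sub_iff_add_eq]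
    have : ∑ k ∈ Finset.range (n + 1), β * ((n : ℝ) - k + q) *
        (risingCoeff p k * risingCoeff q (n - k) / (α - k * β)) =
        ∑ k ∈ Finset.range (n + 1 + 1), β * ((n : ℝ) + 1 - k) *
        (risingCoeff p k * risingCoeff q (n + 1 - k) / (α - k * β)) := by
      rw [Finset.sum_range_succ _ (n + 1)]
      simp only [Nat.cast_add, Nat.cast_one, sub_self, mul_zero, zero_mul, add_zero]
      refine Finset.sum_congr rfl fun k hk => ?_
      have hk' : k ≤ n := by simpa [Nat.lt_succ_iff] using hk
      have h3 := succ_mul_risingCoeff_succ q (n - k)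
      rw [Nat.cast_sub hk', ← Nat.sub_add_comm hk'] at h3
      have e : (n : ℝ) + 1 - k = n - k + 1 := by ring
      rw [e]
      linear_combination -(β * risingCoeff p k / (α - k * β)) * h3
    rw [this, ← Finset.sum_add_distrib]
    refine Finset.sum_congr rfl fun k hk => ?_
    have := div_mul_cancel₀ (risingCoeff p k * risingCoeff q (n + 1 - k))
      (h k (by simpa [Nat.lt_succ_iff] using hk))
    linear_combination this
  rw [h1, sum_risingCoeff_mul hpq (n + 1), ← sum_risingCoeff_mul hpq n, resolventSum, Finset.mul_sum, ← Finset.sum_sub_distrib]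
  refine Finset.sum_congr rfl fun k hk => ?_
  have := div_mul_cancel₀ (risingCoeff p k * risingCoeff q (n - k))
    (h k ((Nat.lt_succ_iff.1 (by simpa using hk)).trans (Nat.le_succ n)))
  linear_combination -this

/-! ### The three sequences `(3/2)_n / n!`, `(1/2)_n / n!`, `(-1/2)_n / n!` -/

/-- `(3/2)_n / n!` -/
noncomputable abbrev coeffA : ℕ → ℝ := risingCoeff (3 / 2)
/-- `(1/2)_n / n!` -/
noncomputable abbrev coeffB : ℕ → ℝ := risingCoeff (1 / 2)
/-- `(-1/2)_n / n!` -/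
noncomputable abbrev coeffC : ℕ → ℝ := risingCoeff (-1 / 2)

lemma coeffA_pos (n : ℕ) : 0 < coeffA n := risingCoeff_pos (by norm_num) n
lemma coeffB_pos (n : ℕ) : 0 < coeffB n := risingCoeff_pos (by norm_num) n

lemma coeffA_eq (n : ℕ) : coeffA n = (2 * n + 1) * coeffB n := by
  induction n with
  | zero => simp
  | succ n ih =>
    have h1 := succ_mul_risingCoeff_succ (3 / 2) n
    have h2 := succ_mul_risingCoeff_succ (1 / 2) n
    have hn : ((n : ℝ) + 1) ≠ 0 := by positivity
    apply mul_left_cancel₀ hn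
    rw [coeffA, h1, ← coeffA, ih]
    push_cast
    linear_combination (-(2 * n + 3 : ℝ)) * h2

lemma coeffB_eq_coeffC (n : ℕ) : coeffB n = -(2 * n - 1) * coeffC n := by
  induction n with
  | zero => simp
  | succ n ih =>
    have h1 := succ_mul_risingCoeff_succ (1 / 2) n
    have h2 := succ_mul_risingCoeff_succ (-1 / 2) n
    have hn : ((n : ℝ) + 1) ≠ 0 := by positivity
    apply mul_left_cancel₀ hn
    rw [coeffB, h1, ← coeffB, ih]
    push_cast
    linear_combination ((2 * n + 1 : ℝ)) * h2

/-- Multiplication of (1-t)^(-3/2) by 1-t gives (1-t)^(-1/2); in the same way B is the sequence of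
partial sums of C. -/
lemma coeffA_succ (n : ℕ) : coeffA (n + 1) = coeffA n + coeffB (n + 1) := by
  have h2 := succ_mul_risingCoeff_succ (1 / 2) n
  rw [coeffA_eq, coeffA_eq]
  push_cast
  linear_combination 2 * h2

lemma coeffC_succ (n : ℕ) : coeffC (n + 1) = coeffB (n + 1) - coeffB n := by
  have h2 := succ_mul_risingCoeff_succ (-1 / 2) n
  rw [coeffB_eq_coeffC, coeffB_eq_coeffC]
  push_cast
  linear_combination 2 * h2

lemma succ_mul_coeffB_succ (n : ℕ) : ((n : ℝ) + 1) * coeffB (n + 1) = coeffA n / 2 := by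
  rw [coeffB, succ_mul_risingCoeff_succ, coeffA_eq]; ring

lemma succ_mul_coeffC_succ (n : ℕ) : ((n : ℝ) + 1) * coeffC (n + 1) = -coeffB n / 2 := by
  rw [coeffC, succ_mul_risingCoeff_succ, coeffB_eq_coeffC]; ring

lemma coeffB_succ_le (n : ℕ) : coeffB (n + 1) ≤ coeffB n := by
  rw [coeffB, risingCoeff_succ_eq]
  refine mul_le_of_le_one_right (coeffB_pos n).le ?_
  rw [div_le_one (by positivity)]; linarith

lemma coeffB_antitone : Antitone coeffB := antitone_nat_of_succ_le coeffB_succ_le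

lemma coeffB_le_one (n : ℕ) : coeffB n ≤ 1 := by
  simpa using coeffB_antitone (Nat.zero_le n)

lemma coeffA_monotone : Monotone coeffA := monotone_nat_of_le_succ fun n => by
  rw [coeffA_succ]; linarith [coeffB_pos (n + 1)]

/-- A_n has order √n, so errors that are cubic in A have order n^(3/2) and disappear after division
by N^2. -/
lemma coeffA_sq_le (n : ℕ) : coeffA n ^ 2 ≤ 2 * (n + 1) := by
  -- The stated bound is replaced by a sharper one that reproduces itself under the factor
  -- ((n+3/2)/(n+1))^2.
  have : coeffA n ^ 2 ≤ (4 * n + 3) / 3 := by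
    induction n with
    | zero => norm_num
    | succ n ih =>
      have h1 := succ_mul_risingCoeff_succ (3 / 2) n
      have hn : (0 : ℝ) < ((n : ℝ) + 1) ^ 2 := by positivity
      have h2 : ((n : ℝ) + 1) ^ 2 * coeffA (n + 1) ^ 2 = (n + 3 / 2) ^ 2 * coeffA n ^ 2 := by
        rw [← mul_pow, ← mul_pow, coeffA, h1]
      refine le_of_mul_le_mul_left ?_ hn
      rw [h2]
      calc _ ≤ ((n : ℝ) + 3 / 2) ^ 2 * ((4 * n + 3) / 3) := by gcongr
        _ ≤ _ := by push_cast; nlinarith [(Nat.cast_nonneg n : (0 : ℝ) ≤ n)]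
  have hn : (0 : ℝ) ≤ n := Nat.cast_nonneg n
  linarith

lemma sum_coeffB (n : ℕ) : ∑ k ∈ Finset.range (n + 1), coeffB k = coeffA n := by
  induction n with
  | zero => simp
  | succ n ih => rw [Finset.sum_range_succ, ih, coeffA_succ]

lemma sum_coeffB_reflect (n : ℕ) : ∑ k ∈ Finset.range (n + 1), coeffB (n - k) = coeffA n := by
  rw [← sum_coeffB, ← Finset.sum_range_reflect coeffB]
  simp

/-- Consecutive products have the ratio (2n+1)(2n+3)/(2n+2)^2, the inverse of a Wallis factor. The
limit 2/π enters the diagonal of the kernel twice. -/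
lemma coeffA_mul_coeffB_eq (n : ℕ) : coeffA n * coeffB n = (Real.Wallis.W n)⁻¹ := by
  induction n with
  | zero => simp [Real.Wallis.W]
  | succ n ih =>
    rw [Real.Wallis.W_succ, mul_inv, ← ih, coeffA, risingCoeff_succ_eq, coeffB, risingCoeff_succ_eq]
    have : (2 : ℝ) * n + 1 ≠ 0 := by positivity
    have : (2 : ℝ) * n + 3 ≠ 0 := by positivity
    field_simp

lemma tendsto_coeffA_mul_coeffB :
    Tendsto (fun n => coeffA n * coeffB n) atTop (𝓝 (2 / Real.pi)) := by
  have := Real.Wallis.tendsto_W_nhds_pi_div_two.inv₀ (by positivity)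
  simp only [inv_div] at this
  exact this.congr fun n => (coeffA_mul_coeffB_eq n).symm

lemma coeffA_mul_coeffB_le_one (n : ℕ) : coeffA n * coeffB n ≤ 1 := by
  rw [coeffA_mul_coeffB_eq]
  refine inv_le_one_of_one_le₀ ?_
  induction n with
  | zero => simp [Real.Wallis.W]
  | succ n ih =>
    rw [Real.Wallis.W_succ]
    refine one_le_mul_of_one_le_of_one_le ih ?_
    rw [div_mul_div_comm, one_le_div (by positivity)]
    nlinarith

/-! ### The skew-orthonormal polynomials in terms of binomial coefficients -/

lemma Gamma_three_halves : Real.Gamma (3 / 2) = √Real.pi / 2 := by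
  have h := Real.Gamma_add_one (s := 1 / 2) (by norm_num)
  rw [Real.Gamma_one_half_eq] at h
  norm_num at h
  rw [h]; ring

lemma Gamma_neg_one_half : Real.Gamma (-1 / 2) = -2 * √Real.pi := by
  have h := Real.Gamma_add_one (s := -1 / 2) (by norm_num)
  have e : (-1 / 2 : ℝ) + 1 = 1 / 2 := by norm_num
  rw [e, Real.Gamma_one_half_eq] at h
  linarith

lemma Gamma_ratio_three_halves (k : ℕ) :
    Real.Gamma (k + 3 / 2) / Real.Gamma (k + 1) = √Real.pi / 2 * coeffA k := by
  rw [risingCoeff_mul_Gamma, Gamma_three_halves]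
  intro m h
  have : (0 : ℝ) ≤ m := Nat.cast_nonneg m
  linarith

lemma Gamma_ratio_one_half (k : ℕ) :
    Real.Gamma (k + 1 / 2) / Real.Gamma (k + 1) = √Real.pi * coeffB k := by
  rw [risingCoeff_mul_Gamma, Real.Gamma_one_half_eq]
  intro m h
  have : (0 : ℝ) ≤ m := Nat.cast_nonneg m
  linarith

lemma Gamma_ratio_neg_one_half (k : ℕ) :
    Real.Gamma (k - 1 / 2) / Real.Gamma (k + 1) = -2 * √Real.pi * coeffC k := by
  rw [← Gamma_neg_one_half, ← risingCoeff_mul_Gamma]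
  · congr 2; ring
  · intro m h
    rcases m with _ | m
    · norm_num at h
    · push_cast at h
      have : (0 : ℝ) ≤ m := Nat.cast_nonneg m
      linarith

lemma skewPolyEven_eq (n : ℕ) : skewPolyEven n =
    ∑ k ∈ Finset.range (n + 1), Polynomial.C (coeffA k * coeffB (n - k)) *
      Polynomial.X ^ (2 * k) := by
  refine Finset.sum_congr rfl fun k hk => ?_
  have hk' : k ≤ n := by simpa [Nat.lt_succ_iff] using hk
  rw [← Nat.cast_sub hk', mul_div_mul_comm, Gamma_ratio_three_halves, Gamma_ratio_one_half]
  congr 2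
  have := Real.mul_self_sqrt Real.pi_pos.le
  have h0 := Real.pi_pos.ne'
  field_simp
  rw [pow_two, this]

lemma skewPolyOdd_eq (s : ℝ≥0∞) (n : ℕ) : skewPolyOdd s n =
    ∑ k ∈ Finset.range (n + 1), Polynomial.C (1 / 4 * (relFactor s (2 * k + 2) *
      (coeffA k * coeffC (n - k)))) * Polynomial.X ^ (2 * k + 1) := by
  refine Finset.sum_congr rfl fun k hk => ?_
  have hk' : k ≤ n := by simpa [Nat.lt_succ_iff] using hk
  rw [← Nat.cast_sub hk', mul_div_mul_comm, Gamma_ratio_three_halves, Gamma_ratio_neg_one_half]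
  congr 2
  have := Real.mul_self_sqrt Real.pi_pos.le
  have h0 := Real.pi_pos.ne'
  field_simp
  rw [pow_two, this]
  ring

lemma aeval_skewPolyEven (n : ℕ) (u : ℂ) : Polynomial.aeval u (skewPolyEven n) =
    ∑ k ∈ Finset.range (n + 1), ((coeffA k * coeffB (n - k) : ℝ) : ℂ) * u ^ (2 * k) := by
  simp [skewPolyEven_eq]

lemma aeval_skewPolyOdd (s : ℝ≥0∞) (n : ℕ) (u : ℂ) : Polynomial.aeval u (skewPolyOdd s n) =
    ∑ k ∈ Finset.range (n + 1), ((1 / 4 * (relFactor s (2 * k + 2) *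
      (coeffA k * coeffC (n - k))) : ℝ) : ℂ) * u ^ (2 * k + 1) := by
  simp [skewPolyOdd_eq]

/-- The closed form of the coefficients of `∑ π_{2j}(u) π_{2j+1}(v)`. -/
lemma sum_skewPoly_mul_aux (s : ℝ≥0∞) (J : ℕ) (u v : ℂ) :
    ∑ j ∈ Finset.range J, Polynomial.aeval u (skewPolyEven j) *
      Polynomial.aeval v (skewPolyOdd s j) =
    ∑ k ∈ Finset.range J, ∑ l ∈ Finset.range J,
      ((coeffA k * (((J : ℝ) - k) * coeffB (J - k)) * (relFactor s (2 * l + 2) * coeffA l *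
        (((J : ℝ) - l) * coeffC (J - l))) : ℝ) : ℂ) *
        (u ^ (2 * k) * v ^ (2 * l + 1) / (2 * k - 2 * l - 1)) := by
  induction J with
  | zero => simp
  | succ J ih =>
    rw [Finset.sum_range_succ, ih]
    -- The factors J - k and J - l kill the new row and column, so both double sums can run over the
    -- same range.
    have hJ : ∀ k l : ℕ, k = J ∨ l = J → ((coeffA k * (((J : ℝ) - k) * coeffB (J - k)) *
        (relFactor s (2 * l + 2) * coeffA l * (((J : ℝ) - l) * coeffC (J - l))) : ℝ) : ℂ) *
        (u ^ (2 * k) * v ^ (2 * l + 1) / (2 * k - 2 * l - 1)) = 0 := by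
      rintro k l (rfl | rfl) <;> simp
    have e : ∑ k ∈ Finset.range J, ∑ l ∈ Finset.range J,
      ((coeffA k * (((J : ℝ) - k) * coeffB (J - k)) * (relFactor s (2 * l + 2) * coeffA l *
        (((J : ℝ) - l) * coeffC (J - l))) : ℝ) : ℂ) *
        (u ^ (2 * k) * v ^ (2 * l + 1) / (2 * k - 2 * l - 1)) =
      ∑ k ∈ Finset.range (J + 1), ∑ l ∈ Finset.range (J + 1),
      ((coeffA k * (((J : ℝ) - k) * coeffB (J - k)) * (relFactor s (2 * l + 2) * coeffA l *
        (((J : ℝ) - l) * coeffC (J - l))) : ℝ) : ℂ) *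
        (u ^ (2 * k) * v ^ (2 * l + 1) / (2 * k - 2 * l - 1)) := by
      rw [Finset.sum_range_succ _ J, Finset.sum_eq_zero (s := Finset.range (J + 1))
        (fun l _ => hJ J l (Or.inl rfl)), add_zero]
      refine Finset.sum_congr rfl fun k _ => ?_
      rw [Finset.sum_range_succ _ J, hJ k J (Or.inr rfl), add_zero]
    rw [e, aeval_skewPolyEven, aeval_skewPolyOdd, Finset.sum_mul_sum, ← Finset.sum_add_distrib]
    refine Finset.sum_congr rfl fun k hk => ?_
    rw [← Finset.sum_add_distrib]
    refine Finset.sum_congr rfl fun l hl => ?_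
    have hk' : k ≤ J := by simpa [Nat.lt_succ_iff] using hk
    have hl' : l ≤ J := by simpa [Nat.lt_succ_iff] using hl
    have h1 := succ_mul_risingCoeff_succ (1 / 2) (J - k)
    have h2 := succ_mul_risingCoeff_succ (-1 / 2) (J - l)
    rw [Nat.cast_sub hk', ← Nat.sub_add_comm hk'] at h1
    rw [Nat.cast_sub hl', ← Nat.sub_add_comm hl'] at h2
    have h1' : (((J + 1 : ℕ) : ℝ) - k) * coeffB (J + 1 - k) =
        ((J : ℝ) - k + 1 / 2) * coeffB (J - k) := by
      rw [← h1]; push_cast; ring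
    have h2' : (((J + 1 : ℕ) : ℝ) - l) * coeffC (J + 1 - l) =
        ((J : ℝ) - l + -1 / 2) * coeffC (J - l) := by
      rw [← h2]; push_cast; ring
    rw [h1', h2']
    -- The increment is (J-k+1/2)(J-l-1/2) - (J-k)(J-l) = (2k-2l-1)/4. It cancels the denominator
    -- and leaves the term j = J.
    have hd : (2 * k - 2 * l - 1 : ℂ) ≠ 0 := by
      intro h
      have : (2 * k - 2 * l - 1 : ℤ) = 0 := by exact_mod_cast h
      omega
    have hd' := mul_inv_cancel₀ hd
    simp only [div_eq_mul_inv (_ * _) (2 * (k : ℂ) - 2 * l - 1)]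
    push_cast
    linear_combination (-(1 / 4) * (coeffA k : ℂ) * coeffB (J - k) * relFactor s (2 * l + 2) *
      coeffA l * coeffC (J - l) * u ^ (2 * k) * v ^ (2 * l + 1)) * hd'

/-- The closed form of `∑ π_{2j}(u) π_{2j+1}(v)`. -/
lemma sum_skewPoly_mul (s : ℝ≥0∞) (n : ℕ) (u v : ℂ) :
    ∑ j ∈ Finset.range (n + 1), Polynomial.aeval u (skewPolyEven j) *
      Polynomial.aeval v (skewPolyOdd s j) =
    -(1 / 4) * ∑ l ∈ Finset.range (n + 1),
      ((relFactor s (2 * l + 2) * (coeffA l * coeffB (n - l)) : ℝ) : ℂ) * v ^ (2 * l + 1) *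
      ∑ k ∈ Finset.range (n + 1), ((coeffA k * coeffA (n - k) : ℝ) : ℂ) *
        (u ^ (2 * k) / (2 * k - 2 * l - 1)) := by
  rw [sum_skewPoly_mul_aux, Finset.sum_comm, Finset.mul_sum]
  refine Finset.sum_congr rfl fun l hl => ?_
  rw [Finset.mul_sum, Finset.mul_sum]
  refine Finset.sum_congr rfl fun k hk => ?_
  have hk' : k ≤ n := by simpa [Nat.lt_succ_iff] using hk
  have hl' : l ≤ n := by simpa [Nat.lt_succ_iff] using hl
  have h1 := succ_mul_coeffB_succ (n - k)
  have h2 := succ_mul_coeffC_succ (n - l)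
  rw [Nat.cast_sub hk', ← Nat.sub_add_comm hk'] at h1
  rw [Nat.cast_sub hl', ← Nat.sub_add_comm hl'] at h2
  have h1' : (((n + 1 : ℕ) : ℝ) - k) * coeffB (n + 1 - k) = coeffA (n - k) / 2 := by
    rw [← h1]; push_cast; ring
  have h2' : (((n + 1 : ℕ) : ℝ) - l) * coeffC (n + 1 - l) = -coeffB (n - l) / 2 := by
    rw [← h2]; push_cast; ring
  rw [h1', h2']
  push_cast
  ring

/-- The partial sums of `π_{2j+1}`. -/
lemma sum_aeval_skewPolyOdd (s : ℝ≥0∞) (n : ℕ) (v : ℂ) :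
    ∑ j ∈ Finset.range (n + 1), Polynomial.aeval v (skewPolyOdd s j) =
    ∑ k ∈ Finset.range (n + 1), ((1 / 4 * (relFactor s (2 * k + 2) *
      (coeffA k * coeffB (n - k))) : ℝ) : ℂ) * v ^ (2 * k + 1) := by
  induction n with
  | zero => simp [aeval_skewPolyOdd]
  | succ n ih =>
    rw [Finset.sum_range_succ, ih, aeval_skewPolyOdd, Finset.sum_range_succ _ (n + 1),
      Finset.sum_range_succ _ (n + 1), ← add_assoc, ← Finset.sum_add_distrib]
    congr 1
    · refine Finset.sum_congr rfl fun k hk => ?_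
      have hk' : k ≤ n := by simpa [Nat.lt_succ_iff] using hk
      rw [Nat.sub_add_comm hk', coeffC_succ]
      push_cast
      ring
    · simp

/-! ### The parameter `1 / s` -/

/-- The real number `1 / s`, equal to `0` for `s = ∞`. -/
noncomputable def invParam (s : ℝ≥0∞) : ℝ := (s⁻¹).toReal

lemma invParam_nonneg (s : ℝ≥0∞) : 0 ≤ invParam s := ENNReal.toReal_nonneg

@[simp] lemma invParam_top : invParam ∞ = 0 := by simp [invParam]

lemma relFactor_eq {s : ℝ≥0∞} (hs : s ≠ 0) (m : ℕ) : relFactor s m = 1 - m * invParam s := by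
  rw [relFactor]
  split_ifs with h
  · simp [h]
  · have : s.toReal ≠ 0 := (ENNReal.toReal_pos hs h).ne'
    rw [invParam, ENNReal.toReal_inv]
    field_simp

lemma mul_invParam_lt_one {s : ℝ≥0∞} {m : ℕ} (hs : (m : ℝ≥0∞) < s) : m * invParam s < 1 := by
  by_cases h : s = ∞
  · simp [h]
  · have h1 : (m : ℝ) < s.toReal := by
      have := (ENNReal.toReal_lt_toReal (by simp) h).2 hs
      simpa using this
    have h0 : (0 : ℝ) < s.toReal := (Nat.cast_nonneg m).trans_lt h1
    rw [invParam, ENNReal.toReal_inv, ← div_eq_mul_inv, div_lt_one h0]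
    exact h1

lemma relFactor_mem_Icc {s : ℝ≥0∞} {N m : ℕ} (hs : (N : ℝ≥0∞) < s) (hm : m ≤ N) :
    relFactor s m ∈ Set.Icc (0 : ℝ) 1 := by
  rw [relFactor_eq (pos_of_gt hs).ne']
  have h1 := mul_invParam_lt_one hs
  have h2 := invParam_nonneg s
  have h3 : (m : ℝ) ≤ N := by exact_mod_cast hm
  constructor
  · nlinarith
  · have : 0 ≤ (m : ℝ) * invParam s := by positivity
    linarith

/-! ### The weight -/

lemma weight_eq_weight_norm (s : ℝ≥0∞) (z : ℂ) : weight s z = weight s ((‖z‖ : ℝ) : ℂ) := by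
  simp [weight]

lemma weight_conj (s : ℝ≥0∞) (z : ℂ) : weight s (conj z) = weight s z := by
  simp [weight]

lemma weight_nonneg (s : ℝ≥0∞) (z : ℂ) : 0 ≤ weight s z := by
  unfold weight
  split_ifs <;> positivity

lemma weight_le_one (s : ℝ≥0∞) (z : ℂ) : weight s z ≤ 1 := by
  unfold weight
  split_ifs
  · exact le_rfl
  · exact zero_le_one
  · exact Real.rpow_le_one_of_one_le_of_nonpos (le_max_left _ _)
      (neg_nonpos.2 ENNReal.toReal_nonneg)

lemma weight_eq_one (s : ℝ≥0∞) {z : ℂ} (hz : ‖z‖ ≤ 1) : weight s z = 1 := by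
  simp [weight, hz]

lemma measurable_weight (s : ℝ≥0∞) : Measurable (weight s) := by
  unfold weight
  by_cases h : s = ∞
  · simp only [h, if_true]
    exact Measurable.ite (measurableSet_le measurable_norm measurable_const) measurable_const
      measurable_const
  · simp only [h, if_false]
    exact (measurable_const.max measurable_norm).pow_const _

lemma measurable_weight_ofReal (s : ℝ≥0∞) : Measurable fun x : ℝ => weight s (x : ℂ) :=
  (measurable_weight s).comp Complex.measurable_ofReal

lemma weight_of_one_lt {s : ℝ≥0∞} (hs : s ≠ ∞) {r : ℝ} (hr : 1 < r) :
    weight s (r : ℂ) = r ^ (-s.toReal) := by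
  have h0 : 0 ≤ r := by linarith
  simp [weight, hs, abs_of_nonneg h0, max_eq_right hr.le]

lemma weight_top_of_one_lt {r : ℝ} (hr : 1 < r) : weight ∞ (r : ℂ) = 0 := by
  have h0 : 0 ≤ r := by linarith
  simp [weight, abs_of_nonneg h0, hr]

/-- Squared weights occur in planar integrals and in iterated radial integrals; both are then
covered by the one-dimensional formulas with 2s in place of s. -/
lemma weight_sq (s : ℝ≥0∞) (z : ℂ) : weight s z ^ 2 = weight (2 * s) z := by
  unfold weight
  by_cases h : s = ∞
  · simp [h]
  · have h2 : 2 * s ≠ ∞ := ENNReal.mul_ne_top (by simp) h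
    simp only [h, h2, if_false]
    rw [← Real.rpow_natCast, ← Real.rpow_mul (by positivity)]
    congr 1
    simp [ENNReal.toReal_mul]
    ring

lemma invParam_two_mul (s : ℝ≥0∞) : invParam (2 * s) = invParam s / 2 := by
  rw [invParam, ENNReal.mul_inv (by simp) (by simp), ENNReal.toReal_mul, invParam]
  simp
  ring

/-! ### Radial integrals -/

lemma natCast_lt_toReal {s : ℝ≥0∞} {m : ℕ} (hm : (m : ℝ≥0∞) < s) (h : s ≠ ∞) :
    (m : ℝ) < s.toReal := by
  simpa using (ENNReal.toReal_lt_toReal (by simp) h).2 hm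

lemma integrableOn_pow_mul_weight_Ioi {s : ℝ≥0∞} {j : ℕ} (hj : ((j + 1 : ℕ) : ℝ≥0∞) < s) :
    IntegrableOn (fun r : ℝ => r ^ j * weight s r) (Set.Ioi 1) := by
  by_cases h : s = ∞
  · subst h
    refine (integrableOn_zero).congr_fun (fun r hr => ?_) measurableSet_Ioi
    simp [weight_top_of_one_lt hr]
  · have h1 := natCast_lt_toReal hj h
    push_cast at h1
    refine (integrableOn_Ioi_rpow_of_lt (a := j - s.toReal) (by linarith) one_pos).congr_fun
      (fun r hr => ?_) measurableSet_Ioi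
    have hr0 : (0 : ℝ) < r := one_pos.trans hr
    simp only [weight_of_one_lt h hr]
    rw [sub_eq_add_neg, Real.rpow_add hr0, Real.rpow_natCast]

lemma integral_pow_mul_weight_Ioi {s : ℝ≥0∞} {j : ℕ} (hj : ((j + 1 : ℕ) : ℝ≥0∞) < s) {y : ℝ}
    (hy : 1 ≤ y) : ∫ r in Set.Ioi y, r ^ j * weight s r =
      if s = ∞ then 0 else y ^ (j + 1 - s.toReal) / (s.toReal - (j + 1)) := by
  split_ifs with h
  · subst h
    rw [setIntegral_congr_fun measurableSet_Ioi (g := fun _ => (0 : ℝ))]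
    · simp
    · intro r hr
      simp [weight_top_of_one_lt (lt_of_le_of_lt hy hr)]
  · have h1 := natCast_lt_toReal hj h
    push_cast at h1
    rw [setIntegral_congr_fun measurableSet_Ioi (g := fun r => r ^ ((j : ℝ) - s.toReal)),
      integral_Ioi_rpow_of_lt (by linarith) (by linarith)]
    · have e : (j : ℝ) - s.toReal + 1 = j + 1 - s.toReal := by ring
      have e2 : s.toReal - (j + 1) = -((j : ℝ) + 1 - s.toReal) := by ring
      rw [e, e2, div_neg, neg_div]
    · intro r hr
      have hr1 : 1 < r := lt_of_le_of_lt hy hr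
      have hr0 : (0 : ℝ) < r := one_pos.trans hr1
      simp only [weight_of_one_lt h hr1]
      rw [sub_eq_add_neg, Real.rpow_add hr0, Real.rpow_natCast]

lemma integrableOn_pow_mul_weight_Ioc (s : ℝ≥0∞) (j : ℕ) :
    IntegrableOn (fun r : ℝ => r ^ j * weight s r) (Set.Ioc 0 1) := by
  have : IntegrableOn (fun r : ℝ => r ^ j) (Set.Ioc 0 1) :=
    (continuous_pow j).integrableOn_Ioc
  refine this.congr_fun (fun r hr => ?_) measurableSet_Ioc
  have : ‖(r : ℂ)‖ ≤ 1 := by simpa [abs_of_pos hr.1] using hr.2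
  simp [weight_eq_one s this]

lemma integral_pow_mul_weight_of_le_one (s : ℝ≥0∞) (j : ℕ) {y : ℝ} (h0 : 0 ≤ y) (hy : y ≤ 1) :
    ∫ r in (0 : ℝ)..y, r ^ j * weight s r = y ^ (j + 1) / (j + 1) := by
  rw [intervalIntegral.integral_congr (g := fun r => r ^ j)]
  · simp
  · intro r hr
    rw [Set.uIcc_of_le h0] at hr
    have : ‖(r : ℂ)‖ ≤ 1 := by simpa [abs_of_nonneg hr.1] using hr.2.trans hy
    simp [weight_eq_one s this]

lemma integrableOn_pow_mul_weight {s : ℝ≥0∞} {j : ℕ} (hj : ((j + 1 : ℕ) : ℝ≥0∞) < s) :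
    IntegrableOn (fun r : ℝ => r ^ j * weight s r) (Set.Ioi 0) := by
  rw [← Set.Ioc_union_Ioi_eq_Ioi (zero_le_one (α := ℝ))]
  exact (integrableOn_pow_mul_weight_Ioc s j).union (integrableOn_pow_mul_weight_Ioi hj)

lemma one_sub_mul_invParam {s : ℝ≥0∞} {c : ℝ} (h0 : s.toReal ≠ 0) :
    1 - c * invParam s = (s.toReal - c) / s.toReal := by
  rw [invParam, ENNReal.toReal_inv]
  field_simp

lemma integral_pow_mul_weight {s : ℝ≥0∞} {j : ℕ} (hj : ((j + 1 : ℕ) : ℝ≥0∞) < s) :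
    ∫ r in Set.Ioi (0 : ℝ), r ^ j * weight s r = 1 / ((j + 1) * (1 - (j + 1) * invParam s)) := by
  rw [← Set.Ioc_union_Ioi_eq_Ioi (zero_le_one (α := ℝ)),
    setIntegral_union (Set.Ioc_disjoint_Ioi le_rfl) measurableSet_Ioi
      (integrableOn_pow_mul_weight_Ioc s j) (integrableOn_pow_mul_weight_Ioi hj),
    ← intervalIntegral.integral_of_le zero_le_one,
    integral_pow_mul_weight_of_le_one s j zero_le_one le_rfl, integral_pow_mul_weight_Ioi hj le_rfl]
  split_ifs with h
  · simp [h]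
  · have h1 := natCast_lt_toReal hj h
    push_cast at h1
    have hj0 : (0 : ℝ) ≤ j := Nat.cast_nonneg j
    have h2 : s.toReal ≠ 0 := by linarith
    have h3 : s.toReal - (j + 1) ≠ 0 := by linarith
    rw [one_sub_mul_invParam h2]
    simp only [one_pow, Real.one_rpow]
    field_simp
    ring

/-- The iterated radial integral in the form `⟨· | ·⟩_ℝ`. -/
lemma integral_pow_mul_weight_mul_primitive {s : ℝ≥0∞} {m n : ℕ} (hm : ((m + 1 : ℕ) : ℝ≥0∞) < s)
    (hn : ((n + 1 : ℕ) : ℝ≥0∞) < s) (hmn : m ≠ n) :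
    ∫ y in Set.Ioi (0 : ℝ), y ^ n * weight s y * ∫ x in (0 : ℝ)..y, x ^ m * weight s x =
      1 / (((m : ℝ) + 1) * ((n : ℝ) - m) * (1 - (n + 1) * invParam s)) -
        2 / (((n : ℝ) - m) * (m + n + 2) * (1 - (m + n + 2) * (invParam s / 2))) := by
  have h2s : ((m + n + 1 + 1 : ℕ) : ℝ≥0∞) < 2 * s := by
    have := ENNReal.add_lt_add hm hn
    rw [two_mul]
    convert! this using 1
    push_cast
    ring
  have hIm := integrableOn_pow_mul_weight hm
  have hI1 := (integrableOn_pow_mul_weight_Ioi hn).mul_const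
    (∫ r in Set.Ioi (0 : ℝ), r ^ m * weight s r)
  have hI2 := (integrableOn_pow_mul_weight_Ioi h2s).mul_const
    (if s = ∞ then 0 else 1 / (s.toReal - (m + 1)))
  have e1 : Set.EqOn (fun y : ℝ => y ^ n * weight s y * ∫ x in (0 : ℝ)..y, x ^ m * weight s x)
      (fun y => y ^ (m + n + 1) / ((m : ℝ) + 1)) (Set.Ioc 0 1) := by
    intro y hy
    have : ‖(y : ℂ)‖ ≤ 1 := by simpa [abs_of_pos hy.1] using hy.2
    simp only [integral_pow_mul_weight_of_le_one s m hy.1.le hy.2, weight_eq_one s this]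
    ring
  -- Outside the unit disk the primitive is the full integral minus its tail. The tail is a power
  -- y^(m+1-s), and with the outer weight it produces the parameter 2s.
  have e2 : Set.EqOn (fun y : ℝ => y ^ n * weight s y * ∫ x in (0 : ℝ)..y, x ^ m * weight s x)
      (fun y => y ^ n * weight s y * (∫ r in Set.Ioi (0 : ℝ), r ^ m * weight s r) -
        y ^ (m + n + 1) * weight (2 * s) y * (if s = ∞ then 0 else 1 / (s.toReal - (m + 1))))
      (Set.Ioi 1) := by
    intro y hy
    have hy1 : 1 < y := hy
    have hy0 : 0 < y := one_pos.trans hy1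
    have h1 : ∫ x in (0 : ℝ)..y, x ^ m * weight s x =
        (∫ r in Set.Ioi (0 : ℝ), r ^ m * weight s r) - ∫ r in Set.Ioi y, r ^ m * weight s r :=
      (intervalIntegral.integral_Ioi_sub_Ioi hIm hy0.le).symm
    simp only [h1, integral_pow_mul_weight_Ioi hm hy1.le, mul_sub]
    congr 1
    split_ifs with h
    · simp
    · rw [← weight_sq, weight_of_one_lt h hy1]
      have e : (m : ℝ) + 1 - s.toReal = ((m + 1 : ℕ) : ℝ) + -s.toReal := by push_cast; ring
      rw [e, Real.rpow_add hy0, Real.rpow_natCast]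
      ring
  rw [← Set.Ioc_union_Ioi_eq_Ioi (zero_le_one (α := ℝ)),
    setIntegral_union (Set.Ioc_disjoint_Ioi le_rfl) measurableSet_Ioi
      (((((continuous_pow (m + n + 1)).div_const ((m : ℝ) + 1)).integrableOn_Ioc).congr_fun e1.symm
        measurableSet_Ioc))
      (IntegrableOn.congr_fun (hI1.sub hI2) e2.symm measurableSet_Ioi),
    setIntegral_congr_fun measurableSet_Ioc e1, setIntegral_congr_fun measurableSet_Ioi e2,
    integral_sub hI1 hI2, integral_mul_const, integral_mul_const,
    integral_pow_mul_weight_Ioi hn le_rfl, integral_pow_mul_weight_Ioi h2s le_rfl,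
    integral_pow_mul_weight hm, ← intervalIntegral.integral_of_le zero_le_one]
  have hm0 : (0 : ℝ) ≤ m := Nat.cast_nonneg m
  have hn0 : (0 : ℝ) ≤ n := Nat.cast_nonneg n
  have hne : (n : ℝ) - m ≠ 0 := sub_ne_zero.2 (by exact_mod_cast hmn.symm)
  have e0 : ∫ y in (0 : ℝ)..1, y ^ (m + n + 1) / ((m : ℝ) + 1) =
      1 / ((m + n + 2) * ((m : ℝ) + 1)) := by
    rw [intervalIntegral.integral_div, integral_pow]
    push_cast
    simp
    field_simp
    ring
  rw [e0]
  by_cases h : s = ∞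
  · simp only [h, if_true, invParam_top, ENNReal.mul_top (two_ne_zero)]
    field_simp
    ring
  · have h2 : 2 * s ≠ ∞ := ENNReal.mul_ne_top (by simp) h
    simp only [h, h2, if_false]
    have h1 := natCast_lt_toReal hm h
    have h1' := natCast_lt_toReal hn h
    push_cast at h1 h1'
    have hs0 : s.toReal ≠ 0 := by linarith
    have e3 : 1 - ((m : ℝ) + n + 2) * (invParam s / 2) =
        (2 * s.toReal - (m + n + 2)) / (2 * s.toReal) := by
      rw [invParam, ENNReal.toReal_inv]; field_simp
    rw [one_sub_mul_invParam hs0, one_sub_mul_invParam hs0, e3]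
    have h3 : s.toReal - (m + 1) ≠ 0 := by linarith
    have h4 : s.toReal - (n + 1) ≠ 0 := by linarith
    have h5 : 2 * s.toReal - (m + n + 2) ≠ 0 := by linarith
    have h6 : 2 * s.toReal - (((m + n + 1 : ℕ) : ℝ) + 1) ≠ 0 := by push_cast; linarith
    simp only [Real.one_rpow, ENNReal.toReal_mul, ENNReal.toReal_ofNat]
    push_cast at h6 ⊢
    generalize s.toReal = t at *
    have e7 : 2 * t - (m + n + 1 + 1 : ℝ) = 2 * t - (m + n + 2) := by ring
    rw [e7]
    field_simp
    ring

/-! ### The skew-symmetric form `∫ ∫ F(x) G(y) sgn(y - x) dx dy` -/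

lemma measurable_sign : Measurable Real.sign := by
  have : Real.sign = fun r : ℝ => if r < 0 then (-1 : ℝ) else if 0 < r then 1 else 0 := rfl
  rw [this]
  exact Measurable.ite (measurableSet_lt measurable_id measurable_const) measurable_const
    (Measurable.ite (measurableSet_lt measurable_const measurable_id) measurable_const
      measurable_const)

lemma abs_sign_le_one (r : ℝ) : ‖Real.sign r‖ ≤ 1 := by
  rcases Real.sign_apply_eq r with h | h | h <;> simp [h]

/-- The transform `F ↦ ∫ F(x) sgn(y - x) dx`. -/
noncomputable def signTransform (F : ℝ → ℝ) (y : ℝ) : ℝ := ∫ x, F x * Real.sign (y - x)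

lemma integrable_mul_sign {F : ℝ → ℝ} (hF : Integrable F) (y : ℝ) :
    Integrable fun x => F x * Real.sign (y - x) :=
  hF.mul_bdd (c := 1) (measurable_sign.comp (measurable_const.sub measurable_id)).aestronglyMeasurable
    (ae_of_all _ fun _ => abs_sign_le_one _)

/-- The integral is split at y, where the sign jumps, and both pieces are moved to the base point 0.
This shows continuity in y; for even F the two constants cancel. -/
lemma signTransform_eq {F : ℝ → ℝ} (hF : Integrable F) (y : ℝ) :
    signTransform F y =
      (∫ x in Set.Iic (0 : ℝ), F x) - (∫ x in Set.Ioi (0 : ℝ), F x) + 2 * ∫ x in (0 : ℝ)..y, F x := by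
  have h1 : ∫ x in Set.Iic y, F x * Real.sign (y - x) = ∫ x in Set.Iic y, F x := by
    rw [integral_Iic_eq_integral_Iio, integral_Iic_eq_integral_Iio]
    refine setIntegral_congr_fun measurableSet_Iio fun x hx => ?_
    simp [Real.sign_of_pos (sub_pos.2 hx)]
  have h2 : ∫ x in Set.Ioi y, F x * Real.sign (y - x) = -∫ x in Set.Ioi y, F x := by
    rw [← integral_neg]
    refine setIntegral_congr_fun measurableSet_Ioi fun x hx => ?_
    simp [Real.sign_of_neg (sub_neg.2 hx)]
  have h3 := intervalIntegral.integral_Iic_sub_Iic (a := 0) (b := y) hF.integrableOn hF.integrableOn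
  have h4 := intervalIntegral.integral_Ioi_sub_Ioi' (a := 0) (b := y) hF.integrableOn hF.integrableOn
  rw [signTransform, ← intervalIntegral.integral_Iic_add_Ioi
    (integrable_mul_sign hF y).integrableOn (integrable_mul_sign hF y).integrableOn, h1, h2]
  linarith

lemma continuous_signTransform {F : ℝ → ℝ} (hF : Integrable F) : Continuous (signTransform F) := by
  rw [funext (signTransform_eq hF)]
  exact continuous_const.add (continuous_const.mul (hF.continuous_primitive 0))

lemma norm_signTransform_le {F : ℝ → ℝ} (hF : Integrable F) (y : ℝ) :
    ‖signTransform F y‖ ≤ ∫ x, ‖F x‖ := by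
  refine norm_integral_le_of_norm_le hF.norm (ae_of_all _ fun x => ?_)
  rw [norm_mul]
  exact mul_le_of_le_one_right (norm_nonneg _) (abs_sign_le_one _)

/-- The skew-symmetric form `∫ ∫ F(x) G(y) sgn(y - x) dx dy`. -/
noncomputable def signForm (F G : ℝ → ℝ) : ℝ := ∫ y, signTransform F y * G y

lemma integrable_signTransform_mul {F G : ℝ → ℝ} (hF : Integrable F) (hG : Integrable G) :
    Integrable fun y => signTransform F y * G y :=
  hG.bdd_mul (continuous_signTransform hF).aestronglyMeasurable
    (ae_of_all _ fun y => norm_signTransform_le hF y)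

/-- Fubini, since the sign is odd. Integrability of F and G makes the double integral absolutely
convergent. -/
lemma signForm_swap {F G : ℝ → ℝ} (hF : Integrable F) (hG : Integrable G) :
    signForm F G = -signForm G F := by
  have h : Integrable (Function.uncurry fun y x => F x * Real.sign (y - x) * G y)
      (volume.prod volume) := by
    have h1 := (hG.mul_prod hF).mul_bdd (c := 1) (g := fun z : ℝ × ℝ => Real.sign (z.1 - z.2))
      (measurable_sign.comp (measurable_fst.sub measurable_snd)).aestronglyMeasurable
      (ae_of_all _ fun _ => abs_sign_le_one _)
    refine h1.congr (ae_of_all _ fun z => ?_)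
    simp only [Function.uncurry]
    ring
  calc signForm F G = ∫ y, ∫ x, F x * Real.sign (y - x) * G y := by
        simp only [signForm, signTransform, integral_mul_const]
    _ = ∫ x, ∫ y, F x * Real.sign (y - x) * G y := integral_integral_swap h
    _ = -signForm G F := by
        simp only [signForm, signTransform, ← integral_mul_const, ← integral_neg]
        refine integral_congr_ae (ae_of_all _ fun x => integral_congr_ae (ae_of_all _ fun y => ?_))
        have : Real.sign (y - x) = -Real.sign (x - y) := by rw [← Real.sign_neg, neg_sub]
        simp only [this]
        ring

lemma signForm_sum {ι κ : Type*} (I : Finset ι) (K : Finset κ) (a : ι → ℝ) (b : κ → ℝ)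
    {F : ι → ℝ → ℝ} {G : κ → ℝ → ℝ} (hF : ∀ i ∈ I, Integrable (F i))
    (hG : ∀ k ∈ K, Integrable (G k)) :
    signForm (fun x => ∑ i ∈ I, a i * F i x) (fun y => ∑ k ∈ K, b k * G k y) =
      ∑ i ∈ I, ∑ k ∈ K, a i * b k * signForm (F i) (G k) := by
  have h1 : ∀ y, signTransform (fun x => ∑ i ∈ I, a i * F i x) y =
      ∑ i ∈ I, a i * signTransform (F i) y := by
    intro y
    simp only [signTransform, Finset.sum_mul, mul_assoc]
    rw [integral_finsetSum]
    · simp only [integral_const_mul]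
    · exact fun i hi => (integrable_mul_sign (hF i hi) y).const_mul _
  have h2 : ∀ i ∈ I, ∀ k ∈ K, Integrable fun y => a i * b k * (signTransform (F i) y * G k y) :=
    fun i hi k hk => (integrable_signTransform_mul (hF i hi) (hG k hk)).const_mul _
  simp only [signForm, h1, Finset.sum_mul_sum]
  have h3 : ∀ y, ∑ i ∈ I, ∑ k ∈ K, a i * signTransform (F i) y * (b k * G k y) =
      ∑ i ∈ I, ∑ k ∈ K, a i * b k * (signTransform (F i) y * G k y) := fun y =>
    Finset.sum_congr rfl fun i _ => Finset.sum_congr rfl fun k _ => by ring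
  simp only [h3]
  rw [integral_finsetSum _ fun i hi => integrable_finsetSum _ fun k hk => h2 i hi k hk]
  refine Finset.sum_congr rfl fun i hi => ?_
  rw [integral_finsetSum _ fun k hk => h2 i hi k hk]
  simp only [integral_const_mul]

lemma signTransform_neg (F : ℝ → ℝ) (c : ℝ) (hc : ∀ x, F (-x) = c * F x) (y : ℝ) :
    signTransform F (-y) = -c * signTransform F y := by
  rw [signTransform, ← integral_neg_eq_self, signTransform, ← integral_const_mul]
  refine integral_congr_ae (ae_of_all _ fun x => ?_)
  have : Real.sign (-y - -x) = -Real.sign (y - x) := by rw [← Real.sign_neg]; congr 1; ring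
  simp only [hc, this]
  ring

lemma signForm_eq_zero (F G : ℝ → ℝ) (c : ℝ) (hc : c * c = 1) (hF : ∀ x, F (-x) = c * F x)
    (hG : ∀ x, G (-x) = c * G x) : signForm F G = 0 := by
  have : signForm F G = -signForm F G := by
    conv_lhs => rw [signForm, ← integral_neg_eq_self]
    rw [signForm, ← integral_neg]
    refine integral_congr_ae (ae_of_all _ fun y => ?_)
    simp only [signTransform_neg F c hF, hG]
    linear_combination (-(signTransform F y * G y)) * hc
  linarith

/-- For even F the transform is twice the primitive from 0, an odd function. Its product with the
odd G is even, so the line folds onto the half-line and contributes another factor 2. -/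
lemma signForm_even_odd {F G : ℝ → ℝ} (hFi : Integrable F) (hF : ∀ x, F (-x) = F x)
    (hG : ∀ x, G (-x) = -G x) :
    signForm F G = 4 * ∫ y in Set.Ioi (0 : ℝ), G y * ∫ x in (0 : ℝ)..y, F x := by
  have h0 : ∫ x in Set.Iic (0 : ℝ), F x = ∫ x in Set.Ioi (0 : ℝ), F x := by
    have := integral_comp_neg_Iic 0 F
    simpa [hF] using this
  have h1 : ∀ y, signTransform F y = 2 * ∫ x in (0 : ℝ)..y, F x := fun y => by
    rw [signTransform_eq hFi, h0]; ring
  have h2 : ∀ y, signTransform F y * G y = signTransform F |y| * G |y| := by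
    intro y
    rcases abs_cases y with ⟨h, -⟩ | ⟨h, -⟩
    · rw [h]
    · rw [h, signTransform_neg F 1 (by simpa using hF), hG]; ring
  rw [signForm, integral_congr_ae (ae_of_all _ h2),
    integral_comp_abs (f := fun y => signTransform F y * G y)]
  simp only [h1]
  rw [← integral_const_mul, ← integral_const_mul]
  refine setIntegral_congr_fun measurableSet_Ioi fun y _ => ?_
  ring

/-! ### The real part of the form on monomials -/

lemma integrable_weight_mul_pow {s : ℝ≥0∞} {m : ℕ} (hm : ((m + 1 : ℕ) : ℝ≥0∞) < s) :
    Integrable fun x : ℝ => weight s x * x ^ m := by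
  have h : Integrable fun x : ℝ => ‖x‖ ^ m * weight s ((‖x‖ : ℝ) : ℂ) := by
    have := (integrable_fun_norm_addHaar (E := ℝ) (volume : Measure ℝ)
      (f := fun r => r ^ m * weight s (r : ℂ))).2
    refine this ?_
    simpa using integrableOn_pow_mul_weight hm
  refine h.mono' ((measurable_weight_ofReal s).mul (measurable_id.pow_const m)).aestronglyMeasurable
    (ae_of_all _ fun x => ?_)
  rw [norm_mul, norm_pow, weight_eq_weight_norm, Complex.norm_real,
    Real.norm_of_nonneg (weight_nonneg _ _), mul_comm]

lemma weight_ofReal_neg (s : ℝ≥0∞) (x : ℝ) : weight s ((-x : ℝ) : ℂ) = weight s (x : ℂ) := by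
  simp [weight]

/-- The value of `⟨x ^ m | x ^ n⟩_ℝ` for even `m` and odd `n`. -/
lemma signForm_monomial {s : ℝ≥0∞} {m n : ℕ} (hm : ((m + 1 : ℕ) : ℝ≥0∞) < s)
    (hn : ((n + 1 : ℕ) : ℝ≥0∞) < s) (hme : Even m) (hno : Odd n) :
    signForm (fun x : ℝ => weight s x * x ^ m) (fun x : ℝ => weight s x * x ^ n) =
      4 / (((m : ℝ) + 1) * ((n : ℝ) - m) * (1 - (n + 1) * invParam s)) -
        8 / (((n : ℝ) - m) * (m + n + 2) * (1 - (m + n + 2) * (invParam s / 2))) := by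
  have hmn : m ≠ n := by rintro rfl; exact (Nat.not_even_iff_odd.2 hno) hme
  rw [signForm_even_odd (integrable_weight_mul_pow hm) (fun x => by
    simp only [weight_ofReal_neg, hme.neg_pow]) (fun x => by
    simp only [weight_ofReal_neg, hno.neg_pow, mul_neg])]
  have := integral_pow_mul_weight_mul_primitive hm hn hmn
  simp only [mul_comm (weight s _)]
  rw [this]
  ring

/-! ### The complex part of the form on monomials -/

/-- The integral of `conj z ^ m z ^ n sgn(Im z)` against the squared weight. -/
noncomputable def complexForm (s : ℝ≥0∞) (m n : ℕ) : ℂ :=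
  ∫ z : ℂ, ((weight s z ^ 2 : ℝ) : ℂ) * conj (z ^ m) * z ^ n * (Real.sign z.im : ℂ)

lemma natCast_lt_two_mul {s : ℝ≥0∞} {m n : ℕ} (hm : ((m + 1 : ℕ) : ℝ≥0∞) < s)
    (hn : ((n + 1 : ℕ) : ℝ≥0∞) < s) : ((m + n + 1 + 1 : ℕ) : ℝ≥0∞) < 2 * s := by
  have := ENNReal.add_lt_add hm hn
  rw [two_mul]
  convert! this using 1
  push_cast
  ring

lemma integrable_norm_pow_mul_weight_sq {s : ℝ≥0∞} {j : ℕ} (h : ((j + 1 + 1 : ℕ) : ℝ≥0∞) < 2 * s) :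
    Integrable fun z : ℂ => ‖z‖ ^ j * weight s z ^ 2 := by
  have h : Integrable fun z : ℂ => ‖z‖ ^ j * weight (2 * s) ((‖z‖ : ℝ) : ℂ) := by
    have := (integrable_fun_norm_addHaar (E := ℂ) (volume : Measure ℂ)
      (f := fun r => r ^ j * weight (2 * s) (r : ℂ))).2
    refine this ?_
    refine (integrableOn_pow_mul_weight h).congr_fun (fun r _ => ?_) measurableSet_Ioi
    simp [Complex.finrank_real_complex]
    ring
  refine h.congr (ae_of_all _ fun z => ?_)
  simp only [weight_sq]
  rw [← weight_eq_weight_norm]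

lemma integrable_complexForm {s : ℝ≥0∞} {m n : ℕ} (hm : ((m + 1 : ℕ) : ℝ≥0∞) < s)
    (hn : ((n + 1 : ℕ) : ℝ≥0∞) < s) :
    Integrable fun z : ℂ => ((weight s z ^ 2 : ℝ) : ℂ) * conj (z ^ m) * z ^ n *
      (Real.sign z.im : ℂ) := by
  refine (integrable_norm_pow_mul_weight_sq (natCast_lt_two_mul hm hn)).mono' ?_
    (ae_of_all _ fun z => ?_)
  · refine Measurable.aestronglyMeasurable ?_
    refine ((Measurable.mul ?_ ?_).mul (measurable_id.pow_const n)).mul ?_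
    · exact Complex.measurable_ofReal.comp ((measurable_weight s).pow_const 2)
    · exact Complex.continuous_conj.measurable.comp (measurable_id.pow_const m)
    · exact Complex.measurable_ofReal.comp (measurable_sign.comp Complex.measurable_im)
  · rw [norm_mul, norm_mul, norm_mul, Complex.norm_real, Complex.norm_real, RCLike.norm_conj,
      Real.norm_of_nonneg (by positivity : 0 ≤ weight s z ^ 2), norm_pow, norm_pow, pow_add]
    calc _ ≤ weight s z ^ 2 * ‖z‖ ^ m * ‖z‖ ^ n * 1 := by
          gcongr
          exact abs_sign_le_one _
      _ = _ := by ring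

lemma sign_sin {θ : ℝ} (hθ : θ ∈ Set.Ioo (-Real.pi) Real.pi) :
    Real.sign (Real.sin θ) = Real.sign θ := by
  rcases lt_trichotomy θ 0 with h | h | h
  · rw [Real.sign_of_neg h, Real.sign_of_neg (Real.sin_neg_of_neg_of_neg_pi_lt h hθ.1)]
  · simp [h]
  · rw [Real.sign_of_pos h, Real.sign_of_pos (Real.sin_pos_of_pos_of_lt_pi h hθ.2)]

/-- These are the Fourier coefficients of the square wave; they account for the denominators n - m
in the planar part of the form. -/
lemma integral_exp_mul_sign (d : ℤ) :
    ∫ θ in Set.Ioo (-Real.pi) Real.pi, Complex.exp (d * Complex.I * θ) * (Real.sign θ : ℂ) =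
      if Even d then 0 else 4 * Complex.I / d := by
  have hpi := Real.pi_pos
  have hc : Continuous fun θ : ℝ => Complex.exp (d * Complex.I * θ) := by fun_prop
  have hi : IntegrableOn (fun θ : ℝ => Complex.exp (d * Complex.I * θ) * (Real.sign θ : ℂ))
      (Set.Ioc (-Real.pi) Real.pi) := by
    refine Integrable.mul_bdd (c := 1) (hc.integrableOn_Ioc)
      (Complex.measurable_ofReal.comp measurable_sign).aestronglyMeasurable
      (ae_of_all _ fun θ => ?_)
    rw [Complex.norm_real]
    exact abs_sign_le_one _
  have hi' : ∀ a b, -Real.pi ≤ a → a ≤ b → b ≤ Real.pi → IntervalIntegrable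
      (fun θ : ℝ => Complex.exp (d * Complex.I * θ) * (Real.sign θ : ℂ)) volume a b :=
    fun a b h1 h2 h3 => (intervalIntegrable_iff_integrableOn_Ioc_of_le h2).2
      (hi.mono_set (Set.Ioc_subset_Ioc h1 h3))
  rw [← integral_Ioc_eq_integral_Ioo, ← intervalIntegral.integral_of_le (by linarith),
    ← intervalIntegral.integral_add_adjacent_intervals (b := 0)
      (hi' _ _ le_rfl (by linarith) hpi.le) (hi' _ _ (by linarith) hpi.le le_rfl)]
  have h1 : ∫ θ in (-Real.pi)..0, Complex.exp (d * Complex.I * θ) * (Real.sign θ : ℂ) =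
      -∫ θ in (-Real.pi)..0, Complex.exp (d * Complex.I * θ) := by
    rw [intervalIntegral.integral_of_le (by linarith), intervalIntegral.integral_of_le (by linarith),
      integral_Ioc_eq_integral_Ioo, integral_Ioc_eq_integral_Ioo, ← integral_neg]
    refine setIntegral_congr_fun measurableSet_Ioo fun θ hθ => ?_
    simp [Real.sign_of_neg hθ.2]
  have h2 : ∫ θ in (0 : ℝ)..Real.pi, Complex.exp (d * Complex.I * θ) * (Real.sign θ : ℂ) =
      ∫ θ in (0 : ℝ)..Real.pi, Complex.exp (d * Complex.I * θ) := by
    rw [intervalIntegral.integral_of_le hpi.le, intervalIntegral.integral_of_le hpi.le]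
    refine setIntegral_congr_fun measurableSet_Ioc fun θ hθ => ?_
    simp [Real.sign_of_pos hθ.1]
  rw [h1, h2]
  by_cases hd : d = 0
  · simp [hd]
  have hd' : (d : ℂ) * Complex.I ≠ 0 := mul_ne_zero (by exact_mod_cast hd) Complex.I_ne_zero
  rw [integral_exp_mul_complex hd', integral_exp_mul_complex hd']
  have e1 : Complex.exp (d * Complex.I * (Real.pi : ℝ)) = (-1) ^ d := by
    rw [mul_assoc, Complex.exp_int_mul, mul_comm Complex.I, Complex.exp_pi_mul_I]
  have e2 : Complex.exp (d * Complex.I * ((-Real.pi : ℝ) : ℂ)) = (-1) ^ d := by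
    have : (d * Complex.I * ((-Real.pi : ℝ) : ℂ) : ℂ) = -(d * Complex.I * (Real.pi : ℝ)) := by
      push_cast; ring
    rw [this, Complex.exp_neg, e1, ← zpow_neg, ← inv_neg_one, inv_zpow, zpow_neg, inv_inv]
    norm_num
  rw [e1, e2]
  have hd0 : (d : ℂ) ≠ 0 := by exact_mod_cast hd
  split_ifs with h
  · simp [h.neg_one_zpow]
  · rw [(Int.not_even_iff_odd.1 h).neg_one_zpow]
    simp
    field_simp
    rw [Complex.I_sq]
    ring

lemma complexForm_eq {s : ℝ≥0∞} {m n : ℕ} (hm : ((m + 1 : ℕ) : ℝ≥0∞) < s)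
    (hn : ((n + 1 : ℕ) : ℝ≥0∞) < s) :
    complexForm s m n = ((1 / ((m + n + 2) * (1 - (m + n + 2) * (invParam s / 2))) : ℝ) : ℂ) *
      if Even ((n : ℤ) - m) then 0 else 4 * Complex.I / ((n : ℤ) - m : ℤ) := by
  rw [complexForm, ← Complex.integral_comp_polarCoord_symm, ← integral_exp_mul_sign]
  have e : Set.EqOn (fun p : ℝ × ℝ => p.1 • (((weight s (Complex.polarCoord.symm p) ^ 2 : ℝ) : ℂ) *
      conj (Complex.polarCoord.symm p ^ m) * Complex.polarCoord.symm p ^ n *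
      (Real.sign (Complex.polarCoord.symm p).im : ℂ)))
      (fun p => ((p.1 ^ (m + n + 1) * weight (2 * s) (p.1 : ℂ) : ℝ) : ℂ) *
        (Complex.exp (((n : ℤ) - m : ℤ) * Complex.I * p.2) * (Real.sign p.2 : ℂ)))
      polarCoord.target := by
    rintro ⟨r, θ⟩ ⟨hr, hθ⟩
    have hr : 0 < r := hr
    have h1 : Complex.polarCoord.symm (r, θ) = r * Complex.exp (θ * Complex.I) := by
      rw [Complex.polarCoord_symm_apply, Complex.exp_mul_I]
      push_cast
      rfl
    have h2 : (Complex.polarCoord.symm (r, θ)).im = r * Real.sin θ := by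
      simp [Complex.polarCoord_symm_apply, -Complex.ofReal_cos, -Complex.ofReal_sin]
    have h3 : Real.sign (r * Real.sin θ) = Real.sign θ := by
      rw [← sign_sin hθ]
      rcases lt_trichotomy (Real.sin θ) 0 with h | h | h
      · rw [Real.sign_of_neg h, Real.sign_of_neg (mul_neg_of_pos_of_neg hr h)]
      · simp [h]
      · rw [Real.sign_of_pos h, Real.sign_of_pos (mul_pos hr h)]
    have h4 : conj (Complex.exp (θ * Complex.I)) = Complex.exp (-(θ * Complex.I)) := by
      rw [← Complex.exp_conj]; simp
    have h5 : Complex.exp (((n : ℤ) - m : ℤ) * Complex.I * θ) =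
        Complex.exp (-(θ * Complex.I)) ^ m * Complex.exp (θ * Complex.I) ^ n := by
      rw [← Complex.exp_nat_mul, ← Complex.exp_nat_mul, ← Complex.exp_add]
      congr 1
      push_cast
      ring
    simp only [h2, h3]
    rw [weight_sq, weight_eq_weight_norm, Complex.norm_polarCoord_symm, abs_of_pos hr, h1, h5]
    simp only [mul_pow, map_mul, map_pow, Complex.conj_ofReal, h4, Complex.real_smul]
    push_cast
    ring
  have hmeas : MeasurableSet polarCoord.target := polarCoord.open_target.measurableSet
  rw [setIntegral_congr_fun hmeas e, polarCoord_target, Measure.volume_eq_prod,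
    setIntegral_prod_mul (fun r : ℝ => ((r ^ (m + n + 1) * weight (2 * s) (r : ℂ) : ℝ) : ℂ))
      (fun θ : ℝ => Complex.exp (((n : ℤ) - m : ℤ) * Complex.I * θ) * (Real.sign θ : ℂ))]
  congr 1
  rw [integral_complex_ofReal, integral_pow_mul_weight (natCast_lt_two_mul hm hn), invParam_two_mul]
  push_cast
  ring_nf

/-! ### The form on sums of monomials -/

lemma skewReal_eq_signForm (s : ℝ≥0∞) (f g : Polynomial ℝ) : skewReal s f g =
    signForm (fun x => weight s (x : ℂ) * f.eval x) (fun y => weight s (y : ℂ) * g.eval y) := by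
  simp only [skewReal, signForm, signTransform, ← integral_mul_const]
  refine integral_congr_ae (ae_of_all _ fun y => integral_congr_ae (ae_of_all _ fun x => ?_))
  ring

/-- The form is bilinear on polynomials of degree less than `N < s`. -/
lemma skew_sum {ι κ : Type*} {s : ℝ≥0∞} {N : ℕ} (hs : (N : ℝ≥0∞) < s) (I : Finset ι)
    (K : Finset κ) (a : ι → ℝ) (b : κ → ℝ) {d : ι → ℕ} {e : κ → ℕ} (hd : ∀ i ∈ I, d i < N)
    (he : ∀ k ∈ K, e k < N) :
    skew s (∑ i ∈ I, Polynomial.C (a i) * Polynomial.X ^ d i)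
      (∑ k ∈ K, Polynomial.C (b k) * Polynomial.X ^ e k) =
    ∑ i ∈ I, ∑ k ∈ K, ((a i * b k : ℝ) : ℂ) *
      skew s (Polynomial.X ^ d i) (Polynomial.X ^ e k) := by
  have hlt : ∀ j < N, ((j + 1 : ℕ) : ℝ≥0∞) < s := fun j hj =>
    lt_of_le_of_lt (by exact_mod_cast hj) hs
  have hR : skewReal s (∑ i ∈ I, Polynomial.C (a i) * Polynomial.X ^ d i)
      (∑ k ∈ K, Polynomial.C (b k) * Polynomial.X ^ e k) =
      ∑ i ∈ I, ∑ k ∈ K, a i * b k * skewReal s (Polynomial.X ^ d i) (Polynomial.X ^ e k) := by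
    simp only [skewReal_eq_signForm, Polynomial.eval_pow, Polynomial.eval_X]
    rw [← signForm_sum I K a b (fun i hi => integrable_weight_mul_pow (hlt _ (hd i hi)))
      (fun k hk => integrable_weight_mul_pow (hlt _ (he k hk)))]
    congr 1 <;>
    · funext x
      simp only [Polynomial.eval_finsetSum, Polynomial.eval_mul, Polynomial.eval_C,
        Polynomial.eval_pow, Polynomial.eval_X, Finset.mul_sum]
      exact Finset.sum_congr rfl fun i _ => by ring
  have hC : skewComplex s (∑ i ∈ I, Polynomial.C (a i) * Polynomial.X ^ d i)
      (∑ k ∈ K, Polynomial.C (b k) * Polynomial.X ^ e k) =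
      ∑ i ∈ I, ∑ k ∈ K, ((a i * b k : ℝ) : ℂ) *
        skewComplex s (Polynomial.X ^ d i) (Polynomial.X ^ e k) := by
    have h2 : ∀ i ∈ I, ∀ k ∈ K, Integrable fun z : ℂ => ((a i * b k : ℝ) : ℂ) *
        (((weight s z ^ 2 : ℝ) : ℂ) * conj (z ^ d i) * z ^ e k * (Real.sign z.im : ℂ)) :=
      fun i hi k hk =>
        (integrable_complexForm (hlt _ (hd i hi)) (hlt _ (he k hk))).const_mul _
    have h3 : ∀ z : ℂ, ((weight s z ^ 2 : ℝ) : ℂ) *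
        conj (Polynomial.aeval z (∑ i ∈ I, Polynomial.C (a i) * Polynomial.X ^ d i)) *
        Polynomial.aeval z (∑ k ∈ K, Polynomial.C (b k) * Polynomial.X ^ e k) *
          (Real.sign z.im : ℂ) =
        ∑ i ∈ I, ∑ k ∈ K, ((a i * b k : ℝ) : ℂ) *
        (((weight s z ^ 2 : ℝ) : ℂ) * conj (z ^ d i) * z ^ e k * (Real.sign z.im : ℂ)) := by
      intro z
      simp only [map_sum, map_mul, map_pow, Polynomial.aeval_C, Polynomial.aeval_X,
        Complex.coe_algebraMap, Complex.conj_ofReal]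
      rw [mul_assoc ((weight s z ^ 2 : ℝ) : ℂ), Finset.sum_mul_sum, Finset.mul_sum, Finset.sum_mul]
      refine Finset.sum_congr rfl fun i _ => ?_
      rw [Finset.mul_sum, Finset.sum_mul]
      refine Finset.sum_congr rfl fun k _ => ?_
      push_cast
      ring
    simp only [skewComplex, h3]
    simp only [map_pow, Polynomial.aeval_X] at h2 ⊢
    rw [integral_finsetSum _ fun i hi => integrable_finsetSum _ fun k hk => h2 i hi k hk,
      Finset.mul_sum]
    refine Finset.sum_congr rfl fun i hi => ?_
    rw [integral_finsetSum _ fun k hk => h2 i hi k hk, Finset.mul_sum]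
    refine Finset.sum_congr rfl fun k hk => ?_
    rw [integral_const_mul]
    ring
  rw [skew, hR, hC]
  push_cast
  rw [← Finset.sum_add_distrib]
  refine Finset.sum_congr rfl fun i _ => ?_
  rw [← Finset.sum_add_distrib]
  refine Finset.sum_congr rfl fun k _ => ?_
  rw [skew]
  ring

lemma skewComplex_monomial (s : ℝ≥0∞) (m n : ℕ) :
    skewComplex s (Polynomial.X ^ m) (Polynomial.X ^ n) = -2 * Complex.I * complexForm s m n := by
  simp [skewComplex, complexForm]

lemma skewReal_monomial (s : ℝ≥0∞) (m n : ℕ) :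
    skewReal s (Polynomial.X ^ m) (Polynomial.X ^ n) =
      signForm (fun x : ℝ => weight s x * x ^ m) (fun x : ℝ => weight s x * x ^ n) := by
  simp [skewReal_eq_signForm]

lemma skew_monomial_swap {s : ℝ≥0∞} {m n : ℕ} (hm : ((m + 1 : ℕ) : ℝ≥0∞) < s)
    (hn : ((n + 1 : ℕ) : ℝ≥0∞) < s) :
    skew s (Polynomial.X ^ m) (Polynomial.X ^ n) =
      -skew s (Polynomial.X ^ n) (Polynomial.X ^ m) := by
  rw [skew, skew, skewReal_monomial, skewReal_monomial,
    signForm_swap (integrable_weight_mul_pow hm) (integrable_weight_mul_pow hn),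
    skewComplex_monomial, skewComplex_monomial, complexForm_eq hm hn, complexForm_eq hn hm]
  have e : (m : ℤ) - n = -((n : ℤ) - m) := by ring
  simp only [e, even_neg]
  split_ifs
  · push_cast; ring
  · push_cast
    rw [div_neg]
    ring_nf

lemma skew_monomial_same_parity {s : ℝ≥0∞} {m n : ℕ} (hm : ((m + 1 : ℕ) : ℝ≥0∞) < s)
    (hn : ((n + 1 : ℕ) : ℝ≥0∞) < s) (h : Even m ↔ Even n) :
    skew s (Polynomial.X ^ m) (Polynomial.X ^ n) = 0 := by
  have h1 : Even ((n : ℤ) - m) := by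
    rw [Int.even_sub, Int.even_coe_nat, Int.even_coe_nat, h]
  rw [skew, skewComplex_monomial, complexForm_eq hm hn, if_pos h1, skewReal_monomial]
  have : signForm (fun x : ℝ => weight s x * x ^ m) (fun x : ℝ => weight s x * x ^ n) = 0 := by
    refine signForm_eq_zero _ _ ((-1) ^ m) (by rw [← mul_pow]; simp) (fun x => ?_) (fun x => ?_)
    · rw [weight_ofReal_neg, neg_pow]; ring
    · have : ((-1 : ℝ)) ^ m = (-1) ^ n := by
        by_cases hm' : Even m
        · rw [hm'.neg_one_pow, (h.1 hm').neg_one_pow]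
        · rw [(Nat.not_even_iff_odd.1 hm').neg_one_pow,
            (Nat.not_even_iff_odd.1 (fun h' => hm' (h.2 h'))).neg_one_pow]
      rw [weight_ofReal_neg, this, neg_pow]; ring
  simp [this]

/-- The planar part is -2i times 4i/(n-m) times a radial integral with parameter 2s. This is the
exact negative of the second term of the real part. What remains factors in m, n and s apart from n
- m, and therefore explicit skew-orthonormal polynomials exist. -/
lemma skew_monomial_even_odd {s : ℝ≥0∞} {m n : ℕ} (hm : ((m + 1 : ℕ) : ℝ≥0∞) < s)
    (hn : ((n + 1 : ℕ) : ℝ≥0∞) < s) (hme : Even m) (hno : Odd n) :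
    skew s (Polynomial.X ^ m) (Polynomial.X ^ n) =
      ((4 / (((m : ℝ) + 1) * ((n : ℝ) - m) * (1 - (n + 1) * invParam s)) : ℝ) : ℂ) := by
  have h1 : ¬ Even ((n : ℤ) - m) := by
    rw [Int.even_sub, Int.even_coe_nat, Int.even_coe_nat]
    simp [hme, hno]
  rw [skew, skewComplex_monomial, complexForm_eq hm hn, if_neg h1, skewReal_monomial,
    signForm_monomial hm hn hme hno]
  push_cast
  rw [sub_add, sub_eq_self]
  have hI := Complex.I_mul_I
  simp only [div_eq_mul_inv, mul_inv, one_mul]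
  linear_combination (8 * ((n : ℂ) - m)⁻¹ * ((m : ℂ) + n + 2)⁻¹ *
    (1 - ((m : ℂ) + n + 2) * (invParam s * 2⁻¹))⁻¹) * hI

/-! ### Skew-orthonormality -/

/-- In the recurrence the factor on the right is l - n. It vanishes at n = l, and the factor on the
left never does because it is a half-integer, so all later terms are 0. -/
lemma resolventSum_half_eq_zero {l n : ℕ} (h : l < n) :
    resolventSum (1 / 2) (1 / 2) (l + 1 / 2) 1 n = 0 := by
  have hne : ∀ k : ℕ, (l : ℝ) + 1 / 2 - k * 1 ≠ 0 := by
    intro k hk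
    have : (2 * l + 1 : ℝ) = 2 * k := by linarith
    have : 2 * l + 1 = 2 * k := by exact_mod_cast this
    omega
  obtain ⟨n, rfl⟩ : ∃ m, n = m + 1 := ⟨n - 1, by omega⟩
  have key : ∀ n, l ≤ n → resolventSum (1 / 2) (1 / 2) (l + 1 / 2) 1 (n + 1) = 0 := by
    intro n hn
    have hr := fun n => resolventSum_succ (p := 1 / 2) (q := 1 / 2) (by norm_num) (n := n)
      (fun k _ => hne k)
    have hn1 := hne (n + 1)
    push_cast at hn1
    induction n, hn using Nat.le_induction with
    | base =>
      have := hr l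
      have e : (l : ℝ) + 1 / 2 - (l + 1 / 2) * 1 = 0 := by ring
      rw [e, zero_mul] at this
      exact (mul_eq_zero.1 this).resolve_left hn1
    | succ n _ ih =>
      have h2 := hr (n + 1)
      have h3 := hne (n + 1)
      push_cast at h2 h3 hn1
      rw [ih h3, mul_zero] at h2
      exact (mul_eq_zero.1 h2).resolve_left hn1
  exact key n (by omega)

/-- With q = -1/2 and α = k - 1/2 the right factor of the recurrence is k - n, which vanishes at n =
k. -/
lemma resolventSum_three_halves_eq_zero {k n : ℕ} (h : k < n) :
    resolventSum (3 / 2) (-1 / 2) (k - 1 / 2) 1 n = 0 := by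
  have hne : ∀ l : ℕ, (k : ℝ) - 1 / 2 - l * 1 ≠ 0 := by
    intro l hl
    have : (2 * k : ℝ) = 2 * l + 1 := by linarith
    have : 2 * k = 2 * l + 1 := by exact_mod_cast this
    omega
  obtain ⟨n, rfl⟩ : ∃ m, n = m + 1 := ⟨n - 1, by omega⟩
  have key : ∀ n, k ≤ n → resolventSum (3 / 2) (-1 / 2) (k - 1 / 2) 1 (n + 1) = 0 := by
    intro n hn
    have hr := fun n => resolventSum_succ (p := 3 / 2) (q := -1 / 2) (by norm_num) (n := n)
      (fun k _ => hne k)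
    have hn1 := hne (n + 1)
    push_cast at hn1
    induction n, hn using Nat.le_induction with
    | base =>
      have := hr k
      have e : (k : ℝ) - 1 / 2 - (k + -1 / 2) * 1 = 0 := by ring
      rw [e, zero_mul] at this
      exact (mul_eq_zero.1 this).resolve_left hn1
    | succ n _ ih =>
      have h2 := hr (n + 1)
      have h3 := hne (n + 1)
      push_cast at h2 h3 hn1
      rw [ih h3, mul_zero] at h2
      exact (mul_eq_zero.1 h2).resolve_left hn1
  exact key n (by omega)

/-- This is the normalisation. Here α depends on m, so the recurrence does not apply directly;
reversing the order of summation gives the fixed parameter α = 1/2. The recurrence factor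
(n+1)/(n+1/2) is then the inverse of the ratio of consecutive B, and the product is constant. -/
lemma coeffB_mul_resolventSum (m : ℕ) :
    coeffB m * resolventSum (3 / 2) (-1 / 2) (m - 1 / 2) 1 m = -2 := by
  have h1 : resolventSum (3 / 2) (-1 / 2) (m - 1 / 2) 1 m =
      -resolventSum (-1 / 2) (3 / 2) (1 / 2) 1 m := by
    rw [resolventSum, ← Finset.sum_range_reflect, resolventSum, ← Finset.sum_neg_distrib]
    refine Finset.sum_congr rfl fun k hk => ?_
    have hk' : k ≤ m := by simpa [Nat.lt_succ_iff] using hk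
    have e : m + 1 - 1 - k = m - k := by omega
    rw [e, Nat.sub_sub_self hk', Nat.cast_sub hk', ← div_neg]
    congr 1
    · ring
    · ring
  have h2 : ∀ m, coeffB m * resolventSum (-1 / 2) (3 / 2) (1 / 2) 1 m = 2 := by
    intro m
    induction m with
    | zero => simp [resolventSum]
    | succ n ih =>
      have hr := resolventSum_succ (p := -1 / 2) (q := 3 / 2) (by norm_num) (α := 1 / 2) (β := 1)
        (n := n) (fun k _ hk => by
          have : (1 : ℝ) = 2 * k := by linarith
          have : 1 = 2 * k := by exact_mod_cast this
          omega)
      have hb := succ_mul_risingCoeff_succ (1 / 2) n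
      have hn : ((n : ℝ) + 1) ≠ 0 := by positivity
      apply mul_left_cancel₀ hn
      rw [← mul_assoc, coeffB, hb]
      linear_combination -(risingCoeff (1 / 2) n) * hr + (n + 1) * ih
  rw [h1, mul_neg, h2]

lemma natCast_succ_lt {s : ℝ≥0∞} {N j : ℕ} (hs : (N : ℝ≥0∞) < s) (hj : j < N) :
    ((j + 1 : ℕ) : ℝ≥0∞) < s :=
  lt_of_le_of_lt (by exact_mod_cast hj) hs

/-- The factor (s-(2l+2))/s in π_{2m+1} cancels the dependence of the form on s, and A_k = (2k+1)
B_k cancels the denominator 2k+1. Only 2l+1-2k is left below. -/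
lemma sum_resolvent {N n m : ℕ} {s : ℝ≥0∞} (hs : (N : ℝ≥0∞) < s) (hn : 2 * n < N)
    (hm : 2 * m + 1 < N) : skew s (skewPolyEven n) (skewPolyOdd s m) =
    ((∑ k ∈ Finset.range (n + 1), ∑ l ∈ Finset.range (m + 1),
      coeffB k * coeffB (n - k) * (coeffA l * coeffC (m - l)) / (2 * l + 1 - 2 * k) : ℝ) : ℂ) := by
  have hk' : ∀ k ∈ Finset.range (n + 1), k ≤ n := fun k hk => by
    simpa [Nat.lt_succ_iff] using hk
  have hl' : ∀ k ∈ Finset.range (m + 1), k ≤ m := fun k hk => by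
    simpa [Nat.lt_succ_iff] using hk
  rw [skewPolyEven_eq, skewPolyOdd_eq, skew_sum hs _ _ _ _
    (fun k hk => by have := hk' k hk; omega) (fun k hk => by have := hl' k hk; omega)]
  rw [Complex.ofReal_sum]
  refine Finset.sum_congr rfl fun k hk => ?_
  rw [Complex.ofReal_sum]
  refine Finset.sum_congr rfl fun l hl => ?_
  have h1 := hk' k hk
  have h2 := hl' l hl
  rw [skew_monomial_even_odd (natCast_succ_lt hs (by omega)) (natCast_succ_lt hs (by omega))
    ⟨k, by ring⟩ ⟨l, rfl⟩, coeffA_eq k, relFactor_eq (pos_of_gt hs).ne']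
  have h3 : ((2 * l + 2 : ℕ) : ℝ) * invParam s < 1 :=
    mul_invParam_lt_one (natCast_succ_lt hs (by omega : 2 * l + 1 < N))
  have h4 : (1 - ((2 * l + 2 : ℕ) : ℝ) * invParam s) ≠ 0 := by linarith
  have h5 : (2 * l + 1 - 2 * k : ℝ) ≠ 0 := by
    intro h
    have : (2 * l + 1 : ℝ) = 2 * k := by linarith
    have : 2 * l + 1 = 2 * k := by exact_mod_cast this
    omega
  have h6 : (2 * k + 1 : ℝ) ≠ 0 := by positivity
  rw [← Complex.ofReal_mul]
  congr 1
  push_cast at h4 ⊢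
  have h7 : (1 - (2 * l + 1 + 1 : ℝ) * invParam s) = 1 - (2 * l + 2) * invParam s := by ring
  rw [h7]
  generalize (1 - (2 * l + 2 : ℝ) * invParam s) = r at *
  generalize (2 * l + 1 - 2 * k : ℝ) = t at *
  field_simp

/-- The polynomials `π_{2n}`, `π_{2m+1}` are skew-orthonormal. -/
lemma skew_skewPolyEven_skewPolyOdd {N n m : ℕ} {s : ℝ≥0∞} (hs : (N : ℝ≥0∞) < s)
    (hn : 2 * n < N) (hm : 2 * m + 1 < N) :
    skew s (skewPolyEven n) (skewPolyOdd s m) = if n = m then 1 else 0 := by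
  rw [sum_resolvent hs hn hm]
  have e : (if n = m then (1 : ℂ) else 0) = ((if n = m then (1 : ℝ) else 0 : ℝ) : ℂ) := by
    split_ifs <;> simp
  rw [e, Complex.ofReal_inj]
  have h1 : ∀ k, ∑ l ∈ Finset.range (m + 1),
      coeffB k * coeffB (n - k) * (coeffA l * coeffC (m - l)) / (2 * l + 1 - 2 * k) =
      coeffB k * coeffB (n - k) * (-1 / 2 * resolventSum (3 / 2) (-1 / 2) (k - 1 / 2) 1 m) := by
    intro k
    rw [resolventSum, Finset.mul_sum, Finset.mul_sum]
    refine Finset.sum_congr rfl fun l _ => ?_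
    have : ((k : ℝ) - 1 / 2 - l * 1) = -1 / 2 * (2 * l + 1 - 2 * k) := by ring
    rw [this, div_mul_eq_div_div, mul_div_assoc, div_div_eq_mul_div]
    ring
  have h2 : ∀ l, ∑ k ∈ Finset.range (n + 1),
      coeffB k * coeffB (n - k) * (coeffA l * coeffC (m - l)) / (2 * l + 1 - 2 * k) =
      coeffA l * coeffC (m - l) * (1 / 2 * resolventSum (1 / 2) (1 / 2) (l + 1 / 2) 1 n) := by
    intro l
    rw [resolventSum, Finset.mul_sum, Finset.mul_sum]
    refine Finset.sum_congr rfl fun k _ => ?_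
    have : ((l : ℝ) + 1 / 2 - k * 1) = 1 / 2 * (2 * l + 1 - 2 * k) := by ring
    rw [this, div_mul_eq_div_div, mul_div_assoc, div_div_eq_mul_div]
    ring
  -- The index to be summed first is the one belonging to the polynomial of larger degree; its inner
  -- sums vanish, except at k = n = m.
  rcases lt_or_ge m n with h | h
  · rw [if_neg h.ne', Finset.sum_comm]
    refine Finset.sum_eq_zero fun l hl => ?_
    rw [h2, resolventSum_half_eq_zero, mul_zero, mul_zero]
    have : l < m + 1 := by simpa using hl
    omega
  · simp only [h1]
    rw [Finset.sum_range_succ, Finset.sum_eq_zero, zero_add]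
    · split_ifs with hnm
      · subst hnm
        have := coeffB_mul_resolventSum n
        simp only [Nat.sub_self, risingCoeff_zero, mul_one]
        linear_combination (-1 / 2) * this
      · rw [resolventSum_three_halves_eq_zero (lt_of_le_of_ne h hnm)]
        simp
    · intro k hk
      have : k < n := by simpa using hk
      rw [resolventSum_three_halves_eq_zero (by omega)]
      simp

lemma natDegree_skewPolyEven_le (n : ℕ) : (skewPolyEven n).natDegree ≤ 2 * n := by
  rw [skewPolyEven_eq]
  refine Polynomial.natDegree_sum_le_of_forall_le _ _ fun k hk => ?_
  refine (Polynomial.natDegree_C_mul_X_pow_le _ _).trans ?_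
  have : k < n + 1 := by simpa using hk
  omega

lemma natDegree_skewPolyOdd_le (s : ℝ≥0∞) (n : ℕ) : (skewPolyOdd s n).natDegree ≤ 2 * n + 1 := by
  rw [skewPolyOdd_eq]
  refine Polynomial.natDegree_sum_le_of_forall_le _ _ fun k hk => ?_
  refine (Polynomial.natDegree_C_mul_X_pow_le _ _).trans ?_
  have : k < n + 1 := by simpa using hk
  omega

/-- The form in terms of coefficients. -/
lemma skew_eq_sum_coeff {s : ℝ≥0∞} {N : ℕ} (hs : (N : ℝ≥0∞) < s) {f g : Polynomial ℝ}
    (hf : f.natDegree < N) (hg : g.natDegree < N) :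
    skew s f g = ∑ i : Fin N, ∑ k : Fin N, ((f.coeff i * g.coeff k : ℝ) : ℂ) *
      skew s (Polynomial.X ^ (i : ℕ)) (Polynomial.X ^ (k : ℕ)) := by
  conv_lhs => rw [f.as_sum_range_C_mul_X_pow' hf, g.as_sum_range_C_mul_X_pow' hg]
  rw [Finset.sum_range, Finset.sum_range]
  exact skew_sum hs _ _ _ _ (fun i _ => i.2) (fun k _ => k.2)

lemma skew_swap {s : ℝ≥0∞} {N : ℕ} (hs : (N : ℝ≥0∞) < s) {f g : Polynomial ℝ}
    (hf : f.natDegree < N) (hg : g.natDegree < N) : skew s f g = -skew s g f := by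
  rw [skew_eq_sum_coeff hs hf hg, skew_eq_sum_coeff hs hg hf, Finset.sum_comm,
    ← Finset.sum_neg_distrib]
  refine Finset.sum_congr rfl fun i _ => ?_
  rw [← Finset.sum_neg_distrib]
  refine Finset.sum_congr rfl fun k _ => ?_
  rw [skew_monomial_swap (natCast_succ_lt hs k.2) (natCast_succ_lt hs i.2), mul_comm (f.coeff _)]
  ring

lemma skew_skewPolyEven_skewPolyEven {N n m : ℕ} {s : ℝ≥0∞} (hs : (N : ℝ≥0∞) < s)
    (hn : 2 * n < N) (hm : 2 * m < N) : skew s (skewPolyEven n) (skewPolyEven m) = 0 := by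
  have h : ∀ n k, k ∈ Finset.range (n + 1) → k ≤ n := fun n k hk => by
    simpa [Nat.lt_succ_iff] using hk
  rw [skewPolyEven_eq, skewPolyEven_eq, skew_sum hs _ _ _ _
    (fun k hk => by have := h n k hk; omega) (fun k hk => by have := h m k hk; omega)]
  refine Finset.sum_eq_zero fun k hk => Finset.sum_eq_zero fun l hl => ?_
  have h1 := h n k hk
  have h2 := h m l hl
  rw [skew_monomial_same_parity (natCast_succ_lt hs (by omega)) (natCast_succ_lt hs (by omega))
    (by simp), mul_zero]

lemma skew_skewPolyOdd_skewPolyOdd {N n m : ℕ} {s : ℝ≥0∞} (hs : (N : ℝ≥0∞) < s)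
    (hn : 2 * n + 1 < N) (hm : 2 * m + 1 < N) :
    skew s (skewPolyOdd s n) (skewPolyOdd s m) = 0 := by
  have h : ∀ n k, k ∈ Finset.range (n + 1) → k ≤ n := fun n k hk => by
    simpa [Nat.lt_succ_iff] using hk
  rw [skewPolyOdd_eq, skewPolyOdd_eq, skew_sum hs _ _ _ _
    (fun k hk => by have := h n k hk; omega) (fun k hk => by have := h m k hk; omega)]
  refine Finset.sum_eq_zero fun k hk => Finset.sum_eq_zero fun l hl => ?_
  have h1 := h n k hk
  have h2 := h m l hl
  rw [skew_monomial_same_parity (natCast_succ_lt hs (by omega)) (natCast_succ_lt hs (by omega))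
    (by simp [parity_simps]), mul_zero]

/-! ### The kernel in terms of the skew-orthonormal polynomials -/

/-- The sequence `π_0, π_1, …`. -/
noncomputable def skewPoly (s : ℝ≥0∞) (i : ℕ) : Polynomial ℝ :=
  if Even i then skewPolyEven (i / 2) else skewPolyOdd s (i / 2)

lemma skewPoly_two_mul (s : ℝ≥0∞) (j : ℕ) : skewPoly s (2 * j) = skewPolyEven j := by
  simp [skewPoly]

lemma skewPoly_two_mul_add_one (s : ℝ≥0∞) (j : ℕ) :
    skewPoly s (2 * j + 1) = skewPolyOdd s j := by
  have : (2 * j + 1) / 2 = j := by omega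
  simp [skewPoly, parity_simps, this]

lemma natDegree_skewPoly_le (s : ℝ≥0∞) (i : ℕ) : (skewPoly s i).natDegree ≤ i := by
  rcases Nat.even_or_odd' i with ⟨j, rfl | rfl⟩
  · rw [skewPoly_two_mul]; exact natDegree_skewPolyEven_le j
  · rw [skewPoly_two_mul_add_one]; exact natDegree_skewPolyOdd_le s j

/-- The index paired with `i`. -/
def partner (i : ℕ) : ℕ := if Even i then i + 1 else i - 1

/-- The sign of `i` in its pair. -/
def pairSign (i : ℕ) : ℂ := if Even i then 1 else -1

lemma partner_two_mul (j : ℕ) : partner (2 * j) = 2 * j + 1 := by simp [partner]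
lemma partner_two_mul_add_one (j : ℕ) : partner (2 * j + 1) = 2 * j := by
  simp [partner, parity_simps]
lemma pairSign_two_mul (j : ℕ) : pairSign (2 * j) = 1 := by simp [pairSign]
lemma pairSign_two_mul_add_one (j : ℕ) : pairSign (2 * j + 1) = -1 := by
  simp [pairSign, parity_simps]

lemma partner_lt {J i : ℕ} (hi : i < 2 * J) : partner i < 2 * J := by
  rcases Nat.even_or_odd' i with ⟨j, rfl | rfl⟩
  · rw [partner_two_mul]; omega
  · rw [partner_two_mul_add_one]; omega

lemma partner_partner (i : ℕ) : partner (partner i) = i := by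
  rcases Nat.even_or_odd' i with ⟨j, rfl | rfl⟩ <;>
  simp [partner_two_mul, partner_two_mul_add_one]

lemma pairSign_partner (i : ℕ) : pairSign (partner i) = -pairSign i := by
  rcases Nat.even_or_odd' i with ⟨j, rfl | rfl⟩ <;>
  simp [partner_two_mul, partner_two_mul_add_one, pairSign_two_mul, pairSign_two_mul_add_one]

lemma pairSign_mul_self (i : ℕ) : pairSign i * pairSign i = 1 := by
  rw [pairSign]; split_ifs <;> simp

lemma skew_skewPoly {s : ℝ≥0∞} {N : ℕ} (hs : (N : ℝ≥0∞) < s) {i k : ℕ} (hi : i < N) (hk : k < N) :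
    skew s (skewPoly s i) (skewPoly s k) = if k = partner i then pairSign i else 0 := by
  rcases Nat.even_or_odd' i with ⟨j, rfl | rfl⟩ <;> rcases Nat.even_or_odd' k with ⟨l, rfl | rfl⟩
  · rw [skewPoly_two_mul, skewPoly_two_mul, skew_skewPolyEven_skewPolyEven hs hi hk,
      partner_two_mul, if_neg (by omega)]
  · rw [skewPoly_two_mul, skewPoly_two_mul_add_one, skew_skewPolyEven_skewPolyOdd hs hi hk,
      partner_two_mul, pairSign_two_mul]
    congr 1
    simp [eq_comm]
  · rw [skewPoly_two_mul, skewPoly_two_mul_add_one,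
      skew_swap hs ((natDegree_skewPolyOdd_le s j).trans_lt hi)
        ((natDegree_skewPolyEven_le l).trans_lt hk),
      skew_skewPolyEven_skewPolyOdd hs hk hi, partner_two_mul_add_one, pairSign_two_mul_add_one]
    have : 2 * l = 2 * j ↔ l = j := by omega
    simp only [this]
    split_ifs <;> simp
  · rw [skewPoly_two_mul_add_one, skewPoly_two_mul_add_one, skew_skewPolyOdd_skewPolyOdd hs hi hk,
      partner_two_mul_add_one, if_neg (by omega)]

lemma sum_range_two_mul {M : Type*} [AddCommMonoid M] (f : ℕ → M) (J : ℕ) :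
    ∑ i ∈ Finset.range (2 * J), f i = ∑ j ∈ Finset.range J, (f (2 * j) + f (2 * j + 1)) := by
  induction J with
  | zero => simp
  | succ J ih =>
    rw [Finset.sum_range_succ, ← ih, show 2 * (J + 1) = 2 * J + 1 + 1 by ring,
      Finset.sum_range_succ, Finset.sum_range_succ, add_assoc]

/-! ### Change of basis in the inverse Gram matrix -/

open Matrix in
-- A change of basis by L turns the Gram matrix into L G Lᵀ and the vectors of values into L x, and
-- the bilinear expression is invariant. Monic polynomials and the π_n can thus both be compared
-- with the monomials.
lemma mulVec_dotProduct_inv {n : Type*} [Fintype n] [DecidableEq n] (L G : Matrix n n ℂ)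
    (hL : IsUnit L.det) (x y : n → ℂ) :
    (L *ᵥ x) ⬝ᵥ ((L * G * Lᵀ)⁻¹ *ᵥ (L *ᵥ y)) = x ⬝ᵥ (G⁻¹ *ᵥ y) := by
  have hL' : IsUnit (Lᵀ).det := by rwa [Matrix.det_transpose]
  rw [Matrix.mul_inv_rev, Matrix.mul_inv_rev, ← Matrix.vecMul_transpose,
    ← Matrix.dotProduct_mulVec, Matrix.mulVec_mulVec, Matrix.mulVec_mulVec]
  congr 2
  rw [← Matrix.mul_assoc, Matrix.mul_nonsing_inv _ hL', Matrix.one_mul, Matrix.mul_assoc,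
    Matrix.nonsing_inv_mul _ hL, Matrix.mul_one]

/-- The matrix of coefficients. -/
noncomputable def coeffMatrix (N : ℕ) (f : ℕ → Polynomial ℝ) : Matrix (Fin N) (Fin N) ℂ :=
  Matrix.of fun m n => ((f m).coeff n : ℂ)

open Matrix in
lemma gram_eq {s : ℝ≥0∞} {N : ℕ} (hs : (N : ℝ≥0∞) < s) (f : ℕ → Polynomial ℝ)
    (hf : ∀ i < N, (f i).natDegree < N) : gram s N f =
      coeffMatrix N f * gram s N (fun i => Polynomial.X ^ i) * (coeffMatrix N f)ᵀ := by
  ext m n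
  simp only [gram, coeffMatrix, Matrix.mul_apply, Matrix.of_apply, Matrix.transpose_apply,
    Finset.sum_mul]
  rw [skew_eq_sum_coeff hs (hf m m.2) (hf n n.2), Finset.sum_comm]
  refine Finset.sum_congr rfl fun i _ => Finset.sum_congr rfl fun k _ => ?_
  push_cast
  ring

open Matrix in
lemma aeval_eq_mulVec {N : ℕ} (f : ℕ → Polynomial ℝ) (hf : ∀ i < N, (f i).natDegree < N) (u : ℂ) :
    (fun m : Fin N => Polynomial.aeval u (f m)) =
      coeffMatrix N f *ᵥ fun i : Fin N => u ^ (i : ℕ) := by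
  ext m
  rw [Polynomial.aeval_eq_sum_range' (hf m m.2), Finset.sum_range]
  simp [coeffMatrix, Matrix.mulVec, dotProduct, Complex.real_smul]

open Matrix in
lemma kappa_eq_dotProduct (s : ℝ≥0∞) (N : ℕ) (f : ℕ → Polynomial ℝ) (u v : ℂ) :
    kappa s N f u v = -2 * (weight s u : ℂ) * (weight s v : ℂ) *
      ((fun m : Fin N => Polynomial.aeval u (f m)) ⬝ᵥ
        ((gram s N f)⁻¹ *ᵥ fun m : Fin N => Polynomial.aeval v (f m))) := by
  rw [kappa]
  congr 1
  simp only [dotProduct, Matrix.mulVec, Finset.mul_sum]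
  exact Finset.sum_congr rfl fun m _ => Finset.sum_congr rfl fun n _ => by ring

lemma isUnit_det_coeffMatrix {N : ℕ} {f : ℕ → Polynomial ℝ}
    (hf : ∀ i < N, (f i).Monic ∧ (f i).natDegree = i) : IsUnit (coeffMatrix N f).det := by
  have h := Matrix.det_matrixOfPolynomials (fun i : Fin N => f i) (fun i => (hf i i.2).2)
    (fun i => (hf i i.2).1)
  have e : coeffMatrix N f = ((Matrix.of (fun i j : Fin N => (f j).coeff i)).map
      Complex.ofRealHom).transpose := by
    ext m n; simp [coeffMatrix]
  rw [e, Matrix.det_transpose, ← RingHom.mapMatrix_apply, ← RingHom.map_det, h]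
  simp

open Matrix in
/-- The kernel `ϰ` for even `N = 2 J` does not depend on the choice of monic polynomials. -/
lemma kappa_eq {s : ℝ≥0∞} {J : ℕ} (hs : ((2 * J : ℕ) : ℝ≥0∞) < s) (p : ℕ → Polynomial ℝ)
    (hp : ∀ i < 2 * J, (p i).Monic ∧ (p i).natDegree = i) (u v : ℂ) :
    kappa s (2 * J) p u v = 2 * (weight s u : ℂ) * (weight s v : ℂ) *
      (∑ j ∈ Finset.range J, Polynomial.aeval u (skewPolyEven j) *
          Polynomial.aeval v (skewPolyOdd s j) -
        ∑ j ∈ Finset.range J, Polynomial.aeval v (skewPolyEven j) *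
          Polynomial.aeval u (skewPolyOdd s j)) := by
  set N := 2 * J with hN
  have hpd : ∀ i < N, (p i).natDegree < N := fun i hi => by rw [(hp i hi).2]; exact hi
  have hqd : ∀ i < N, (skewPoly s i).natDegree < N := fun i hi =>
    (natDegree_skewPoly_le s i).trans_lt hi
  -- The Gram matrix of the π_n consists of blocks [[0, 1], [-1, 0]], and T is its inverse.
  set T : Matrix (Fin N) (Fin N) ℂ :=
    Matrix.of fun m n => if (n : ℕ) = partner m then -pairSign m else 0 with hT
  have hprod : gram s N (skewPoly s) * T = 1 := by
    ext m n
    rw [Matrix.mul_apply, Finset.sum_eq_single (⟨partner m, partner_lt m.2⟩ : Fin N)]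
    · simp only [gram, Matrix.of_apply, hT, skew_skewPoly hs m.2 (partner_lt m.2), if_true,
        partner_partner, pairSign_partner, neg_neg, Matrix.one_apply, mul_ite, mul_zero,
        pairSign_mul_self]
      congr 1
      simp [Fin.ext_iff, eq_comm]
    · intro k _ hk
      have : (k : ℕ) ≠ partner m := fun h => hk (Fin.ext h)
      simp [gram, skew_skewPoly hs m.2 k.2, this]
    · simp
  have hinv : (gram s N (skewPoly s))⁻¹ = T := Matrix.inv_eq_right_inv hprod
  -- No leading coefficients are needed: the coefficient matrix is a left factor of an invertible
  -- matrix.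
  have hunit : IsUnit (coeffMatrix N (skewPoly s)).det := by
    rw [gram_eq hs _ hqd, Matrix.mul_assoc, Matrix.mul_assoc] at hprod
    have := congrArg Matrix.det hprod
    rw [Matrix.det_mul, Matrix.det_one] at this
    exact IsUnit.of_mul_eq_one _ this
  rw [kappa_eq_dotProduct, gram_eq hs p hpd, aeval_eq_mulVec p hpd, aeval_eq_mulVec p hpd,
    mulVec_dotProduct_inv _ _ (isUnit_det_coeffMatrix hp), ← mulVec_dotProduct_inv _ _ hunit,
    ← gram_eq hs _ hqd, hinv, ← aeval_eq_mulVec _ hqd, ← aeval_eq_mulVec _ hqd]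
  have h1 : (T *ᵥ fun m : Fin N => Polynomial.aeval v (skewPoly s m)) =
      fun m : Fin N => -pairSign m * Polynomial.aeval v (skewPoly s (partner m)) := by
    ext m
    rw [Matrix.mulVec, dotProduct, Finset.sum_eq_single (⟨partner m, partner_lt m.2⟩ : Fin N)]
    · simp [hT]
    · intro k _ hk
      have : (k : ℕ) ≠ partner m := fun h => hk (Fin.ext h)
      simp [hT, this]
    · simp
  rw [h1, dotProduct, ← Finset.sum_range (fun m => Polynomial.aeval u (skewPoly s m) *
    (-pairSign m * Polynomial.aeval v (skewPoly s (partner m)))), hN, sum_range_two_mul]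
  simp only [partner_two_mul, partner_two_mul_add_one, pairSign_two_mul, pairSign_two_mul_add_one,
    skewPoly_two_mul, skewPoly_two_mul_add_one]
  rw [← Finset.sum_sub_distrib, Finset.mul_sum, Finset.mul_sum]
  exact Finset.sum_congr rfl fun j _ => by ring

/-! ### The integrals `s_{2n}` and `h_n` -/

lemma integral_weight_mul_pow_even {s : ℝ≥0∞} {k : ℕ} (hk : ((2 * k + 1 : ℕ) : ℝ≥0∞) < s) :
    ∫ x : ℝ, weight s x * x ^ (2 * k) = 2 / ((2 * k + 1) * (1 - (2 * k + 1) * invParam s)) := by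
  have e : ∀ x : ℝ, weight s x * x ^ (2 * k) =
      (fun r : ℝ => r ^ (2 * k) * weight s (r : ℂ)) |x| := by
    intro x
    have : weight s ((|x| : ℝ) : ℂ) = weight s x := by simp [weight]
    simp only [this, (even_two_mul k).pow_abs]
    ring
  rw [integral_congr_ae (ae_of_all _ e), integral_comp_abs (f := fun r : ℝ => r ^ (2 * k) *
    weight s (r : ℂ)), integral_pow_mul_weight hk]
  push_cast
  ring

/-- The k-th moment has the denominator (2k+1)(1-(2k+1)/s). The first factor turns A_k into B_k and
the second is α - kβ with α = 1 - 1/s, β = 2/s. -/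
lemma skewInt_eq {s : ℝ≥0∞} {n : ℕ} (hn : ((2 * n + 1 : ℕ) : ℝ≥0∞) < s) :
    skewInt s n =
      ((2 * resolventSum (1 / 2) (1 / 2) (1 - invParam s) (2 * invParam s) n : ℝ) : ℂ) := by
  have hlt : ∀ k ∈ Finset.range (n + 1), ((2 * k + 1 : ℕ) : ℝ≥0∞) < s := fun k hk => by
    refine lt_of_le_of_lt ?_ hn
    have : k < n + 1 := by simpa using hk
    have : 2 * k + 1 ≤ 2 * n + 1 := by omega
    exact_mod_cast this
  have e : ∀ x : ℝ, weighted s (skewPolyEven n) x =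
      ((∑ k ∈ Finset.range (n + 1), coeffA k * coeffB (n - k) * (weight s x * x ^ (2 * k)) : ℝ) :
        ℂ) := by
    intro x
    rw [weighted, aeval_skewPolyEven]
    push_cast
    rw [Finset.sum_mul]
    exact Finset.sum_congr rfl fun k _ => by ring
  rw [skewInt, integral_congr_ae (ae_of_all _ e), integral_complex_ofReal, integral_finsetSum _
    fun k hk => (integrable_weight_mul_pow (hlt k hk)).const_mul _]
  congr 1
  rw [resolventSum, Finset.mul_sum]
  refine Finset.sum_congr rfl fun k hk => ?_
  rw [integral_const_mul, integral_weight_mul_pow_even (hlt k hk), coeffA_eq]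
  have h6 : (2 * k + 1 : ℝ) ≠ 0 := by positivity
  have h7 : 1 - invParam s - k * (2 * invParam s) = 1 - (2 * k + 1) * invParam s := by ring
  rw [h7, mul_comm (2 * (k : ℝ) + 1) (coeffB k), ← div_div]
  field_simp

lemma resolventSum_pos {σ : ℝ} {n : ℕ} (hσ : (2 * n + 1) * σ < 1) :
    0 < resolventSum (1 / 2) (1 / 2) (1 - σ) (2 * σ) n := by
  refine Finset.sum_pos (fun k hk => ?_) ⟨0, by simp⟩
  have hk' : (k : ℝ) ≤ n := by
    have : k ≤ n := by simpa [Nat.lt_succ_iff] using hk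
    exact_mod_cast this
  refine div_pos (mul_pos (coeffB_pos k) (coeffB_pos _)) ?_
  nlinarith

/-- In the recurrence the right factor exceeds the left one by σ, and both are positive.
Monotonicity of s_{2n} is what Abel's inequality needs in the correction for odd N. -/
lemma resolventSum_le_succ {σ : ℝ} {n : ℕ} (h0 : 0 ≤ σ) (hσ : (2 * n + 3) * σ < 1) :
    resolventSum (1 / 2) (1 / 2) (1 - σ) (2 * σ) n ≤
      resolventSum (1 / 2) (1 / 2) (1 - σ) (2 * σ) (n + 1) := by
  have hr := resolventSum_succ (p := 1 / 2) (q := 1 / 2) (by norm_num) (α := 1 - σ) (β := 2 * σ)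
    (n := n) (fun k hk => by
      have : (k : ℝ) ≤ n + 1 := by exact_mod_cast hk
      have : 0 < 1 - σ - k * (2 * σ) := by nlinarith
      exact this.ne')
  have hpos := resolventSum_pos (n := n) (σ := σ) (by nlinarith)
  have h1 : 0 < 1 - σ - ((n : ℝ) + 1) * (2 * σ) := by nlinarith
  refine le_of_mul_le_mul_left ?_ h1
  rw [hr]
  refine mul_le_mul_of_nonneg_right ?_ hpos.le
  nlinarith

/-- The ratio `s_{2j} / s_{2J}`. -/
noncomputable def skewIntRatio (s : ℝ≥0∞) (J j : ℕ) : ℝ :=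
  resolventSum (1 / 2) (1 / 2) (1 - invParam s) (2 * invParam s) j /
    resolventSum (1 / 2) (1 / 2) (1 - invParam s) (2 * invParam s) J

lemma skewInt_div_skewInt {s : ℝ≥0∞} {J j : ℕ} (hs : ((2 * J + 1 : ℕ) : ℝ≥0∞) < s) (hj : j ≤ J) :
    skewInt s j / skewInt s J = (skewIntRatio s J j : ℂ) := by
  have : ((2 * j + 1 : ℕ) : ℝ≥0∞) < s := by
    refine lt_of_le_of_lt ?_ hs
    have : 2 * j + 1 ≤ 2 * J + 1 := by omega
    exact_mod_cast this
  rw [skewInt_eq hs, skewInt_eq this, skewIntRatio]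
  push_cast
  rw [mul_div_mul_left _ _ two_ne_zero]

lemma skewIntRatio_mono {s : ℝ≥0∞} {J j : ℕ} (hs : ((2 * J + 1 : ℕ) : ℝ≥0∞) < s) (hj : j < J) :
    skewIntRatio s J j ≤ skewIntRatio s J (j + 1) := by
  have h1 := mul_invParam_lt_one hs
  have h0 := invParam_nonneg s
  push_cast at h1
  have hj' : (j : ℝ) + 1 ≤ J := by exact_mod_cast hj
  refine div_le_div_of_nonneg_right (resolventSum_le_succ h0 ?_) (resolventSum_pos h1).le
  nlinarith

lemma skewIntRatio_nonneg {s : ℝ≥0∞} {J j : ℕ} (hs : ((2 * J + 1 : ℕ) : ℝ≥0∞) < s) (hj : j ≤ J) :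
    0 ≤ skewIntRatio s J j := by
  have h1 := mul_invParam_lt_one hs
  have h0 := invParam_nonneg s
  push_cast at h1
  have hj' : (j : ℝ) ≤ J := by exact_mod_cast hj
  refine div_nonneg (resolventSum_pos ?_).le (resolventSum_pos h1).le
  nlinarith

lemma skewIntRatio_self {s : ℝ≥0∞} {J : ℕ} (hs : ((2 * J + 1 : ℕ) : ℝ≥0∞) < s) :
    skewIntRatio s J J = 1 := by
  have h1 := mul_invParam_lt_one hs
  push_cast at h1
  exact div_self (resolventSum_pos h1).ne'

lemma skewIntRatio_le_one {s : ℝ≥0∞} {J j : ℕ} (hs : ((2 * J + 1 : ℕ) : ℝ≥0∞) < s) (hj : j ≤ J) :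
    skewIntRatio s J j ≤ 1 := by
  induction hj using Nat.decreasingInduction with
  | self => exact (skewIntRatio_self hs).le
  | of_succ k hk ih => exact (skewIntRatio_mono hs hk).trans ih

lemma monomialNormSq_eq {s : ℝ≥0∞} {n : ℕ} (hn : ((n + 1 : ℕ) : ℝ≥0∞) < s) :
    monomialNormSq s n = Real.pi / ((n + 1) * (1 - (n + 1) * invParam s)) := by
  have h2 : ((2 * n + 1 + 1 : ℕ) : ℝ≥0∞) < 2 * s := by
    have := natCast_lt_two_mul hn hn
    rwa [← two_mul] at this
  have e : ∀ z : ℂ, ‖z‖ ^ (2 * n) * weight s z ^ 2 =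
      (fun r : ℝ => r ^ (2 * n) * weight (2 * s) (r : ℂ)) ‖z‖ := by
    intro z
    simp only [weight_sq]
    rw [← weight_eq_weight_norm]
  have e2 : ∀ y : ℝ, y ^ (Module.finrank ℝ ℂ - 1) • (y ^ (2 * n) * weight (2 * s) (y : ℂ)) =
      y ^ (2 * n + 1) * weight (2 * s) (y : ℂ) := by
    intro y
    simp [Complex.finrank_real_complex]
    ring
  have e3 : (volume : Measure ℂ).real (Metric.ball (0 : ℂ) 1) = Real.pi := by
    simp [Measure.real, Complex.volume_ball]
  rw [monomialNormSq, integral_congr_ae (ae_of_all _ e),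
    integral_fun_norm_addHaar volume (fun r : ℝ => r ^ (2 * n) * weight (2 * s) (r : ℂ)), e3]
  simp only [e2]
  rw [integral_pow_mul_weight h2, invParam_two_mul, Complex.finrank_real_complex]
  have hn0 : (n : ℝ) + 1 ≠ 0 := by positivity
  push_cast
  simp only [nsmul_eq_mul, smul_eq_mul]
  have e4 : (2 * (n : ℝ) + 1 + 1) * (1 - (2 * n + 1 + 1) * (invParam s / 2)) =
    2 * ((n + 1) * (1 - (n + 1) * invParam s)) := by ring
  rw [e4]
  field_simp
  norm_num

/-- The complex kernel without the weights. -/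
noncomputable def complexSum (s : ℝ≥0∞) (N : ℕ) (z w : ℂ) : ℂ :=
  1 / (Real.pi : ℂ) * ∑ n ∈ Finset.range N,
    ((((n : ℝ) + 1) * (1 - (n + 1) * invParam s) : ℝ) : ℂ) * (z * conj w) ^ n

lemma complexKernel_eq {s : ℝ≥0∞} {N : ℕ} (hs : (N : ℝ≥0∞) < s) (z w : ℂ) :
    complexKernel s N z w = (weight s z : ℂ) * (weight s w : ℂ) * complexSum s N z w := by
  rw [complexKernel, complexSum]
  congr 1
  rw [Finset.mul_sum]
  refine Finset.sum_congr rfl fun n hn => ?_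
  rw [monomialNormSq_eq (natCast_succ_lt hs (by simpa using hn)), mul_pow]
  push_cast
  rw [div_div_eq_mul_div]
  ring

/-! ### The matrix kernel at nonreal points -/

/-- The kernel `ϰ` for `N = 2 J` without the weights. -/
noncomputable def skewKernel (s : ℝ≥0∞) (J : ℕ) (u v : ℂ) : ℂ :=
  2 * (∑ j ∈ Finset.range J, Polynomial.aeval u (skewPolyEven j) *
          Polynomial.aeval v (skewPolyOdd s j) -
        ∑ j ∈ Finset.range J, Polynomial.aeval v (skewPolyEven j) *
          Polynomial.aeval u (skewPolyOdd s j))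

/-- The correction for `N = 2 J + 1` without the weights. -/
noncomputable def oddCorrection (s : ℝ≥0∞) (J : ℕ) (u v : ℂ) : ℂ :=
  -(2 * ∑ j ∈ Finset.range J, (skewInt s j / skewInt s J) *
    (Polynomial.aeval u (skewPolyEven J) * Polynomial.aeval v (skewPolyOdd s j) -
      Polynomial.aeval v (skewPolyEven J) * Polynomial.aeval u (skewPolyOdd s j)))

/-- The `(1,1)` entry of the kernel without the weights. -/
noncomputable def bareKernel (s : ℝ≥0∞) (N : ℕ) (u v : ℂ) : ℂ :=
  skewKernel s (N / 2) u v + if Even N then 0 else oddCorrection s (N / 2) u v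

/-- The `2 × 2` kernel at nonreal points, without the weights. -/
noncomputable def bareMatrix (s : ℝ≥0∞) (N : ℕ) (u v : ℂ) : Matrix (Fin 2) (Fin 2) ℂ :=
  !![bareKernel s N u v, Complex.I * (Real.sign v.im : ℂ) * bareKernel s N u (conj v);
    Complex.I * (Real.sign u.im : ℂ) * bareKernel s N (conj u) v,
    Complex.I * (Real.sign u.im : ℂ) * (Complex.I * (Real.sign v.im : ℂ)) *
      bareKernel s N (conj u) (conj v)]

lemma bareKernel_swap (s : ℝ≥0∞) (N : ℕ) (u v : ℂ) :
    bareKernel s N u v = -bareKernel s N v u := by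
  have h1 : skewKernel s (N / 2) u v = -skewKernel s (N / 2) v u := by
    rw [skewKernel, skewKernel]; ring
  have h2 : oddCorrection s (N / 2) u v = -oddCorrection s (N / 2) v u := by
    rw [oddCorrection, oddCorrection, neg_neg, ← mul_neg, ← Finset.sum_neg_distrib]
    exact congrArg _ (Finset.sum_congr rfl fun j _ => by ring)
  rw [bareKernel, bareKernel, h1, h2]
  split_ifs <;> ring

lemma eps_of_im_ne_zero (f : ℂ → ℂ) {u : ℂ} (hu : u.im ≠ 0) :
    eps f u = Complex.I * (Real.sign u.im : ℂ) * f (conj u) := by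
  rw [eps, if_neg hu]

/-- At nonreal points ε only conjugates and multiplies by ±i. The weight is invariant under
conjugation, so it factors out of all four entries, and the sign term is absent. -/
lemma evenKernel_eq {s : ℝ≥0∞} {J : ℕ} (hs : ((2 * J : ℕ) : ℝ≥0∞) < s) (p : ℕ → Polynomial ℝ)
    (hp : ∀ i < 2 * J, (p i).Monic ∧ (p i).natDegree = i) {u v : ℂ} (hu : u.im ≠ 0)
    (hv : v.im ≠ 0) : evenKernel s (2 * J) p u v =
    ((weight s u : ℂ) * (weight s v : ℂ)) • !![skewKernel s J u v,
      Complex.I * (Real.sign v.im : ℂ) * skewKernel s J u (conj v);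
    Complex.I * (Real.sign u.im : ℂ) * skewKernel s J (conj u) v,
    Complex.I * (Real.sign u.im : ℂ) * (Complex.I * (Real.sign v.im : ℂ)) *
      skewKernel s J (conj u) (conj v)] := by
  have hk : ∀ u v, kappa s (2 * J) p u v =
      (weight s u : ℂ) * (weight s v : ℂ) * skewKernel s J u v := fun u v => by
    rw [kappa_eq hs p hp, skewKernel]; ring
  rw [evenKernel]
  simp only [eps_of_im_ne_zero _ hu, eps_of_im_ne_zero _ hv, hk, weight_conj, sgnDiff, hu,
    false_and, if_false]
  ext i j
  fin_cases i <;> fin_cases j <;> simp <;> ring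

/-- For odd N the terms with the indicator of the real line vanish as well, and antisymmetry of the
bare kernel brings the (2,1) entry to the same shape as for even N. -/
lemma matrixKernel_eq {s : ℝ≥0∞} {N : ℕ} (hs : (N : ℝ≥0∞) < s) (p : ℕ → Polynomial ℝ)
    (hp : ∀ i < N, (p i).Monic ∧ (p i).natDegree = i) {u v : ℂ} (hu : u.im ≠ 0) (hv : v.im ≠ 0) :
    matrixKernel s N p u v = ((weight s u : ℂ) * (weight s v : ℂ)) • bareMatrix s N u v := by
  have hs' : ((2 * (N / 2) : ℕ) : ℝ≥0∞) < s := by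
    refine lt_of_le_of_lt ?_ hs
    have : 2 * (N / 2) ≤ N := by omega
    exact_mod_cast this
  have hE := evenKernel_eq hs' p (fun i hi => hp i (by omega)) hu hv
  rw [matrixKernel]
  split_ifs with h
  · obtain ⟨J, rfl⟩ := h
    have e : (J + J) / 2 = J := by omega
    rw [e, two_mul] at hE
    rw [hE, bareMatrix]
    simp [bareKernel, e]
  · have h12 : ∀ {u v : ℂ}, u.im ≠ 0 → v.im ≠ 0 → oddKernel12 s (N / 2) p u v =
        (weight s u : ℂ) * (weight s v : ℂ) *
          (Complex.I * (Real.sign v.im : ℂ) * bareKernel s N u (conj v)) := by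
      intro u v hu hv
      have hE := evenKernel_eq hs' p (fun i hi => hp i (by omega)) hu hv
      rw [oddKernel12, hE, bareKernel, if_neg h, oddCorrection]
      simp only [eps_of_im_ne_zero _ hv, weighted, weight_conj, chiReal, hv, if_false]
      simp only [Matrix.smul_apply, Matrix.of_apply, Matrix.cons_val', Matrix.cons_val_zero,
        Matrix.cons_val_one, smul_eq_mul, mul_zero, zero_div, add_zero]
      rw [mul_add, mul_add, sub_eq_add_neg]
      congr 1
      rw [mul_neg, mul_neg, neg_inj, Finset.mul_sum, Finset.mul_sum, Finset.mul_sum, Finset.mul_sum]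
      exact Finset.sum_congr rfl fun j _ => by ring
    have h21 : -oddKernel12 s (N / 2) p v u = (weight s u : ℂ) * (weight s v : ℂ) *
        (Complex.I * (Real.sign u.im : ℂ) * bareKernel s N (conj u) v) := by
      rw [h12 hv hu, bareKernel_swap s N v]; ring
    rw [oddKernel, h12 hu hv, h21, hE, bareMatrix]
    simp only [eps_of_im_ne_zero _ hv, eps_of_im_ne_zero _ hu, weighted, weight_conj, chiReal, hv,
      hu, if_false]
    ext i j
    fin_cases i <;> fin_cases j
    · simp only [bareKernel, if_neg h, oddCorrection, Matrix.smul_apply, Matrix.of_apply,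
        Matrix.cons_val', Matrix.cons_val_zero, Fin.zero_eta, smul_eq_mul]
      rw [mul_add, sub_eq_add_neg]
      congr 1
      rw [mul_neg, neg_inj, Finset.mul_sum, Finset.mul_sum, Finset.mul_sum]
      exact Finset.sum_congr rfl fun j _ => by ring
    · simp
    · simp
    · simp only [bareKernel, if_neg h, oddCorrection, Matrix.smul_apply, Matrix.of_apply,
        Matrix.cons_val', Matrix.cons_val_one, Fin.mk_one, smul_eq_mul, mul_zero, sub_zero,
        zero_div, add_zero, Matrix.cons_val_zero]
      rw [mul_add, mul_add, sub_eq_add_neg]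
      congr 1
      rw [mul_neg, mul_neg, neg_inj, Finset.mul_sum, Finset.mul_sum, Finset.mul_sum, Finset.mul_sum]
      exact Finset.sum_congr rfl fun j _ => by ring

/-! ### Tails of the series `∑ u ^ (2 d - 1) / (2 d - 1)` -/

/-- The integral `∫ u (u t) ^ (2 e) / (1 - u² t²) dt` over `[0, 1]`; for `|u| < 1` it is the tail
`∑ u ^ (2 d + 1) / (2 d + 1)` over `d ≥ e`. -/
noncomputable def oddTail (u : ℂ) (e : ℕ) : ℂ :=
  ∫ t in (0 : ℝ)..1, u * (u * t) ^ (2 * e) / (1 - u ^ 2 * t ^ 2)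

/-- The imaginary part of conj u (1 - ut) is -Im u for every real t, hence |Im u| ≤ |u| |1 - ut|.
The bounds for t and -t are multiplied. This controls the denominators uniformly in t. -/
lemma sq_im_le_sq_norm_mul (u : ℂ) (t : ℝ) : u.im ^ 2 ≤ ‖u‖ ^ 2 * ‖1 - u ^ 2 * (t : ℂ) ^ 2‖ := by
  have key : ∀ t : ℝ, |u.im| ≤ ‖u‖ * ‖1 - u * t‖ := by
    intro t
    have h1 : (conj u * (1 - u * t)).im = -u.im := by
      have : conj u * (1 - u * t) = conj u - (Complex.normSq u * t : ℝ) := by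
        push_cast
        rw [← Complex.mul_conj]; ring
      rw [this]; simp [-Complex.ofReal_mul]
    calc |u.im| = |(conj u * (1 - u * t)).im| := by rw [h1, abs_neg]
      _ ≤ ‖conj u * (1 - u * t)‖ := Complex.abs_im_le_norm _
      _ = _ := by rw [norm_mul, RCLike.norm_conj]
  have h1 := key t
  have h2 := key (-t)
  have e : 1 - u ^ 2 * (t : ℂ) ^ 2 = (1 - u * t) * (1 - u * (-t : ℝ)) := by push_cast; ring
  rw [e, norm_mul, ← sq_abs]
  calc |u.im| ^ 2 = |u.im| * |u.im| := by ring
    _ ≤ (‖u‖ * ‖1 - u * t‖) * (‖u‖ * ‖1 - u * (-t : ℝ)‖) := by gcongr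
    _ = _ := by ring

lemma one_sub_sq_mul_sq_ne_zero {u : ℂ} (hu : u.im ≠ 0) (t : ℝ) :
    1 - u ^ 2 * (t : ℂ) ^ 2 ≠ 0 := by
  intro h
  have := sq_im_le_sq_norm_mul u t
  rw [h, norm_zero, mul_zero] at this
  exact (pow_pos (abs_pos.2 hu) 2).not_ge (by rwa [sq_abs])

lemma continuous_oddTail_integrand {u : ℂ} (hu : u.im ≠ 0) (e : ℕ) :
    Continuous fun t : ℝ => u * (u * t) ^ (2 * e) / (1 - u ^ 2 * (t : ℂ) ^ 2) :=
  Continuous.div (by fun_prop) (by fun_prop) (one_sub_sq_mul_sq_ne_zero hu)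

lemma oddTail_sub_succ {u : ℂ} (hu : u.im ≠ 0) (e : ℕ) :
    oddTail u e - oddTail u (e + 1) = u ^ (2 * e + 1) / (2 * e + 1) := by
  rw [oddTail, oddTail, ← intervalIntegral.integral_sub
    ((continuous_oddTail_integrand hu e).intervalIntegrable _ _)
    ((continuous_oddTail_integrand hu (e + 1)).intervalIntegrable _ _)]
  have h : ∀ t : ℝ, u * (u * t) ^ (2 * e) / (1 - u ^ 2 * (t : ℂ) ^ 2) -
      u * (u * t) ^ (2 * (e + 1)) / (1 - u ^ 2 * (t : ℂ) ^ 2) =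
      u ^ (2 * e + 1) * ((t ^ (2 * e) : ℝ) : ℂ) := by
    intro t
    rw [← sub_div, div_eq_iff (one_sub_sq_mul_sq_ne_zero hu t)]
    push_cast
    ring
  simp only [h]
  rw [intervalIntegral.integral_const_mul, intervalIntegral.integral_ofReal, integral_pow]
  push_cast
  simp
  rw [div_eq_mul_inv]

/-- One factor C bounds the power of |u|, the other bounds 1/|1 - u² t²|, and the integral of t^(2e)
gives the decay. -/
lemma norm_oddTail_le {u : ℂ} (hu : u.im ≠ 0) {C : ℝ} (hC : ‖u‖ ^ 2 ≤ C * u.im ^ 2) {e : ℕ}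
    (he : ‖u‖ ^ (2 * e + 1) ≤ C) : ‖oddTail u e‖ ≤ C ^ 2 / (2 * e + 1) := by
  have hC0 : 0 ≤ C := le_trans (by positivity) he
  have him : 0 < u.im ^ 2 := by positivity
  have h : ∀ t ∈ Set.Ioc (0 : ℝ) 1, ‖u * (u * t) ^ (2 * e) / (1 - u ^ 2 * (t : ℂ) ^ 2)‖ ≤
      C ^ 2 * t ^ (2 * e) := by
    intro t ht
    have h1 : 0 < ‖1 - u ^ 2 * (t : ℂ) ^ 2‖ := norm_pos_iff.2 (one_sub_sq_mul_sq_ne_zero hu t)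
    have h2 : 1 ≤ C * ‖1 - u ^ 2 * (t : ℂ) ^ 2‖ := by
      have h3 := sq_im_le_sq_norm_mul u t
      have : u.im ^ 2 * 1 ≤ u.im ^ 2 * (C * ‖1 - u ^ 2 * (t : ℂ) ^ 2‖) := by
        calc u.im ^ 2 * 1 ≤ ‖u‖ ^ 2 * ‖1 - u ^ 2 * (t : ℂ) ^ 2‖ := by linarith
          _ ≤ (C * u.im ^ 2) * ‖1 - u ^ 2 * (t : ℂ) ^ 2‖ := by gcongr
          _ = _ := by ring
      exact le_of_mul_le_mul_left this him
    rw [norm_div, div_le_iff₀ h1, norm_mul, norm_pow, norm_mul, Complex.norm_real,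
      Real.norm_of_nonneg ht.1.le]
    have ht0 : 0 ≤ t := ht.1.le
    calc ‖u‖ * (‖u‖ * t) ^ (2 * e) = ‖u‖ ^ (2 * e + 1) * t ^ (2 * e) * 1 := by ring
      _ ≤ C * t ^ (2 * e) * (C * ‖1 - u ^ 2 * (t : ℂ) ^ 2‖) := by gcongr
      _ = _ := by ring
  refine (intervalIntegral.norm_integral_le_of_norm_le zero_le_one (ae_of_all _ h)
    (Continuous.intervalIntegrable (by fun_prop) _ _)).trans ?_
  rw [intervalIntegral.integral_const_mul, integral_pow]
  push_cast
  simp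
  rw [div_eq_mul_inv]

/-- This is artanh u. For nonreal u the segments 1 ± ut stay in the slit plane, so the principal
logarithm is a valid primitive. -/
lemma oddTail_zero {u : ℂ} (hu : u.im ≠ 0) :
    oddTail u 0 = (Complex.log (1 + u) - Complex.log (1 - u)) / 2 := by
  have hs : ∀ v : ℂ, v.im ≠ 0 → ∀ t : ℝ, 1 + v * t ∈ Complex.slitPlane := by
    intro v hv t
    by_cases ht : t = 0
    · simp [ht]
    · refine Complex.mem_slitPlane_iff.2 (Or.inr ?_)
      simpa using ⟨hv, ht⟩
  have hd : ∀ t ∈ Set.uIcc (0 : ℝ) 1, HasDerivAt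
      (fun t : ℝ => (Complex.log (1 + u * t) - Complex.log (1 + (-u) * t)) / 2)
      (u * (u * t) ^ (2 * 0) / (1 - u ^ 2 * (t : ℂ) ^ 2)) t := by
    intro t _
    have hu' : (-u).im ≠ 0 := by simpa using hu
    have h1 : ∀ v : ℂ, HasDerivAt (fun t : ℝ => 1 + v * (t : ℂ)) v t := fun v => by
      simpa using ((Complex.ofRealCLM.hasDerivAt (x := t)).const_mul v).const_add 1
    have h2 := (((h1 u).clog_real (hs u hu t)).sub ((h1 (-u)).clog_real (hs (-u) hu' t))).div_const 2
    refine h2.congr_deriv ?_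
    have n1 := Complex.slitPlane_ne_zero (hs u hu t)
    have n2 := Complex.slitPlane_ne_zero (hs (-u) hu' t)
    have n3 := one_sub_sq_mul_sq_ne_zero hu t
    have e : 1 - u ^ 2 * (t : ℂ) ^ 2 = (1 + u * t) * (1 + -u * t) := by ring
    rw [e]
    generalize hx : 1 + u * (t : ℂ) = x at *
    generalize hy : 1 + -u * (t : ℂ) = y at *
    have hxy : x + y = 2 := by rw [← hx, ← hy]; ring
    field_simp
    linear_combination u * hxy
  rw [oddTail, intervalIntegral.integral_eq_sub_of_hasDerivAt hd
    ((continuous_oddTail_integrand hu 0).intervalIntegrable _ _)]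
  simp [sub_eq_add_neg]

/-- This is the jump of the square wave. In log(1 ± u) = log(±u) + log(1 ± 1/u) the two arguments on
the right have opposite signs, so no multiple of 2πi occurs; the difference log u - log(-u) is iπ
sgn Im u. -/
lemma oddTail_zero_sub_inv {u : ℂ} (hu : u.im ≠ 0) :
    oddTail u 0 - oddTail u⁻¹ 0 = Complex.I * (Real.pi / 2) * (Real.sign u.im : ℂ) := by
  have hu0 : u ≠ 0 := fun h => hu (by simp [h])
  have him : u⁻¹.im = -u.im / Complex.normSq u := Complex.inv_im u
  have hn : 0 < Complex.normSq u := Complex.normSq_pos.2 hu0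
  have hui : u⁻¹.im ≠ 0 := by
    rw [him]; exact div_ne_zero (neg_ne_zero.2 hu) hn.ne'
  rw [oddTail_zero hu, oddTail_zero hui]
  have harg : ∀ z : ℂ, 0 < z.im → 0 < z.arg ∧ z.arg < Real.pi := fun z hz =>
    ⟨lt_of_le_of_ne (Complex.arg_nonneg_iff.2 hz.le) fun h => by
      have := (Complex.arg_eq_zero_iff.1 h.symm).2; linarith,
      Complex.arg_lt_pi_iff.2 (Or.inr hz.ne')⟩
  have harg' : ∀ z : ℂ, z.im < 0 → z.arg < 0 ∧ -Real.pi < z.arg := fun z hz =>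
    ⟨Complex.arg_neg_iff.2 hz, Complex.neg_pi_lt_arg z⟩
  have n1 : 1 + u⁻¹ ≠ 0 := fun h => hui (by simpa using congrArg Complex.im h)
  have n2 : 1 - u⁻¹ ≠ 0 := fun h => hui (by simpa using congrArg Complex.im h)
  have e1 : 1 + u = u * (1 + u⁻¹) := by field_simp; ring
  have e2 : 1 - u = (-u) * (1 - u⁻¹) := by field_simp; ring
  have main : Complex.log (1 + u) = Complex.log u + Complex.log (1 + u⁻¹) ∧
      Complex.log (1 - u) = Complex.log (-u) + Complex.log (1 - u⁻¹) := by
    rw [e1, e2]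
    rcases lt_or_gt_of_ne hu with h | h
    · have hi : 0 < u⁻¹.im := by rw [him]; exact div_pos (by linarith) hn
      have a1 := harg' u h
      have a2 := harg (1 + u⁻¹) (by simpa using hi)
      have a3 := harg (-u) (by simpa using h)
      have a4 := harg' (1 - u⁻¹) (by simpa using hi)
      exact ⟨Complex.log_mul hu0 n1 ⟨by linarith, by linarith⟩,
        Complex.log_mul (neg_ne_zero.2 hu0) n2 ⟨by linarith, by linarith⟩⟩
    · have hi : u⁻¹.im < 0 := by rw [him]; exact div_neg_of_neg_of_pos (by linarith) hn
      have a1 := harg u h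
      have a2 := harg' (1 + u⁻¹) (by simpa using hi)
      have a3 := harg' (-u) (by simpa using h)
      have a4 := harg (1 - u⁻¹) (by simpa using hi)
      exact ⟨Complex.log_mul hu0 n1 ⟨by linarith, by linarith⟩,
        Complex.log_mul (neg_ne_zero.2 hu0) n2 ⟨by linarith, by linarith⟩⟩
  have hneg : Complex.log u - Complex.log (-u) =
      Complex.I * Real.pi * (Real.sign u.im : ℂ) := by
    rw [Complex.log, Complex.log, norm_neg]
    rcases lt_or_gt_of_ne hu with h | h
    · rw [Complex.arg_neg_eq_arg_add_pi_of_im_neg h, Real.sign_of_neg h]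
      push_cast; ring
    · rw [Complex.arg_neg_eq_arg_sub_pi_of_im_pos h, Real.sign_of_pos h]
      push_cast; ring
  rw [main.1, main.2]
  linear_combination hneg / 2

/-- A primitive of `d ↦ u ^ (2 d - 1) / (2 d - 1)` on each side of `0`, with limits `0` at
`±∞` for `|u| = 1`. -/
noncomputable def stepPrimitive (u : ℂ) (d : ℤ) : ℂ :=
  if 1 ≤ d then -oddTail u (d - 1).toNat else -oddTail u⁻¹ (1 - d).toNat

/-- For d ≠ 0 the difference of consecutive tails is a single term of the series in u or in 1/u. At
d = 0 the two branches of `stepPrimitive` meet, and the mismatch of the two series is the point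
mass. -/
lemma zpow_div_eq_stepPrimitive {u : ℂ} (hu : u.im ≠ 0) (d : ℤ) :
    u ^ (2 * d - 1) / (2 * d - 1 : ℂ) = stepPrimitive u (d + 1) - stepPrimitive u d +
      if d = 0 then Complex.I * (Real.pi / 2) * (Real.sign u.im : ℂ) else 0 := by
  have hu0 : u ≠ 0 := fun h => hu (by simp [h])
  have hui : u⁻¹.im ≠ 0 := by
    rw [Complex.inv_im]; exact div_ne_zero (neg_ne_zero.2 hu) (Complex.normSq_pos.2 hu0).ne'
  rcases lt_trichotomy d 0 with h | h | h
  · obtain ⟨e, rfl⟩ : ∃ e : ℕ, d = -(e + 1 : ℕ) := ⟨(-d - 1).toNat, by omega⟩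
    have h1 : (1 - (-((e + 1 : ℕ) : ℤ) + 1)).toNat = e + 1 := by omega
    have h2 : (1 - (-((e + 1 : ℕ) : ℤ))).toNat = e + 1 + 1 := by omega
    rw [if_neg h.ne, add_zero, stepPrimitive, stepPrimitive, if_neg (by omega), if_neg (by omega),
      h1, h2]
    have h3 := oddTail_sub_succ hui (e + 1)
    have h4 : u ^ (2 * (-((e + 1 : ℕ) : ℤ)) - 1) = u⁻¹ ^ (2 * (e + 1) + 1) := by
      rw [inv_pow, ← zpow_natCast, ← zpow_neg]
      congr 1
    have h5 : (2 * ((-((e + 1 : ℕ) : ℤ) : ℤ) : ℂ) - 1) = -(2 * ((e + 1 : ℕ) : ℂ) + 1) := by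
      push_cast; ring
    rw [h4, h5, div_neg, ← h3]
    ring
  · subst h
    have h3 := oddTail_sub_succ hui 0
    rw [if_pos rfl, ← oddTail_zero_sub_inv hu, stepPrimitive, stepPrimitive, if_pos (by omega),
      if_neg (by omega)]
    simp only [zero_add, sub_zero, sub_self, Int.toNat_zero, Int.toNat_one, mul_zero,
      Int.cast_zero] at h3 ⊢
    have h4 : u ^ (0 - 1 : ℤ) = u⁻¹ := by norm_num
    rw [h4]
    simp at h3
    linear_combination h3
  · obtain ⟨e, rfl⟩ : ∃ e : ℕ, d = (e + 1 : ℕ) := ⟨(d - 1).toNat, by omega⟩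
    have h1 : (((e + 1 : ℕ) : ℤ) + 1 - 1).toNat = e + 1 := by omega
    have h2 : (((e + 1 : ℕ) : ℤ) - 1).toNat = e := by omega
    rw [if_neg h.ne', add_zero, stepPrimitive, stepPrimitive, if_pos (by omega), if_pos (by omega),
      h1, h2]
    have h3 := oddTail_sub_succ hu e
    have h4 : u ^ (2 * ((e + 1 : ℕ) : ℤ) - 1) = u ^ (2 * e + 1) := by
      rw [← zpow_natCast]
      congr 1
      push_cast
      ring
    have h5 : (2 * (((e + 1 : ℕ) : ℤ) : ℂ) - 1) = (2 * (e : ℂ) + 1) := by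
      push_cast; ring
    rw [h4, h5, ← h3]
    ring

/-- Bounds on `u` that are uniform in a neighbourhood of size `1 / n` of a nonreal point of the
unit circle. -/
structure Tame (u : ℂ) (n : ℕ) (C : ℝ) : Prop where
  im_ne_zero : u.im ≠ 0
  sq_norm_le : ‖u‖ ^ 2 ≤ C * u.im ^ 2
  pow_le : ∀ m ≤ 2 * n + 5, ‖u‖ ^ m ≤ C
  inv_pow_le : ∀ m ≤ 2 * n + 5, ‖u⁻¹‖ ^ m ≤ C

lemma Tame.one_le {u : ℂ} {n : ℕ} {C : ℝ} (h : Tame u n C) : 1 ≤ C := by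
  simpa using h.pow_le 0 (by omega)

lemma Tame.ne_zero {u : ℂ} {n : ℕ} {C : ℝ} (h : Tame u n C) : u ≠ 0 :=
  fun h' => h.im_ne_zero (by simp [h'])

lemma Tame.norm_stepPrimitive_le {u : ℂ} {n : ℕ} {C : ℝ} (h : Tame u n C) {d : ℤ}
    (hd : d.natAbs ≤ n + 1) : ‖stepPrimitive u d‖ ≤ 2 * C ^ 2 * (1 / ((d.natAbs : ℝ) + 1)) := by
  have hu0 := h.ne_zero
  have hn : 0 < Complex.normSq u := Complex.normSq_pos.2 hu0
  have hui : u⁻¹.im ≠ 0 := by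
    rw [Complex.inv_im]; exact div_ne_zero (neg_ne_zero.2 h.im_ne_zero) hn.ne'
  have hsq : ‖u⁻¹‖ ^ 2 ≤ C * u⁻¹.im ^ 2 := by
    have h1 := h.sq_norm_le
    rw [← Complex.normSq_eq_norm_sq] at h1
    rw [← Complex.normSq_eq_norm_sq, Complex.inv_im, Complex.normSq_inv, div_pow, neg_sq,
      ← mul_div_assoc, le_div_iff₀ (by positivity)]
    calc _ = Complex.normSq u := by field_simp
      _ ≤ _ := h1
  have hC : 0 ≤ C ^ 2 := by positivity
  rw [stepPrimitive]
  split_ifs with h1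
  · rw [norm_neg]
    refine (norm_oddTail_le h.im_ne_zero h.sq_norm_le (h.pow_le _ (by omega))).trans ?_
    obtain ⟨e, rfl⟩ : ∃ e : ℕ, d = (e + 1 : ℕ) := ⟨(d - 1).toNat, by omega⟩
    have h2 : (((e + 1 : ℕ) : ℤ) - 1).toNat = e := by omega
    rw [h2, Int.natAbs_natCast, mul_one_div, div_le_div_iff₀ (by positivity) (by positivity)]
    push_cast
    have : (0 : ℝ) ≤ e := Nat.cast_nonneg e
    nlinarith [mul_nonneg hC this]
  · rw [norm_neg]
    -- Here 1 - d is at most n + 2, so the exponent 2(n+2)+1 = 2n+5 occurs; it fixes the range of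
    -- exponents in `Tame`.
    refine (norm_oddTail_le hui hsq (h.inv_pow_le _ (by omega))).trans ?_
    obtain ⟨e, rfl⟩ : ∃ e : ℕ, d = -(e : ℤ) := ⟨(-d).toNat, by omega⟩
    have h2 : (1 - (-(e : ℤ))).toNat = e + 1 := by omega
    rw [h2, Int.natAbs_neg, Int.natAbs_natCast, mul_one_div,
      div_le_div_iff₀ (by positivity) (by positivity)]
    push_cast
    have : (0 : ℝ) ≤ e := Nat.cast_nonneg e
    nlinarith [mul_nonneg hC this]

/-! ### Summation by parts -/

/-- Summation by parts. Only the increments of A and its two end values enter, not its maximum. -/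
lemma norm_sum_mul_sub_le (A : ℕ → ℝ) (g : ℕ → ℂ) (n : ℕ) {D : ℝ} (h0 : |A 0| ≤ D)
    (hA : ∀ k < n, |A (k + 1) - A k| ≤ D) (hn : |A n| ≤ D) :
    ‖∑ k ∈ Finset.range (n + 1), (A k : ℂ) * (g (k + 1) - g k)‖ ≤
      D * ∑ k ∈ Finset.range (n + 2), ‖g k‖ := by
  have h : ∀ n, ∑ k ∈ Finset.range (n + 1), (A k : ℂ) * (g (k + 1) - g k) =
      A n * g (n + 1) - ∑ k ∈ Finset.range n, ((A (k + 1) - A k : ℝ) : ℂ) * g (k + 1)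
        - A 0 * g 0 := by
    intro n
    induction n with
    | zero => simp; ring
    | succ n ih =>
      rw [Finset.sum_range_succ, ih, Finset.sum_range_succ _ n]
      push_cast
      ring
  have h1 : ‖(A n : ℂ) * g (n + 1)‖ ≤ D * ‖g (n + 1)‖ := by
    rw [norm_mul, Complex.norm_real]
    exact mul_le_mul_of_nonneg_right hn (norm_nonneg _)
  have h2 : ‖∑ k ∈ Finset.range n, ((A (k + 1) - A k : ℝ) : ℂ) * g (k + 1)‖ ≤
      D * ∑ k ∈ Finset.range n, ‖g (k + 1)‖ := by
    rw [Finset.mul_sum]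
    refine norm_sum_le_of_le _ fun k hk => ?_
    rw [norm_mul, Complex.norm_real]
    exact mul_le_mul_of_nonneg_right (hA k (by simpa using hk)) (norm_nonneg _)
  have h3 : ‖(A 0 : ℂ) * g 0‖ ≤ D * ‖g 0‖ := by
    rw [norm_mul, Complex.norm_real]
    exact mul_le_mul_of_nonneg_right h0 (norm_nonneg _)
  rw [h, Finset.sum_range_succ, Finset.sum_range_succ', mul_add, mul_add]
  refine (norm_sub_le _ _).trans ?_
  have := norm_sub_le ((A n : ℂ) * g (n + 1))
    (∑ k ∈ Finset.range n, ((A (k + 1) - A k : ℝ) : ℂ) * g (k + 1))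
  linarith

/-- Abel's inequality for a nonnegative increasing factor. -/
lemma norm_sum_mul_le_of_monotone (f : ℕ → ℝ) (x : ℕ → ℂ) (n : ℕ) {M : ℝ} (h0 : 0 ≤ f 0)
    (hf : ∀ k < n, f k ≤ f (k + 1))
    (hx : ∀ k ≤ n + 1, ‖∑ i ∈ Finset.range k, x i‖ ≤ M) :
    ‖∑ k ∈ Finset.range (n + 1), (f k : ℂ) * x k‖ ≤ 2 * f n * M := by
  have h : ∀ n, ∑ k ∈ Finset.range (n + 1), (f k : ℂ) * x k =
      f n * (∑ i ∈ Finset.range (n + 1), x i) -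
      ∑ k ∈ Finset.range n, ((f (k + 1) - f k : ℝ) : ℂ) * ∑ i ∈ Finset.range (k + 1), x i := by
    intro n
    induction n with
    | zero => simp
    | succ n ih =>
      have e1 := Finset.sum_range_succ x (n + 1)
      have e2 := Finset.sum_range_succ (fun k => ((f (k + 1) - f k : ℝ) : ℂ) *
        ∑ i ∈ Finset.range (k + 1), x i) n
      rw [Finset.sum_range_succ, ih, e2, e1]
      push_cast
      ring
  have hM : 0 ≤ M := (norm_nonneg _).trans (hx 0 (by omega))
  have h0n : ∀ k ≤ n, 0 ≤ f k := by
    intro k hk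
    induction k with
    | zero => exact h0
    | succ k ih => exact (ih (by omega)).trans (hf k (by omega))
  rw [h]
  refine (norm_sub_le _ _).trans ?_
  have h1 : ‖(f n : ℂ) * ∑ i ∈ Finset.range (n + 1), x i‖ ≤ f n * M := by
    rw [norm_mul, Complex.norm_real, Real.norm_of_nonneg (h0n n le_rfl)]
    exact mul_le_mul_of_nonneg_left (hx _ le_rfl) (h0n n le_rfl)
  have h2 : ‖∑ k ∈ Finset.range n, ((f (k + 1) - f k : ℝ) : ℂ) *
      ∑ i ∈ Finset.range (k + 1), x i‖ ≤ f n * M := by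
    calc _ ≤ ∑ k ∈ Finset.range n, (f (k + 1) - f k) * M := by
          refine norm_sum_le_of_le _ fun k hk => ?_
          have hk' : k < n := by simpa using hk
          have h3 := sub_nonneg.2 (hf k hk')
          rw [norm_mul, Complex.norm_real, Real.norm_of_nonneg h3]
          exact mul_le_mul_of_nonneg_left (hx _ (by omega)) h3
      _ = (f n - f 0) * M := by rw [← Finset.sum_mul, Finset.sum_range_sub]
      _ ≤ f n * M := by nlinarith
  linarith

/-- The partial sums of the harmonic series. -/
noncomputable def harmonicSum (n : ℕ) : ℝ := ∑ i ∈ Finset.range n, 1 / ((i : ℝ) + 1)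

lemma harmonicSum_mono : Monotone harmonicSum := fun m n h =>
  Finset.sum_le_sum_of_subset_of_nonneg (Finset.range_mono h) fun i _ _ => by positivity

lemma sum_one_div_dist_le (n l : ℕ) (hl : l ≤ n) :
    ∑ k ∈ Finset.range n, 1 / ((((k : ℤ) - l).natAbs : ℝ) + 1) ≤ 2 * harmonicSum (n + 1) := by
  rw [Finset.range_eq_Ico, ← Finset.sum_Ico_consecutive _ (Nat.zero_le l) hl, two_mul]
  refine add_le_add ?_ ?_
  · rw [← Finset.range_eq_Ico, ← Finset.sum_range_reflect]
    refine le_trans ?_ (harmonicSum_mono (by omega : l ≤ n + 1))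
    refine Finset.sum_le_sum fun k hk => ?_
    have hk' : k < l := by simpa using hk
    have : (((l - 1 - k : ℕ) : ℤ) - l).natAbs = k + 1 := by omega
    rw [this]
    exact one_div_le_one_div_of_le (by positivity) (by push_cast; linarith)
  · rw [Finset.sum_Ico_eq_sum_range]
    refine le_trans ?_ (harmonicSum_mono (by omega : n - l ≤ n + 1))
    refine Finset.sum_le_sum fun k hk => ?_
    have : (((l + k : ℕ) : ℤ) - l).natAbs = k := by omega
    rw [this]

/-! ### The leading term of the kernel -/

/-- The products A_k A_{n-k} reach the order n in the middle, but an increment is a difference of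
two nonnegative numbers A_m B_{k+1} and A_k B_{m+1}, each at most A_n. This saves a factor √n. -/
lemma abs_coeffA_mul_sub_le {n k : ℕ} (hk : k < n) :
    |coeffA (k + 1) * coeffA (n - (k + 1)) - coeffA k * coeffA (n - k)| ≤ coeffA n := by
  obtain ⟨m, rfl⟩ : ∃ m, n = k + 1 + m := ⟨n - (k + 1), by omega⟩
  have h1 : k + 1 + m - (k + 1) = m := by omega
  have h2 : k + 1 + m - k = m + 1 := by omega
  rw [h1, h2, coeffA_succ, coeffA_succ]
  have e : (coeffA k + coeffB (k + 1)) * coeffA m - coeffA k * (coeffA m + coeffB (m + 1)) =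
    coeffB (k + 1) * coeffA m - coeffA k * coeffB (m + 1) := by ring
  rw [e]
  have b1 : 0 ≤ coeffB (k + 1) * coeffA m := (mul_pos (coeffB_pos _) (coeffA_pos _)).le
  have b2 : 0 ≤ coeffA k * coeffB (m + 1) := (mul_pos (coeffA_pos _) (coeffB_pos _)).le
  have b3 : coeffB (k + 1) * coeffA m ≤ coeffA (k + 1 + m) := by
    calc _ ≤ 1 * coeffA m := mul_le_mul_of_nonneg_right (coeffB_le_one _) (coeffA_pos _).le
      _ ≤ _ := by rw [one_mul]; exact coeffA_monotone (by omega)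
  have b4 : coeffA k * coeffB (m + 1) ≤ coeffA (k + 1 + m) := by
    calc _ ≤ coeffA k * 1 := mul_le_mul_of_nonneg_left (coeffB_le_one _) (coeffA_pos _).le
      _ ≤ _ := by rw [mul_one]; exact coeffA_monotone (by omega)
  rw [abs_le]
  constructor <;> linarith

/-- The point mass picks the term k = l. The remainder is a sum of differences of a sequence of size
O(1/|k-l|), and summation by parts costs A_n and a harmonic sum. -/
lemma Tame.norm_sum_sub_le {u : ℂ} {n : ℕ} {C : ℝ} (h : Tame u n C) {l : ℕ} (hl : l ≤ n) :
    ‖∑ k ∈ Finset.range (n + 1), ((coeffA k * coeffA (n - k) : ℝ) : ℂ) *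
        (u ^ (2 * k) / (2 * k - 2 * l - 1)) -
      u ^ (2 * l + 1) * (Complex.I * (Real.pi / 2) * (Real.sign u.im : ℂ)) *
        ((coeffA l * coeffA (n - l) : ℝ) : ℂ)‖ ≤
      4 * C ^ 3 * (coeffA n * harmonicSum (n + 3)) := by
  set γ : ℂ := Complex.I * (Real.pi / 2) * (Real.sign u.im : ℂ) with hγ
  set A : ℕ → ℝ := fun k => coeffA k * coeffA (n - k) with hA
  set g : ℕ → ℂ := fun k => stepPrimitive u ((k : ℤ) - l) with hg
  have hu0 := h.ne_zero
  have hC := h.one_le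
  have h1 : ∀ k, (A k : ℂ) * (u ^ (2 * k) / (2 * k - 2 * l - 1)) =
      u ^ (2 * l + 1) * ((A k : ℂ) * (g (k + 1) - g k)) +
        (if k = l then u ^ (2 * l + 1) * γ * (A k : ℂ) else 0) := by
    intro k
    have h2 := zpow_div_eq_stepPrimitive h.im_ne_zero ((k : ℤ) - l)
    have h3 : u ^ (2 * k) = u ^ (2 * l + 1) * u ^ (2 * ((k : ℤ) - l) - 1) := by
      rw [← zpow_natCast, ← zpow_natCast, ← zpow_add₀ hu0]
      congr 1
      push_cast
      ring
    have h4 : (2 * k - 2 * l - 1 : ℂ) = 2 * (((k : ℤ) - l : ℤ) : ℂ) - 1 := by push_cast; ring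
    have h5 : (k : ℤ) - l + 1 = ((k + 1 : ℕ) : ℤ) - l := by push_cast; ring
    have h6 : (k : ℤ) - l = 0 ↔ k = l := by omega
    rw [h3, h4, mul_div_assoc, h2, h5]
    simp only [h6]
    split_ifs <;> simp only [hg] <;> ring
  have h2 : ∑ k ∈ Finset.range (n + 1), (A k : ℂ) * (u ^ (2 * k) / (2 * k - 2 * l - 1)) -
      u ^ (2 * l + 1) * γ * (A l : ℂ) =
      u ^ (2 * l + 1) * ∑ k ∈ Finset.range (n + 1), (A k : ℂ) * (g (k + 1) - g k) := by
    simp only [h1]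
    rw [Finset.sum_add_distrib, Finset.sum_ite_eq' , if_pos (by simpa [Nat.lt_succ_iff] using hl),
      ← Finset.mul_sum]
    ring
  rw [h2, norm_mul, norm_pow]
  have hApos := coeffA_pos n
  have h3 := norm_sum_mul_sub_le A g n (D := coeffA n)
    (by simp [hA, abs_of_pos hApos]) (fun k hk => abs_coeffA_mul_sub_le hk)
    (by simp [hA, abs_of_pos hApos])
  -- Summation by parts uses the primitive at one index beyond the sum, so |k - l| can be n + 1.
  have h4 : ∑ k ∈ Finset.range (n + 2), ‖g k‖ ≤ 2 * C ^ 2 * (2 * harmonicSum (n + 3)) := by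
    refine le_trans (Finset.sum_le_sum fun k hk => h.norm_stepPrimitive_le ?_) ?_
    · have : k < n + 2 := by simpa using hk
      omega
    · rw [← Finset.mul_sum]
      exact mul_le_mul_of_nonneg_left (sum_one_div_dist_le _ _ (by omega)) (by positivity)
  calc _ ≤ C * (coeffA n * (2 * C ^ 2 * (2 * harmonicSum (n + 3)))) := by
        refine mul_le_mul (h.pow_le _ (by omega)) (h3.trans ?_) (norm_nonneg _) (by linarith)
        exact mul_le_mul_of_nonneg_left h4 hApos.le
    _ = _ := by ring

/-- The diagonal part of the kernel. -/
noncomputable def diagSum (s : ℝ≥0∞) (n : ℕ) (q : ℂ) : ℂ :=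
  ∑ l ∈ Finset.range (n + 1), ((relFactor s (2 * l + 2) * (coeffA l * coeffB (n - l)) *
    (coeffA l * coeffA (n - l)) : ℝ) : ℂ) * q ^ (2 * l + 1)

/-- The error of the inner sum is uniform in l. The outer coefficients A_l B_{n-l} add up to at most
A_n^2, since the partial sums of B are A. -/
lemma norm_sum_skewPoly_sub_le {s : ℝ≥0∞} {n : ℕ} (hs : ((2 * (n + 1) : ℕ) : ℝ≥0∞) < s) {u v : ℂ}
    {C : ℝ} (hu : Tame u n C) (hv : Tame v n C) :
    ‖∑ j ∈ Finset.range (n + 1), Polynomial.aeval u (skewPolyEven j) *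
      Polynomial.aeval v (skewPolyOdd s j) -
      -(1 / 4) * (Complex.I * (Real.pi / 2) * (Real.sign u.im : ℂ)) * diagSum s n (u * v)‖ ≤
      C ^ 4 * (coeffA n ^ 3 * harmonicSum (n + 3)) := by
  have hC := hu.one_le
  rw [sum_skewPoly_mul, diagSum, mul_assoc (-(1 / 4) : ℂ), ← mul_sub, Finset.mul_sum,
    ← Finset.sum_sub_distrib]
  have h1 : ∀ l ∈ Finset.range (n + 1),
      ‖((relFactor s (2 * l + 2) * (coeffA l * coeffB (n - l)) : ℝ) : ℂ) * v ^ (2 * l + 1) *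
      (∑ k ∈ Finset.range (n + 1), ((coeffA k * coeffA (n - k) : ℝ) : ℂ) *
        (u ^ (2 * k) / (2 * k - 2 * l - 1))) -
      Complex.I * (Real.pi / 2) * (Real.sign u.im : ℂ) *
        (((relFactor s (2 * l + 2) * (coeffA l * coeffB (n - l)) *
        (coeffA l * coeffA (n - l)) : ℝ) : ℂ) * (u * v) ^ (2 * l + 1))‖ ≤
      coeffB (n - l) * (4 * C ^ 4 * (coeffA n ^ 2 * harmonicSum (n + 3))) := by
    intro l hl
    have hl' : l ≤ n := by simpa [Nat.lt_succ_iff] using hl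
    have h2 := hu.norm_sum_sub_le hl'
    have hr := relFactor_mem_Icc hs (by omega : 2 * l + 2 ≤ 2 * (n + 1))
    have e : ∀ S : ℂ, ((relFactor s (2 * l + 2) * (coeffA l * coeffB (n - l)) : ℝ) : ℂ) *
        v ^ (2 * l + 1) * S - Complex.I * (Real.pi / 2) * (Real.sign u.im : ℂ) *
        (((relFactor s (2 * l + 2) * (coeffA l * coeffB (n - l)) *
        (coeffA l * coeffA (n - l)) : ℝ) : ℂ) * (u * v) ^ (2 * l + 1)) =
      ((relFactor s (2 * l + 2) * (coeffA l * coeffB (n - l)) : ℝ) : ℂ) * v ^ (2 * l + 1) *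
        (S - u ^ (2 * l + 1) * (Complex.I * (Real.pi / 2) * (Real.sign u.im : ℂ)) *
        ((coeffA l * coeffA (n - l) : ℝ) : ℂ)) := by
      intro S
      push_cast
      ring
    rw [e, norm_mul, norm_mul, Complex.norm_real, norm_pow]
    have ha := coeffA_pos l
    have hb := coeffB_pos (n - l)
    have h3 : ‖relFactor s (2 * l + 2) * (coeffA l * coeffB (n - l))‖ ≤
        1 * (coeffA n * coeffB (n - l)) := by
      rw [Real.norm_of_nonneg (mul_nonneg hr.1 (mul_pos ha hb).le)]
      refine mul_le_mul hr.2 ?_ (mul_pos ha hb).le zero_le_one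
      exact mul_le_mul_of_nonneg_right (coeffA_monotone hl') hb.le
    calc _ ≤ 1 * (coeffA n * coeffB (n - l)) * C * (4 * C ^ 3 * (coeffA n * harmonicSum (n + 3))) := by
          refine mul_le_mul (mul_le_mul h3 (hv.pow_le _ (by omega)) (by positivity) ?_) h2
            (norm_nonneg _) ?_
          · have := coeffA_pos n; positivity
          · have := coeffA_pos n; positivity
      _ = _ := by ring
  rw [norm_mul]
  calc _ ≤ ‖(-(1 / 4) : ℂ)‖ * ∑ l ∈ Finset.range (n + 1),
        coeffB (n - l) * (4 * C ^ 4 * (coeffA n ^ 2 * harmonicSum (n + 3))) :=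
        mul_le_mul_of_nonneg_left (norm_sum_le_of_le _ h1) (norm_nonneg _)
    _ = _ := by
      rw [← Finset.sum_mul, sum_coeffB_reflect]
      norm_num
      ring

/-! ### The correction for odd `N` is of lower order -/

lemma Tame.mono {u : ℂ} {n m : ℕ} {C : ℝ} (h : Tame u n C) (hm : m ≤ n) : Tame u m C :=
  ⟨h.im_ne_zero, h.sq_norm_le, fun k hk => h.pow_le k (by omega),
    fun k hk => h.inv_pow_le k (by omega)⟩

lemma Tame.mono_const {u : ℂ} {n : ℕ} {C C' : ℝ} (h : Tame u n C) (hC : C ≤ C') : Tame u n C' :=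
  ⟨h.im_ne_zero, h.sq_norm_le.trans (by gcongr), fun k hk => (h.pow_le k hk).trans hC,
    fun k hk => (h.inv_pow_le k hk).trans hC⟩

/-- Abel's inequality: the coefficients A_k B_{n-k} increase to A_n, and the geometric sums of
u^(2k) are bounded because u² stays away from 1. -/
lemma Tame.norm_skewPolyEven_le {u : ℂ} {n : ℕ} {C : ℝ} (h : Tame u n C) :
    ‖Polynomial.aeval u (skewPolyEven n)‖ ≤ 4 * C ^ 2 * coeffA n := by
  have hC := h.one_le
  rw [aeval_skewPolyEven]
  have h1 : 1 ≤ C * ‖1 - u ^ 2‖ := by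
    have h3 := sq_im_le_sq_norm_mul u 1
    have him : 0 < u.im ^ 2 := by have := h.im_ne_zero; positivity
    simp only [Complex.ofReal_one, one_pow, mul_one] at h3
    have : u.im ^ 2 * 1 ≤ u.im ^ 2 * (C * ‖1 - u ^ 2‖) := by
      calc u.im ^ 2 * 1 ≤ ‖u‖ ^ 2 * ‖1 - u ^ 2‖ := by linarith
        _ ≤ (C * u.im ^ 2) * ‖1 - u ^ 2‖ := mul_le_mul_of_nonneg_right h.sq_norm_le (norm_nonneg _)
        _ = _ := by ring
    exact le_of_mul_le_mul_left this him
  have h0 : 0 < ‖1 - u ^ 2‖ := by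
    by_contra h2
    nlinarith [norm_nonneg (1 - u ^ 2)]
  have hx : ∀ k ≤ n + 1, ‖∑ i ∈ Finset.range k, u ^ (2 * i)‖ ≤ 2 * C ^ 2 := by
    intro k hk
    have h2 : (∑ i ∈ Finset.range k, u ^ (2 * i)) * (1 - u ^ 2) = 1 - u ^ (2 * k) := by
      simp only [pow_mul]
      exact geom_sum_mul_neg _ _
    have h3 : ‖∑ i ∈ Finset.range k, u ^ (2 * i)‖ * ‖1 - u ^ 2‖ ≤ 2 * C := by
      rw [← norm_mul, h2]
      refine (norm_sub_le _ _).trans ?_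
      rw [norm_one, norm_pow]
      linarith [h.pow_le (2 * k) (by omega)]
    refine le_of_mul_le_mul_right (h3.trans ?_) h0
    nlinarith
  have := norm_sum_mul_le_of_monotone (fun k => coeffA k * coeffB (n - k)) (fun k => u ^ (2 * k)) n
    (mul_pos (coeffA_pos _) (coeffB_pos _)).le (fun k _ =>
      mul_le_mul (coeffA_monotone k.le_succ) (coeffB_antitone (by omega)) (coeffB_pos _).le
        (coeffA_pos _).le) hx
  refine this.trans (le_of_eq ?_)
  simp
  ring

/-- The ratios increase and are at most 1, so Abel's inequality reduces to the sums of the π_{2j+1}.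
Their coefficients are bounded by A_k B_{n-k}, and the triangle inequality is enough. -/
lemma Tame.norm_sum_ratio_mul_skewPolyOdd_le {s : ℝ≥0∞} {v : ℂ} {n : ℕ} {C : ℝ}
    (hs : ((2 * n + 1 : ℕ) : ℝ≥0∞) < s) (h : Tame v n C) :
    ‖∑ j ∈ Finset.range n, (skewIntRatio s n j : ℂ) * Polynomial.aeval v (skewPolyOdd s j)‖ ≤
      2 * C * coeffA n ^ 2 := by
  have hC := h.one_le
  rcases n with _ | n
  · simp; linarith
  have hx : ∀ k ≤ n + 1, ‖∑ i ∈ Finset.range k, Polynomial.aeval v (skewPolyOdd s i)‖ ≤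
      C * coeffA (n + 1) ^ 2 := by
    intro k hk
    rcases k with _ | k
    · simp; positivity
    rw [sum_aeval_skewPolyOdd]
    have : ∀ i ∈ Finset.range (k + 1), ‖((1 / 4 * (relFactor s (2 * i + 2) *
        (coeffA i * coeffB (k - i))) : ℝ) : ℂ) * v ^ (2 * i + 1)‖ ≤
        coeffB (k - i) * (C * coeffA (n + 1)) := by
      intro i hi
      have hi' : i ≤ k := by simpa [Nat.lt_succ_iff] using hi
      have hr := relFactor_mem_Icc hs (by omega : 2 * i + 2 ≤ 2 * (n + 1) + 1)
      have ha := coeffA_pos i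
      have hb := coeffB_pos (k - i)
      rw [norm_mul, Complex.norm_real, norm_pow, Real.norm_of_nonneg (by
        have := hr.1; positivity)]
      calc _ ≤ (1 / 4 * (1 * (coeffA (n + 1) * coeffB (k - i)))) * C := by
            refine mul_le_mul ?_ (h.pow_le _ (by omega)) (by positivity) ?_
            · refine mul_le_mul_of_nonneg_left ?_ (by norm_num)
              refine mul_le_mul hr.2 ?_ (mul_pos ha hb).le zero_le_one
              exact mul_le_mul_of_nonneg_right (coeffA_monotone (by omega)) hb.le
            · have := coeffA_pos (n + 1); positivity
        _ ≤ _ := by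
            have : 0 ≤ coeffB (k - i) * (C * coeffA (n + 1)) := by
              have := coeffA_pos (n + 1); positivity
            linarith
    refine (norm_sum_le_of_le _ this).trans ?_
    rw [← Finset.sum_mul, sum_coeffB_reflect]
    have h1 : coeffA k ≤ coeffA (n + 1) := coeffA_monotone (by omega)
    calc _ ≤ coeffA (n + 1) * (C * coeffA (n + 1)) := by
          refine mul_le_mul_of_nonneg_right h1 ?_
          have := coeffA_pos (n + 1); positivity
      _ = _ := by ring
  have := norm_sum_mul_le_of_monotone (skewIntRatio s (n + 1))
    (fun j => Polynomial.aeval v (skewPolyOdd s j)) n (skewIntRatio_nonneg hs (by omega))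
    (fun k hk => skewIntRatio_mono hs (by omega)) hx
  refine this.trans ?_
  have h1 := skewIntRatio_le_one hs (by omega : n ≤ n + 1)
  have h2 : 0 ≤ C * coeffA (n + 1) ^ 2 := by positivity
  nlinarith

lemma norm_oddCorrection_le {s : ℝ≥0∞} {u v : ℂ} {n : ℕ} {C : ℝ}
    (hs : ((2 * n + 1 : ℕ) : ℝ≥0∞) < s) (hu : Tame u n C) (hv : Tame v n C) :
    ‖oddCorrection s n u v‖ ≤ 32 * C ^ 3 * coeffA n ^ 3 := by
  have hC := hu.one_le
  have e : oddCorrection s n u v = -2 * (Polynomial.aeval u (skewPolyEven n) *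
      ∑ j ∈ Finset.range n, (skewIntRatio s n j : ℂ) * Polynomial.aeval v (skewPolyOdd s j) -
      Polynomial.aeval v (skewPolyEven n) *
      ∑ j ∈ Finset.range n, (skewIntRatio s n j : ℂ) * Polynomial.aeval u (skewPolyOdd s j)) := by
    rw [oddCorrection, Finset.mul_sum, Finset.mul_sum, Finset.mul_sum, ← Finset.sum_sub_distrib,
      Finset.mul_sum, ← Finset.sum_neg_distrib]
    refine Finset.sum_congr rfl fun j hj => ?_
    have hj' : j < n := by simpa using hj
    rw [skewInt_div_skewInt hs hj'.le]
    ring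
  have key : ∀ u v : ℂ, Tame u n C → Tame v n C → ‖Polynomial.aeval u (skewPolyEven n) *
      ∑ j ∈ Finset.range n, (skewIntRatio s n j : ℂ) * Polynomial.aeval v (skewPolyOdd s j)‖ ≤
      8 * C ^ 3 * coeffA n ^ 3 := by
    intro u v hu hv
    rw [norm_mul]
    calc _ ≤ (4 * C ^ 2 * coeffA n) * (2 * C * coeffA n ^ 2) :=
          mul_le_mul hu.norm_skewPolyEven_le (hv.norm_sum_ratio_mul_skewPolyOdd_le hs)
            (norm_nonneg _) (by have := coeffA_pos n; positivity)
      _ = _ := by ring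
  rw [e, norm_mul]
  have h1 := key u v hu hv
  have h2 := key v u hv hu
  have h3 := norm_sub_le (Polynomial.aeval u (skewPolyEven n) *
      ∑ j ∈ Finset.range n, (skewIntRatio s n j : ℂ) * Polynomial.aeval v (skewPolyOdd s j))
      (Polynomial.aeval v (skewPolyEven n) *
      ∑ j ∈ Finset.range n, (skewIntRatio s n j : ℂ) * Polynomial.aeval u (skewPolyOdd s j))
  have h4 : ‖(-2 : ℂ)‖ = 2 := by simp
  rw [h4]
  linarith

/-! ### Growth of the error terms -/

lemma harmonicSum_le (n : ℕ) : harmonicSum n ≤ 1 + Real.log n := by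
  have := harmonic_le_one_add_log n
  simpa [harmonicSum, harmonic] using this

lemma one_le_harmonicSum (n : ℕ) : 1 ≤ harmonicSum (n + 1) := by
  have := harmonicSum_mono (by omega : 1 ≤ n + 1)
  simpa [harmonicSum] using this

/-- With A_n of order √n the quotient has order n^(-1/2) log n. -/
lemma tendsto_growth :
    Tendsto (fun n : ℕ => coeffA n ^ 3 * harmonicSum (n + 3) / ((n : ℝ) + 1) ^ 2) atTop (𝓝 0) := by
  have h1 : Tendsto (fun x : ℝ => (1 + Real.log x) / x ^ (1 / 2 : ℝ)) atTop (𝓝 0) := by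
    have a1 : Tendsto (fun x : ℝ => 1 / x ^ (1 / 2 : ℝ)) atTop (𝓝 0) := by
      have := (tendsto_rpow_atTop (by norm_num : (0 : ℝ) < 1 / 2)).inv_tendsto_atTop
      exact this.congr fun x => (one_div _).symm
    have a2 := (isLittleO_log_rpow_atTop (by norm_num : (0 : ℝ) < 1 / 2)).tendsto_div_nhds_zero
    simpa [add_div] using a1.add a2
  have h2 : Tendsto (fun n : ℕ => ((n + 3 : ℕ) : ℝ)) atTop atTop :=
    tendsto_natCast_atTop_atTop.comp (tendsto_add_atTop_nat 3)
  have h3 := (h1.comp h2).const_mul 6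
  rw [mul_zero] at h3
  refine squeeze_zero (fun n => ?_) (fun n => ?_) h3
  · have := coeffA_pos n
    have := one_le_harmonicSum (n + 2)
    positivity
  · have ha := coeffA_pos n
    have hsq := coeffA_sq_le n
    have hn : (0 : ℝ) ≤ n := Nat.cast_nonneg n
    have hh := one_le_harmonicSum (n + 2)
    have hh2 := harmonicSum_le (n + 3)
    have e1 : ((n + 3 : ℕ) : ℝ) ^ (1 / 2 : ℝ) = √((n + 3 : ℕ) : ℝ) := by rw [Real.sqrt_eq_rpow]
    simp only [Function.comp, e1]
    have hx : (0 : ℝ) < √((n + 3 : ℕ) : ℝ) := Real.sqrt_pos.2 (by positivity)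
    have h4 : coeffA n * √((n + 3 : ℕ) : ℝ) ≤ 3 * (n + 1) := by
      refine abs_le_of_sq_le_sq' ?_ (by positivity) |>.2
      rw [mul_pow, Real.sq_sqrt (by positivity)]
      push_cast
      nlinarith
    have h5 : coeffA n ^ 3 * harmonicSum (n + 3) / ((n : ℝ) + 1) ^ 2 ≤
        6 * harmonicSum (n + 3) / √((n + 3 : ℕ) : ℝ) := by
      rw [div_le_div_iff₀ (by positivity) hx]
      calc coeffA n ^ 3 * harmonicSum (n + 3) * √((n + 3 : ℕ) : ℝ) =
          coeffA n ^ 2 * (coeffA n * √((n + 3 : ℕ) : ℝ)) * harmonicSum (n + 3) := by ring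
        _ ≤ (2 * (n + 1)) * (3 * (n + 1)) * harmonicSum (n + 3) := by gcongr
        _ = _ := by ring
    refine h5.trans ?_
    rw [← mul_div_assoc]
    gcongr

/-! ### Tameness near the unit circle -/

section

variable {ι : Type*} {l : Filter ι} {N : ι → ℕ}

lemma tendsto_div_natCast (hN : Tendsto N l atTop) {z : ι → ℂ} {z₀ : ℂ}
    (hz : Tendsto z l (𝓝 z₀)) : Tendsto (fun i => z i / (N i : ℂ)) l (𝓝 0) := by
  have h1 : Tendsto (fun i => ((N i : ℂ))⁻¹) l (𝓝 0) :=
    tendsto_inv_atTop_nhds_zero_nat (𝕜 := ℂ) |>.comp hN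
  simpa [div_eq_mul_inv] using hz.mul h1

lemma exists_tame (hN : Tendsto N l atTop) {ξ : ℂ} (hξ : ‖ξ‖ = 1) (him : ξ.im ≠ 0) {z : ι → ℂ}
    {z₀ : ℂ} (hz : Tendsto z l (𝓝 z₀)) :
    ∃ C : ℝ, ∀ᶠ i in l, Tame (ξ + z i / N i) (N i / 2) C ∧
      Real.sign (ξ + z i / N i).im = Real.sign ξ.im := by
  set R : ℝ := ‖z₀‖ + 1 with hR
  have hR0 : 0 < R := by positivity
  have hu : Tendsto (fun i => ξ + z i / N i) l (𝓝 ξ) := by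
    simpa using (tendsto_div_natCast hN hz).const_add ξ
  have him2 : Tendsto (fun i => (ξ + z i / N i).im) l (𝓝 ξ.im) :=
    (Complex.continuous_im.tendsto ξ).comp hu
  have hsgn : ∀ᶠ i in l, Real.sign (ξ + z i / N i).im = Real.sign ξ.im := by
    rcases lt_or_gt_of_ne him with h | h
    · filter_upwards [him2.eventually (gt_mem_nhds h)] with i hi
      rw [Real.sign_of_neg hi, Real.sign_of_neg h]
    · filter_upwards [him2.eventually (lt_mem_nhds h)] with i hi
      rw [Real.sign_of_pos hi, Real.sign_of_pos h]
  -- Both |u| and 1/|u| are at most 1 + 2R/N, and the exponents are at most 6N; this gives exp(12R).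
  -- The other summand comes from |u| ≤ 2 and (Im u)² ≥ (Im ξ)²/4.
  refine ⟨Real.exp (12 * R) + 16 / ξ.im ^ 2, ?_⟩
  have e1 : ∀ᶠ i in l, ‖z i‖ ≤ R := by
    have := hz.norm.eventually (gt_mem_nhds (by linarith : ‖z₀‖ < R))
    filter_upwards [this] with i hi using hi.le
  have e2 : ∀ᶠ i in l, 1 ≤ N i ∧ 2 * R ≤ N i := by
    filter_upwards [hN.eventually_ge_atTop 1, hN.eventually_ge_atTop ⌈2 * R⌉₊] with i h1 h2
    exact ⟨h1, Nat.ceil_le.1 h2⟩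
  have e3 : ∀ᶠ i in l, ξ.im ^ 2 / 4 < (ξ + z i / N i).im ^ 2 := by
    have := (him2.pow 2).eventually (lt_mem_nhds (a := ξ.im ^ 2 / 4) (by
      have : 0 < ξ.im ^ 2 := by positivity
      linarith))
    exact this
  have e4 : ∀ᶠ i in l, ‖ξ + z i / N i‖ < 2 :=
    hu.norm.eventually (gt_mem_nhds (by rw [hξ]; norm_num))
  filter_upwards [hsgn, e1, e2, e3, e4] with i h0 h1 h2 h3 h4
  refine ⟨?_, h0⟩
  have hNpos : (0 : ℝ) < N i := by exact_mod_cast h2.1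
  have hzN : ‖z i / N i‖ ≤ R / N i := by
    rw [norm_div, Complex.norm_natCast]
    exact div_le_div_of_nonneg_right h1 hNpos.le
  have hRN : R / N i ≤ 1 / 2 := by
    rw [div_le_div_iff₀ hNpos two_pos]; linarith [h2.2]
  have hRN0 : 0 ≤ R / N i := by positivity
  have him0 : 0 < ξ.im ^ 2 := by positivity
  have hpow : ∀ x : ℝ, 0 ≤ x → x ≤ 1 + 2 * (R / N i) → ∀ m ≤ 2 * (N i / 2) + 5,
      x ^ m ≤ Real.exp (12 * R) + 16 / ξ.im ^ 2 := by
    intro x hx0 hx m hm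
    have hm' : (m : ℝ) ≤ 6 * N i := by
      have : m ≤ 6 * N i := by omega
      exact_mod_cast this
    calc x ^ m ≤ Real.exp (2 * (R / N i)) ^ m := by
          refine pow_le_pow_left₀ hx0 (hx.trans ?_) m
          linarith [Real.add_one_le_exp (2 * (R / N i))]
      _ = Real.exp (m * (2 * (R / N i))) := by rw [← Real.exp_nat_mul]
      _ ≤ Real.exp (12 * R) := by
          refine Real.exp_le_exp.2 ?_
          calc (m : ℝ) * (2 * (R / N i)) ≤ (6 * N i) * (2 * (R / N i)) := by gcongr
            _ = 12 * R := by field_simp; ring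
      _ ≤ _ := by have : 0 ≤ 16 / ξ.im ^ 2 := by positivity
                  linarith
  have hlow : 1 - R / N i ≤ ‖ξ + z i / N i‖ := by
    have := norm_sub_norm_le ξ (-(z i / N i))
    rw [norm_neg, hξ, sub_neg_eq_add] at this
    linarith
  refine ⟨?_, ?_, hpow _ (norm_nonneg _) ?_, hpow _ (norm_nonneg _) ?_⟩
  · intro h
    rw [h] at h3
    norm_num at h3
    linarith
  · calc ‖ξ + z i / N i‖ ^ 2 ≤ 2 ^ 2 := by gcongr
      _ = 16 / ξ.im ^ 2 * (ξ.im ^ 2 / 4) := by field_simp; norm_num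
      _ ≤ (Real.exp (12 * R) + 16 / ξ.im ^ 2) * (ξ + z i / N i).im ^ 2 := by
          have := Real.exp_pos (12 * R)
          gcongr
          linarith
  · have := norm_add_le ξ (z i / N i)
    rw [hξ] at this
    linarith
  · rw [norm_inv]
    have hpos : 0 < 1 - R / N i := by linarith
    refine (inv_anti₀ hpos hlow).trans ?_
    rw [inv_le_iff_one_le_mul₀ hpos]
    nlinarith

/-! ### Limits of powers -/

lemma tendsto_natCast_mul_log (hN : Tendsto N l atTop) {t : ι → ℂ} {t₀ : ℂ}
    (ht : Tendsto t l (𝓝 t₀)) :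
    Tendsto (fun i => (N i : ℂ) * Complex.log (1 + t i / N i)) l (𝓝 t₀) := by
  have h0 := tendsto_div_natCast hN ht
  have h1 : Tendsto (fun i => (N i : ℂ) * Complex.log (1 + t i / N i) - t i) l (𝓝 0) := by
    have hb : Tendsto (fun i => ‖t i‖ * ‖t i / N i‖) l (𝓝 0) := by
      simpa using ht.norm.mul h0.norm
    refine squeeze_zero_norm' ?_ hb
    filter_upwards [h0.norm.eventually (gt_mem_nhds (by norm_num : ‖(0 : ℂ)‖ < 1 / 2)),
      hN.eventually_ge_atTop 1] with i hi hNi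
    have hN0 : (N i : ℂ) ≠ 0 := by
      have : N i ≠ 0 := by omega
      exact_mod_cast this
    have e : (N i : ℂ) * Complex.log (1 + t i / N i) - t i =
        N i * (Complex.log (1 + t i / N i) - t i / N i) := by
      field_simp
    rw [e, norm_mul]
    have h2 := Complex.norm_log_one_add_sub_self_le (z := t i / N i) (by linarith)
    have h3 : (1 - ‖t i / N i‖)⁻¹ ≤ 2 := by
      rw [inv_le_comm₀ (by linarith) two_pos]
      linarith
    have h4 : ‖t i‖ = ‖(N i : ℂ)‖ * ‖t i / N i‖ := by
      rw [← norm_mul]; congr 1; field_simp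
    calc _ ≤ ‖(N i : ℂ)‖ * (‖t i / N i‖ ^ 2 * 2 / 2) := by
          refine mul_le_mul_of_nonneg_left (h2.trans ?_) (norm_nonneg _)
          gcongr
      _ = _ := by rw [h4]; ring
  simpa using h1.add ht

lemma tendsto_one_add_div_pow (hN : Tendsto N l atTop) {t : ι → ℂ} {t₀ : ℂ}
    (ht : Tendsto t l (𝓝 t₀)) {m : ι → ℕ} {x : ℝ}
    (hm : Tendsto (fun i => (m i : ℝ) / N i) l (𝓝 x)) :
    Tendsto (fun i => (1 + t i / N i) ^ m i) l (𝓝 (Complex.exp (t₀ * x))) := by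
  have h1 := tendsto_natCast_mul_log hN ht
  have h2 : Tendsto (fun i => (((m i : ℝ) / N i : ℝ) : ℂ)) l (𝓝 (x : ℂ)) :=
    (Complex.continuous_ofReal.tendsto x).comp hm
  refine ((Complex.continuous_exp.tendsto _).comp (h1.mul h2)).congr' ?_
  have h0 := tendsto_div_natCast hN ht
  filter_upwards [h0.norm.eventually (gt_mem_nhds (by norm_num : ‖(0 : ℂ)‖ < 1 / 2)),
      hN.eventually_ge_atTop 1] with i hi hNi
  have hN0 : (N i : ℂ) ≠ 0 := by
    have : N i ≠ 0 := by omega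
    exact_mod_cast this
  have hne : 1 + t i / N i ≠ 0 := by
    intro h
    have : t i / N i = -1 := by linear_combination h
    rw [this] at hi
    norm_num at hi
  have e : (N i : ℂ) * Complex.log (1 + t i / N i) * (((m i : ℝ) / N i : ℝ) : ℂ) =
      m i * Complex.log (1 + t i / N i) := by
    push_cast
    field_simp
  simp only [Function.comp, e]
  rw [Complex.exp_nat_mul, Complex.exp_log hne]

lemma eventually_norm_pow_le (hN : Tendsto N l atTop) {t : ι → ℂ} {t₀ : ℂ}
    (ht : Tendsto t l (𝓝 t₀)) :
    ∀ᶠ i in l, ∀ m ≤ N i, ‖(1 + t i / N i) ^ m‖ ≤ Real.exp (‖t₀‖ + 1) := by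
  filter_upwards [ht.norm.eventually (gt_mem_nhds (by linarith : ‖t₀‖ < ‖t₀‖ + 1)),
    hN.eventually_ge_atTop 1] with i hi hNi m hm
  have hNpos : (0 : ℝ) < N i := by exact_mod_cast hNi
  have hm' : (m : ℝ) ≤ N i := by exact_mod_cast hm
  rw [norm_pow]
  calc ‖1 + t i / N i‖ ^ m ≤ Real.exp (‖t i‖ / N i) ^ m := by
        refine pow_le_pow_left₀ (norm_nonneg _) ((norm_add_le _ _).trans ?_) m
        rw [norm_one, norm_div, Complex.norm_natCast]
        linarith [Real.add_one_le_exp (‖t i‖ / N i)]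
    _ = Real.exp (m * (‖t i‖ / N i)) := by rw [← Real.exp_nat_mul]
    _ ≤ Real.exp (‖t₀‖ + 1) := by
        refine Real.exp_le_exp.2 ?_
        calc (m : ℝ) * (‖t i‖ / N i) ≤ N i * (‖t i‖ / N i) := by gcongr
          _ = ‖t i‖ := by field_simp
          _ ≤ _ := hi.le

/-! ### Riemann sums -/

lemma integral_step (g : ℕ → ℂ) {M : ℕ} (hM : 0 < M) :
    ∫ x in (0 : ℝ)..1, g ⌊(M : ℝ) * x⌋₊ = (M : ℂ)⁻¹ * ∑ k ∈ Finset.range M, g k := by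
  have hEq : ∀ k : ℕ, Set.EqOn (fun y : ℝ => g ⌊y⌋₊) (fun _ => g k) (Set.Ioo k (k + 1 : ℕ)) := by
    intro k y hy
    have : ⌊y⌋₊ = k := (Nat.floor_eq_iff ((Nat.cast_nonneg k).trans hy.1.le)).2
      ⟨hy.1.le, by have := hy.2; push_cast at this; exact this⟩
    simp [this]
  have hint : ∀ k < M, IntervalIntegrable (fun y : ℝ => g ⌊y⌋₊) volume k (k + 1 : ℕ) := by
    intro k _
    rw [intervalIntegrable_iff_integrableOn_Ioo_of_le (by push_cast; linarith)]
    refine IntegrableOn.congr_fun ?_ (hEq k).symm measurableSet_Ioo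
    exact integrableOn_const (by simp)
  have h1 := intervalIntegral.integral_comp_mul_left (fun y : ℝ => g ⌊y⌋₊) (a := 0) (b := 1)
    (c := (M : ℝ)) (by positivity)
  rw [h1, mul_zero, mul_one]
  have h2 := intervalIntegral.sum_integral_adjacent_intervals (a := fun k : ℕ => (k : ℝ))
    (f := fun y : ℝ => g ⌊y⌋₊) (μ := volume) (n := M) hint
  simp only [Nat.cast_zero] at h2
  rw [← h2]
  have h3 : ∀ k : ℕ, ∫ y in (k : ℝ)..(k + 1 : ℕ), g ⌊y⌋₊ = g k := by
    intro k
    rw [intervalIntegral.integral_of_le (by push_cast; linarith), integral_Ioc_eq_integral_Ioo,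
      setIntegral_congr_fun measurableSet_Ioo (hEq k), setIntegral_const]
    simp
  simp only [h3, Complex.real_smul]
  push_cast
  rfl

/-- The sum is the integral of a step function, so dominated convergence applies. Limits are
required only in the open interval: near its ends one of the indices l, n - l need not tend to
infinity and the Wallis limit may fail. -/
lemma tendsto_riemann_sum [l.IsCountablyGenerated] {M : ι → ℕ} (hM : Tendsto M l atTop)
    {g : ι → ℕ → ℂ} {C : ℝ} (hC : ∀ᶠ i in l, ∀ k < M i, ‖g i k‖ ≤ C) {G : ℝ → ℂ}
    (hG : ∀ x ∈ Set.Ioo (0 : ℝ) 1, Tendsto (fun i => g i ⌊(M i : ℝ) * x⌋₊) l (𝓝 (G x))) :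
    Tendsto (fun i => (M i : ℂ)⁻¹ * ∑ k ∈ Finset.range (M i), g i k) l
      (𝓝 (∫ x in (0 : ℝ)..1, G x)) := by
  have h1 : ∀ᶠ i in l, ∫ x in (0 : ℝ)..1, g i ⌊(M i : ℝ) * x⌋₊ =
      (M i : ℂ)⁻¹ * ∑ k ∈ Finset.range (M i), g i k := by
    filter_upwards [hM.eventually_ge_atTop 1] with i hi
    exact integral_step (g i) hi
  refine Tendsto.congr' h1 ?_
  simp only [intervalIntegral.integral_of_le zero_le_one, integral_Ioc_eq_integral_Ioo]
  refine tendsto_integral_filter_of_dominated_convergence (fun _ => C) ?_ ?_ ?_ ?_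
  · refine Eventually.of_forall fun i => Measurable.aestronglyMeasurable ?_
    exact (measurable_from_nat (f := g i)).comp
      (Nat.measurable_floor.comp (measurable_const.mul measurable_id))
  · filter_upwards [hC, hM.eventually_ge_atTop 1] with i hi hMi
    rw [ae_restrict_iff' measurableSet_Ioo]
    refine ae_of_all _ fun x hx => hi _ ?_
    have hMpos : (0 : ℝ) < M i := by exact_mod_cast hMi
    have : (M i : ℝ) * x < M i := by nlinarith [hx.2]
    exact (Nat.floor_lt (by have := hx.1; positivity)).2 this
  · exact integrable_const _
  · rw [ae_restrict_iff' measurableSet_Ioo]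
    exact ae_of_all _ hG

lemma tendsto_floor_div {M : ι → ℕ} (hM : Tendsto M l atTop) {x : ℝ} (hx : 0 ≤ x) :
    Tendsto (fun i => (⌊(M i : ℝ) * x⌋₊ : ℝ) / M i) l (𝓝 x) := by
  have := (tendsto_nat_floor_mul_div_atTop (R := ℝ) hx).comp
    (tendsto_natCast_atTop_atTop.comp hM)
  refine this.congr fun i => ?_
  simp [mul_comm]

end

/-! ### Scaling limits of the unweighted kernels -/

section

variable {ι : Type*} {l : Filter ι} {N : ι → ℕ} {s : ι → ℝ≥0∞} {lam : ℝ}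

lemma tendsto_half (hN : Tendsto N l atTop) : Tendsto (fun i => N i / 2) l atTop :=
  (Nat.tendsto_div_const_atTop two_ne_zero).comp hN

lemma tendsto_half_div (hN : Tendsto N l atTop) :
    Tendsto (fun i => ((N i / 2 : ℕ) : ℝ) / N i) l (𝓝 (1 / 2)) := by
  refine (tendsto_floor_div hN (by norm_num : (0 : ℝ) ≤ 1 / 2)).congr fun i => ?_
  have : ⌊(N i : ℝ) * (1 / 2)⌋₊ = N i / 2 := by
    have := Nat.floor_div_eq_div (K := ℝ) (N i) 2
    rw [← this]
    congr 1
    push_cast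
    ring
  rw [this]

lemma tendsto_complexSum [l.IsCountablyGenerated] (hN : Tendsto N l atTop)
    (hs : ∀ᶠ i in l, (N i : ℝ≥0∞) < s i)
    (hlam : Tendsto (fun i => (N i : ℝ) * invParam (s i)) l (𝓝 lam))
    {u v t : ι → ℂ} {t₀ : ℂ} (ht : Tendsto t l (𝓝 t₀))
    (huv : ∀ᶠ i in l, u i * conj (v i) = 1 + t i / N i) :
    Tendsto (fun i => ((N i : ℂ) ^ 2)⁻¹ * complexSum (s i) (N i) (u i) (v i)) l
      (𝓝 (1 / (Real.pi : ℂ) * ∫ x in (0 : ℝ)..1, (x : ℂ) * (1 - (lam : ℂ) * x) *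
        Complex.exp (t₀ * x))) := by
  have hinv : Tendsto (fun i => 1 / (N i : ℝ)) l (𝓝 0) :=
    tendsto_one_div_atTop_nhds_zero_nat.comp hN
  have key := tendsto_riemann_sum hN
    (g := fun i k => ((((k : ℝ) + 1) / N i * (1 - (((k : ℝ) + 1) / N i) *
      (N i * invParam (s i))) : ℝ) : ℂ) * (1 + t i / N i) ^ k)
    (C := Real.exp (‖t₀‖ + 1))
    (G := fun x => (x : ℂ) * (1 - (lam : ℂ) * x) * Complex.exp (t₀ * x)) ?_ ?_
  · refine (key.const_mul (1 / (Real.pi : ℂ))).congr' ?_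
    filter_upwards [huv, hN.eventually_ge_atTop 1] with i hi hNi
    have hN0 : (N i : ℂ) ≠ 0 := by
      have : N i ≠ 0 := by omega
      exact_mod_cast this
    rw [complexSum, hi]
    simp only [Finset.mul_sum]
    refine Finset.sum_congr rfl fun k _ => ?_
    push_cast
    field_simp
  · filter_upwards [eventually_norm_pow_le hN ht, hs, hN.eventually_ge_atTop 1] with i hi hsi hNi k hk
    have hNpos : (0 : ℝ) < N i := by exact_mod_cast hNi
    rw [norm_mul, Complex.norm_real]
    have h1 := mul_invParam_lt_one hsi
    have h2 := invParam_nonneg (s i)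
    have h3 : ((k : ℝ) + 1) / N i ≤ 1 := by
      rw [div_le_one hNpos]; exact_mod_cast hk
    have h4 : 0 ≤ ((k : ℝ) + 1) / N i := by positivity
    have h5 : 0 ≤ (N i : ℝ) * invParam (s i) := by positivity
    have h6 : ‖((k : ℝ) + 1) / N i * (1 - (((k : ℝ) + 1) / N i) * (N i * invParam (s i)))‖ ≤ 1 := by
      have h7 : (((k : ℝ) + 1) / N i) * (N i * invParam (s i)) ≤ 1 := mul_le_one₀ h3 h5 h1.le
      rw [Real.norm_eq_abs, abs_of_nonneg (mul_nonneg h4 (by linarith))]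
      have h8 : 0 ≤ (((k : ℝ) + 1) / N i) * (N i * invParam (s i)) := by positivity
      exact mul_le_one₀ h3 (by linarith) (by linarith)
    calc _ ≤ 1 * Real.exp (‖t₀‖ + 1) :=
          mul_le_mul h6 (hi k hk.le) (norm_nonneg _) zero_le_one
      _ = _ := one_mul _
  · intro x hx
    have h1 := tendsto_floor_div hN hx.1.le
    have h2 : Tendsto (fun i => ((⌊(N i : ℝ) * x⌋₊ : ℝ) + 1) / N i) l (𝓝 x) := by
      simpa [add_div] using h1.add hinv
    have h3 := h2.mul ((h2.mul hlam).const_sub 1)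
    have h4 := ((Complex.continuous_ofReal.tendsto _).comp h3).mul
      (tendsto_one_add_div_pow hN ht h1)
    convert h4 using 2
    · simp [Function.comp]
    · push_cast
      ring

lemma diagSum_eq (s : ℝ≥0∞) (n : ℕ) (q : ℂ) : diagSum s n q =
    ∑ k ∈ Finset.range (n + 1), ((relFactor s (2 * k + 2) * (2 * k + 1) *
      (coeffA k * coeffB k) * (coeffA (n - k) * coeffB (n - k)) : ℝ) : ℂ) * q ^ (2 * k + 1) := by
  refine Finset.sum_congr rfl fun k _ => ?_
  rw [show relFactor s (2 * k + 2) * (coeffA k * coeffB (n - k)) * (coeffA k * coeffA (n - k)) =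
    relFactor s (2 * k + 2) * coeffA k * coeffA k * coeffA (n - k) * coeffB (n - k) by ring]
  nth_rewrite 2 [coeffA_eq k]
  congr 2
  ring

/-- With x = (2k+1)/N the factor of s tends to 1 - λx, and the two Wallis products give 4/π². The
sum has N/2 terms, whence the constant 2/π². -/
lemma tendsto_diagSum [l.IsCountablyGenerated] (hN : Tendsto N l atTop)
    (hs : ∀ᶠ i in l, (N i : ℝ≥0∞) < s i)
    (hlam : Tendsto (fun i => (N i : ℝ) * invParam (s i)) l (𝓝 lam))
    {q t : ι → ℂ} {t₀ : ℂ} (ht : Tendsto t l (𝓝 t₀))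
    (hq : ∀ᶠ i in l, q i = 1 + t i / N i) :
    Tendsto (fun i => ((N i : ℂ) ^ 2)⁻¹ * diagSum (s i) (N i / 2 - 1) (q i)) l
      (𝓝 (2 / (Real.pi : ℂ) ^ 2 * ∫ x in (0 : ℝ)..1, (x : ℂ) * (1 - (lam : ℂ) * x) *
        Complex.exp (t₀ * x))) := by
  have hinv : Tendsto (fun i => 1 / (N i : ℝ)) l (𝓝 0) :=
    tendsto_one_div_atTop_nhds_zero_nat.comp hN
  have hJ := tendsto_half hN
  have hJN := tendsto_half_div hN
  have key := tendsto_riemann_sum hJ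
    (g := fun i k => ((relFactor (s i) (2 * k + 2) * ((2 * k + 1) / N i) *
      (coeffA k * coeffB k) * (coeffA (N i / 2 - 1 - k) * coeffB (N i / 2 - 1 - k)) : ℝ) : ℂ) *
        (1 + t i / N i) ^ (2 * k + 1))
    (C := Real.exp (‖t₀‖ + 1))
    (G := fun x => (4 / (Real.pi : ℂ) ^ 2) *
      ((x : ℂ) * (1 - (lam : ℂ) * x) * Complex.exp (t₀ * x))) ?_ ?_
  · have hJN' : Tendsto (fun i => ((((N i / 2 : ℕ) : ℝ) / N i : ℝ) : ℂ)) l (𝓝 ((1 / 2 : ℝ) : ℂ)) :=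
      (Complex.continuous_ofReal.tendsto _).comp hJN
    have h := hJN'.mul key
    rw [intervalIntegral.integral_const_mul, ← mul_assoc] at h
    have e : ((1 / 2 : ℝ) : ℂ) * (4 / (Real.pi : ℂ) ^ 2) = 2 / (Real.pi : ℂ) ^ 2 := by
      push_cast; ring
    rw [e] at h
    refine h.congr' ?_
    filter_upwards [hq, hN.eventually_ge_atTop 2] with i hi hNi
    have hN0 : (N i : ℂ) ≠ 0 := by
      have : N i ≠ 0 := by omega
      exact_mod_cast this
    have hJ0 : ((N i / 2 : ℕ) : ℂ) ≠ 0 := by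
      have : N i / 2 ≠ 0 := by omega
      exact_mod_cast this
    rw [diagSum_eq, hi, show N i / 2 - 1 + 1 = N i / 2 by omega, Finset.mul_sum, Finset.mul_sum,
      Finset.mul_sum]
    refine Finset.sum_congr rfl fun k _ => ?_
    push_cast [-Nat.cast_div_charZero]
    field_simp
  · filter_upwards [eventually_norm_pow_le hN ht, hs, hN.eventually_ge_atTop 1] with i hi hsi hNi k hk
    have hNpos : (0 : ℝ) < N i := by exact_mod_cast hNi
    rw [norm_mul, Complex.norm_real]
    have h1 := relFactor_mem_Icc hsi (m := 2 * k + 2) (by omega)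
    have h3 : (2 * (k : ℝ) + 1) / N i ≤ 1 := by
      rw [div_le_one hNpos]
      have : 2 * k + 1 ≤ N i := by omega
      exact_mod_cast this
    have h4 : 0 ≤ (2 * (k : ℝ) + 1) / N i := by positivity
    have hw : ∀ m, coeffA m * coeffB m ∈ Set.Icc (0 : ℝ) 1 := fun m =>
      ⟨(mul_pos (coeffA_pos m) (coeffB_pos m)).le, coeffA_mul_coeffB_le_one m⟩
    have h5 := (unitInterval.mul_mem (unitInterval.mul_mem (unitInterval.mul_mem h1 ⟨h4, h3⟩)
      (hw k)) (hw (N i / 2 - 1 - k)))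
    calc _ ≤ 1 * Real.exp (‖t₀‖ + 1) := by
          refine mul_le_mul ?_ (hi _ (by omega)) (norm_nonneg _) zero_le_one
          rw [Real.norm_eq_abs, abs_of_nonneg h5.1]
          exact h5.2
      _ = _ := one_mul _
  · intro x hx
    have h1 := tendsto_floor_div hJ hx.1.le
    have h2 : Tendsto (fun i => ((2 * ⌊((N i / 2 : ℕ) : ℝ) * x⌋₊ + 1 : ℕ) : ℝ) / N i) l (𝓝 x) := by
      have h := ((h1.mul hJN).const_mul 2).add hinv
      rw [add_zero, show 2 * (x * (1 / 2)) = x by ring] at h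
      refine h.congr' ?_
      filter_upwards [hN.eventually_ge_atTop 2] with i hNi
      have hN0 : (N i : ℝ) ≠ 0 := by
        have : N i ≠ 0 := by omega
        exact_mod_cast this
      have hJ0 : ((N i / 2 : ℕ) : ℝ) ≠ 0 := by
        have : N i / 2 ≠ 0 := by omega
        exact_mod_cast this
      push_cast [-Nat.cast_div_charZero]
      field_simp
    have h3 : Tendsto (fun i => relFactor (s i) (2 * ⌊((N i / 2 : ℕ) : ℝ) * x⌋₊ + 2)) l
        (𝓝 (1 - x * lam)) := by
      have h := (((h2.add hinv).mul hlam).const_sub 1)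
      rw [add_zero] at h
      refine h.congr' ?_
      filter_upwards [hN.eventually_ge_atTop 1, hs] with i hNi hsi
      have hN0 : (N i : ℝ) ≠ 0 := by
        have : N i ≠ 0 := by omega
        exact_mod_cast this
      rw [relFactor_eq (pos_of_gt hsi).ne']
      push_cast [-Nat.cast_div_charZero]
      field_simp
      ring
    have hJr : Tendsto (fun i => ((N i / 2 : ℕ) : ℝ)) l atTop :=
      tendsto_natCast_atTop_atTop.comp hJ
    have h4 : Tendsto (fun i => ⌊((N i / 2 : ℕ) : ℝ) * x⌋₊) l atTop :=
      tendsto_nat_floor_atTop.comp (hJr.atTop_mul_const hx.1)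
    have h5 : Tendsto (fun i => N i / 2 - 1 - ⌊((N i / 2 : ℕ) : ℝ) * x⌋₊) l atTop := by
      rw [← tendsto_natCast_atTop_iff (R := ℝ)]
      have h : Tendsto (fun i => ((N i / 2 : ℕ) : ℝ) * (1 - x) - 1) l atTop :=
        tendsto_atTop_add_const_right _ _ (hJr.atTop_mul_const (by linarith [hx.2]))
      refine tendsto_atTop_mono (fun i => ?_) h
      have ha : (⌊((N i / 2 : ℕ) : ℝ) * x⌋₊ : ℝ) ≤ ((N i / 2 : ℕ) : ℝ) * x :=
        Nat.floor_le (by have := hx.1; positivity)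
      have hb : N i / 2 ≤ (N i / 2 - 1 - ⌊((N i / 2 : ℕ) : ℝ) * x⌋₊) + 1 +
        ⌊((N i / 2 : ℕ) : ℝ) * x⌋₊ := by omega
      have hc : ((N i / 2 : ℕ) : ℝ) ≤ ((N i / 2 - 1 - ⌊((N i / 2 : ℕ) : ℝ) * x⌋₊ : ℕ) : ℝ) + 1 +
        ⌊((N i / 2 : ℕ) : ℝ) * x⌋₊ := by exact_mod_cast hb
      linarith
    have h6 := (((h3.mul h2).mul (tendsto_coeffA_mul_coeffB.comp h4)).mul
      (tendsto_coeffA_mul_coeffB.comp h5))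
    have h7 := ((Complex.continuous_ofReal.tendsto _).comp h6).mul
      (tendsto_one_add_div_pow hN ht h2)
    convert h7 using 2
    · simp [Function.comp]
    · push_cast
      ring

end

/-- The scaled kernel without the weights. -/
noncomputable def bareLimit (ζ : ℂ) (lam : ℝ) (z w : ℂ) : ℂ :=
  1 / (Real.pi : ℂ) * ∫ x in (0 : ℝ)..1, (x : ℂ) * (1 - (lam : ℂ) * x) *
    Complex.exp ((z * conj ζ + conj w * ζ) * x)

lemma limitKernel_eq (ζ : ℂ) (lam : ℝ) (z w : ℂ) : limitKernel ζ lam z w =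
    (omega lam (z * conj ζ) : ℂ) * (omega lam (conj w * ζ) : ℂ) * bareLimit ζ lam z w := by
  rw [limitKernel, bareLimit]
  ring

section

variable {ι : Type*} {l : Filter ι} {N : ι → ℕ} {s : ι → ℝ≥0∞} {lam : ℝ}

/-- The kernel is twice the antisymmetrised sum, so both error bounds enter twice, and the odd
correction contributes 32. The two sums share the same diagonal part, because it depends only on uv,
and differ in the sign of Im u or Im v. -/
lemma norm_bareKernel_add_le {s : ℝ≥0∞} {N : ℕ} (hN : 2 ≤ N) (hs : (N : ℝ≥0∞) < s) {u v : ℂ}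
    {C : ℝ} (hu : Tame u (N / 2) C) (hv : Tame v (N / 2) C) :
    ‖bareKernel s N u v + 1 / 2 * (Complex.I * (Real.pi / 2) * (Real.sign u.im : ℂ) -
      Complex.I * (Real.pi / 2) * (Real.sign v.im : ℂ)) * diagSum s (N / 2 - 1) (u * v)‖ ≤
      36 * C ^ 4 * (coeffA (N / 2) ^ 3 * harmonicSum (N / 2 + 3)) := by
  obtain ⟨n, hn⟩ : ∃ n, N / 2 = n + 1 := ⟨N / 2 - 1, by omega⟩
  have hC := hu.one_le
  have hs' : ((2 * (n + 1) : ℕ) : ℝ≥0∞) < s :=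
    lt_of_le_of_lt (by exact_mod_cast (by omega : 2 * (n + 1) ≤ N)) hs
  have h1 := norm_sum_skewPoly_sub_le hs' (hu.mono (by omega)) (hv.mono (by omega))
  have h2 := norm_sum_skewPoly_sub_le hs' (hv.mono (by omega : n ≤ N / 2)) (hu.mono (by omega))
  rw [mul_comm v u] at h2
  have h3 : ‖if Even N then (0 : ℂ) else oddCorrection s (N / 2) u v‖ ≤
      32 * C ^ 3 * coeffA (N / 2) ^ 3 := by
    have := coeffA_pos (N / 2)
    split_ifs with hev
    · rw [norm_zero]; positivity
    · have hodd : 2 * (N / 2) + 1 = N := by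
        have := Nat.not_even_iff_odd.1 hev
        obtain ⟨k, hk⟩ := this
        omega
      exact norm_oddCorrection_le (by rwa [hodd]) hu hv
  have hA : coeffA n ≤ coeffA (N / 2) := coeffA_monotone (by omega)
  have hA0 := coeffA_pos n
  have hAJ := coeffA_pos (N / 2)
  have hH : harmonicSum (n + 3) ≤ harmonicSum (N / 2 + 3) := harmonicSum_mono (by omega)
  have hH0 := one_le_harmonicSum (n + 2)
  have hH1 := one_le_harmonicSum (N / 2 + 2)
  set E := coeffA n ^ 3 * harmonicSum (n + 3)
  set F := coeffA (N / 2) ^ 3 * harmonicSum (N / 2 + 3)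
  have hEF : E ≤ F := by
    have : 0 ≤ harmonicSum (n + 3) := by linarith
    exact mul_le_mul (pow_le_pow_left₀ hA0.le hA 3) hH this (by positivity)
  have hAF : coeffA (N / 2) ^ 3 ≤ F := le_mul_of_one_le_right (by positivity) hH1
  have hF0 : 0 ≤ F := le_trans (by positivity) hAF
  have hC34 : C ^ 3 ≤ C ^ 4 := pow_le_pow_right₀ hC (by norm_num)
  rw [bareKernel, skewKernel, hn, Nat.add_sub_cancel, ← hn]
  set S₁ := ∑ j ∈ Finset.range (N / 2), Polynomial.aeval u (skewPolyEven j) *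
    Polynomial.aeval v (skewPolyOdd s j) with hS₁
  set S₂ := ∑ j ∈ Finset.range (N / 2), Polynomial.aeval v (skewPolyEven j) *
    Polynomial.aeval u (skewPolyOdd s j) with hS₂
  rw [← hn, ← hS₁] at h1
  rw [← hn, ← hS₂] at h2
  set D := diagSum s n (u * v)
  set O := if Even N then (0 : ℂ) else oddCorrection s (N / 2) u v
  set α := Complex.I * (Real.pi / 2) * (Real.sign u.im : ℂ)
  set β := Complex.I * (Real.pi / 2) * (Real.sign v.im : ℂ)
  have e : 2 * (S₁ - S₂) + O + 1 / 2 * (α - β) * D =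
      2 * (S₁ - -(1 / 4) * α * D) - 2 * (S₂ - -(1 / 4) * β * D) + O := by ring
  rw [e]
  have h4 : C ^ 4 * E ≤ C ^ 4 * F := by gcongr
  have h5 : 32 * C ^ 3 * coeffA (N / 2) ^ 3 ≤ 32 * C ^ 4 * F := by
    gcongr
  calc _ ≤ ‖2 * (S₁ - -(1 / 4) * α * D)‖ + ‖2 * (S₂ - -(1 / 4) * β * D)‖ + ‖O‖ :=
        (norm_add_le _ _).trans (add_le_add_left (norm_sub_le _ _) _)
    _ ≤ 2 * (C ^ 4 * F) + 2 * (C ^ 4 * F) + 32 * C ^ 4 * F := by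
        rw [norm_mul, norm_mul, Complex.norm_ofNat]
        gcongr
        · exact h1.trans h4
        · exact h2.trans h4
        · exact h3.trans h5
    _ = _ := by ring

lemma tendsto_bareKernel_add (hN : Tendsto N l atTop) (hs : ∀ᶠ i in l, (N i : ℝ≥0∞) < s i)
    {ξ η : ℂ} (hξ : ‖ξ‖ = 1) (hξ' : ξ.im ≠ 0) (hη : ‖η‖ = 1) (hη' : η.im ≠ 0) {z w : ι → ℂ}
    {z₀ w₀ : ℂ} (hz : Tendsto z l (𝓝 z₀)) (hw : Tendsto w l (𝓝 w₀)) :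
    Tendsto (fun i => ((N i : ℂ) ^ 2)⁻¹ * bareKernel (s i) (N i) (ξ + z i / N i) (η + w i / N i) +
      1 / 2 * (Complex.I * (Real.pi / 2) * (Real.sign ξ.im : ℂ) -
        Complex.I * (Real.pi / 2) * (Real.sign η.im : ℂ)) * (((N i : ℂ) ^ 2)⁻¹ *
          diagSum (s i) (N i / 2 - 1) ((ξ + z i / N i) * (η + w i / N i)))) l (𝓝 0) := by
  obtain ⟨C₁, h1⟩ := exists_tame hN hξ hξ' hz
  obtain ⟨C₂, h2⟩ := exists_tame hN hη hη' hw
  set C := max C₁ C₂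
  have hg := ((tendsto_growth.comp (tendsto_half hN)).const_mul (36 * C ^ 4))
  rw [mul_zero] at hg
  refine squeeze_zero_norm' ?_ hg
  filter_upwards [h1, h2, hs, hN.eventually_ge_atTop 2] with i h1 h2 hsi hNi
  have hb := norm_bareKernel_add_le hNi hsi (h1.1.mono_const (le_max_left C₁ C₂))
    (h2.1.mono_const (le_max_right C₁ C₂))
  rw [h1.2, h2.2] at hb
  have e : ∀ a b d c : ℂ, c * a + b * (c * d) = c * (a + b * d) := fun a b d c => by ring
  rw [e, norm_mul, norm_inv, norm_pow, Complex.norm_natCast]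
  have hNpos : (0 : ℝ) < N i := by
    have : 0 < N i := by omega
    exact_mod_cast this
  have hJN : (((N i / 2 : ℕ) : ℝ) + 1) ≤ N i := by
    have : N i / 2 + 1 ≤ N i := by omega
    exact_mod_cast this
  have hA := coeffA_pos (N i / 2)
  have hH := one_le_harmonicSum (N i / 2 + 2)
  have hC0 : 0 ≤ C ^ 4 := by positivity
  simp only [Function.comp]
  calc _ ≤ ((N i : ℝ) ^ 2)⁻¹ * (36 * C ^ 4 *
        (coeffA (N i / 2) ^ 3 * harmonicSum (N i / 2 + 3))) :=
        mul_le_mul_of_nonneg_left hb (by positivity)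
    _ ≤ (((((N i / 2 : ℕ) : ℝ) + 1)) ^ 2)⁻¹ * (36 * C ^ 4 *
        (coeffA (N i / 2) ^ 3 * harmonicSum (N i / 2 + 3))) := by
        refine mul_le_mul_of_nonneg_right ?_ (by positivity)
        exact inv_anti₀ (by positivity) (pow_le_pow_left₀ (by positivity) hJN 2)
    _ = _ := by ring

lemma tendsto_bareKernel_self (hN : Tendsto N l atTop) (hs : ∀ᶠ i in l, (N i : ℝ≥0∞) < s i)
    {ξ : ℂ} (hξ : ‖ξ‖ = 1) (hξ' : ξ.im ≠ 0) {z w : ι → ℂ}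
    {z₀ w₀ : ℂ} (hz : Tendsto z l (𝓝 z₀)) (hw : Tendsto w l (𝓝 w₀)) :
    Tendsto (fun i => ((N i : ℂ) ^ 2)⁻¹ *
      bareKernel (s i) (N i) (ξ + z i / N i) (ξ + w i / N i)) l (𝓝 0) := by
  simpa using tendsto_bareKernel_add hN hs hξ hξ' hξ hξ' hz hw

lemma mul_conj_of_norm_eq_one {ξ : ℂ} (hξ : ‖ξ‖ = 1) : ξ * conj ξ = 1 := by
  rw [Complex.mul_conj, Complex.normSq_eq_norm_sq, hξ]; simp

/-- Here the two imaginary parts have opposite signs, so the diagonal part has the factor iπ sgn Im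
ξ instead of cancelling. Also uv is ξ conj ξ = 1 up to O(1/N), so its powers tend to exponentials.
-/
lemma tendsto_bareKernel_conj [l.IsCountablyGenerated] (hN : Tendsto N l atTop) (hs : ∀ᶠ i in l, (N i : ℝ≥0∞) < s i)
    (hlam : Tendsto (fun i => (N i : ℝ) * invParam (s i)) l (𝓝 lam))
    {ξ : ℂ} (hξ : ‖ξ‖ = 1) (hξ' : ξ.im ≠ 0) {z w : ι → ℂ}
    {z₀ w₀ : ℂ} (hz : Tendsto z l (𝓝 z₀)) (hw : Tendsto w l (𝓝 w₀)) :
    Tendsto (fun i => Complex.I * (Real.sign ξ.im : ℂ) * (((N i : ℂ) ^ 2)⁻¹ *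
      bareKernel (s i) (N i) (ξ + z i / N i) (conj (ξ + w i / N i)))) l
      (𝓝 (bareLimit ξ lam z₀ w₀)) := by
  have hwc : Tendsto (fun i => conj (w i)) l (𝓝 (conj w₀)) :=
    (Complex.continuous_conj.tendsto _).comp hw
  have hc : ‖conj ξ‖ = 1 := by rwa [RCLike.norm_conj]
  have hc' : (conj ξ).im ≠ 0 := by simpa using hξ'
  have h1 := tendsto_bareKernel_add hN hs hξ hξ' hc hc' hz hwc
  have ht : Tendsto (fun i => z i * conj ξ + conj (w i) * ξ + z i * (conj (w i) / N i)) l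
      (𝓝 (z₀ * conj ξ + conj w₀ * ξ)) := by
    simpa using ((hz.mul_const (conj ξ)).add (hwc.mul_const ξ)).add
      (hz.mul (tendsto_div_natCast hN hwc))
  have h2 := tendsto_diagSum hN hs hlam ht
    (q := fun i => (ξ + z i / N i) * (conj ξ + conj (w i) / N i)) (by
      filter_upwards [hN.eventually_ge_atTop 1] with i hNi
      have hN0 : (N i : ℂ) ≠ 0 := by
        have : N i ≠ 0 := by omega
        exact_mod_cast this
      rw [← mul_conj_of_norm_eq_one hξ]
      field_simp
      ring)
  have hsq : (Real.sign ξ.im : ℂ) * (Real.sign ξ.im : ℂ) = 1 := by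
    rcases lt_or_gt_of_ne hξ' with h | h
    · simp [Real.sign_of_neg h]
    · simp [Real.sign_of_pos h]
  have h3 := (h1.const_mul (Complex.I * (Real.sign ξ.im : ℂ))).add (h2.const_mul ((Real.pi : ℂ) / 2))
  convert h3 using 1
  · funext i
    have hsg : Real.sign (conj ξ).im = -Real.sign ξ.im := by
      rw [Complex.conj_im, Real.sign_neg]
    rw [hsg, map_add, map_div₀, Complex.conj_natCast]
    push_cast
    linear_combination (Real.pi / 2 * (((N i : ℂ) ^ 2)⁻¹ *
      diagSum (s i) (N i / 2 - 1) ((ξ + z i / N i) * (conj ξ + conj (w i) / N i)))) *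
        (-(Real.sign ξ.im : ℂ) * (Real.sign ξ.im : ℂ) * Complex.I_mul_I + hsq)
  · rw [bareLimit]
    congr 1
    have : (Real.pi : ℂ) ≠ 0 := by exact_mod_cast Real.pi_ne_zero
    generalize (∫ x in (0 : ℝ)..1, (x : ℂ) * (1 - (lam : ℂ) * x) *
      Complex.exp ((z₀ * conj ξ + conj w₀ * ξ) * x)) = I
    field_simp
    ring

lemma tendsto_bareMatrix [l.IsCountablyGenerated] (hN : Tendsto N l atTop) (hs : ∀ᶠ i in l, (N i : ℝ≥0∞) < s i)
    (hlam : Tendsto (fun i => (N i : ℝ) * invParam (s i)) l (𝓝 lam))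
    {ξ : ℂ} (hξ : ‖ξ‖ = 1) (hξ' : ξ.im ≠ 0) {z w : ι → ℂ}
    {z₀ w₀ : ℂ} (hz : Tendsto z l (𝓝 z₀)) (hw : Tendsto w l (𝓝 w₀)) :
    Tendsto (fun i => ((N i : ℂ) ^ 2)⁻¹ •
      bareMatrix (s i) (N i) (ξ + z i / N i) (ξ + w i / N i)) l
      (𝓝 !![0, bareLimit ξ lam z₀ w₀; -bareLimit ξ lam w₀ z₀, 0]) := by
  have hzc : Tendsto (fun i => conj (z i)) l (𝓝 (conj z₀)) :=
    (Complex.continuous_conj.tendsto _).comp hz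
  have hwc : Tendsto (fun i => conj (w i)) l (𝓝 (conj w₀)) :=
    (Complex.continuous_conj.tendsto _).comp hw
  have hc : ‖conj ξ‖ = 1 := by rwa [RCLike.norm_conj]
  have hc' : (conj ξ).im ≠ 0 := by simpa using hξ'
  obtain ⟨_, h1⟩ := exists_tame hN hξ hξ' hz
  obtain ⟨_, h2⟩ := exists_tame hN hξ hξ' hw
  refine tendsto_pi_nhds.2 fun a => tendsto_pi_nhds.2 fun b => ?_
  fin_cases a <;> fin_cases b
  · simpa [bareMatrix] using tendsto_bareKernel_self hN hs hξ hξ' hz hw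
  · refine (tendsto_bareKernel_conj hN hs hlam hξ hξ' hz hw).congr' ?_
    filter_upwards [h2] with i hi
    simp only [bareMatrix, hi.2, Matrix.smul_apply, smul_eq_mul]
    simp
    ring
  · refine (tendsto_bareKernel_conj hN hs hlam hξ hξ' hw hz).neg.congr' ?_
    filter_upwards [h1] with i hi
    simp only [bareMatrix, hi.2, Matrix.smul_apply, smul_eq_mul]
    rw [bareKernel_swap _ _ (conj (ξ + z i / N i))]
    simp
    ring
  · have h3 := (tendsto_bareKernel_self hN hs hc hc' hzc hwc).const_mul
      (Complex.I * (Real.sign ξ.im : ℂ) * (Complex.I * (Real.sign ξ.im : ℂ)))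
    rw [mul_zero] at h3
    refine h3.congr' ?_
    filter_upwards [h1, h2] with i hi hi'
    simp only [bareMatrix, hi.2, hi'.2, Matrix.smul_apply, smul_eq_mul]
    simp
    ring

lemma tendsto_complexSum_scaled [l.IsCountablyGenerated] (hN : Tendsto N l atTop)
    (hs : ∀ᶠ i in l, (N i : ℝ≥0∞) < s i)
    (hlam : Tendsto (fun i => (N i : ℝ) * invParam (s i)) l (𝓝 lam))
    {ξ : ℂ} (hξ : ‖ξ‖ = 1) {z w : ι → ℂ}
    {z₀ w₀ : ℂ} (hz : Tendsto z l (𝓝 z₀)) (hw : Tendsto w l (𝓝 w₀)) :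
    Tendsto (fun i => ((N i : ℂ) ^ 2)⁻¹ * complexSum (s i) (N i) (ξ + z i / N i) (ξ + w i / N i)) l
      (𝓝 (bareLimit ξ lam z₀ w₀)) := by
  have hwc : Tendsto (fun i => conj (w i)) l (𝓝 (conj w₀)) :=
    (Complex.continuous_conj.tendsto _).comp hw
  have ht : Tendsto (fun i => z i * conj ξ + conj (w i) * ξ + z i * (conj (w i) / N i)) l
      (𝓝 (z₀ * conj ξ + conj w₀ * ξ)) := by
    simpa using ((hz.mul_const (conj ξ)).add (hwc.mul_const ξ)).add
      (hz.mul (tendsto_div_natCast hN hwc))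
  refine tendsto_complexSum hN hs hlam ht ?_
  filter_upwards [hN.eventually_ge_atTop 1] with i hNi
  have hN0 : (N i : ℂ) ≠ 0 := by
    have : N i ≠ 0 := by omega
    exact_mod_cast this
  rw [← mul_conj_of_norm_eq_one hξ, map_add, map_div₀, Complex.conj_natCast]
  field_simp
  ring

end

/-! ### Scaling limits of the weights -/

section

variable {ι : Type*} {l : Filter ι} {N : ι → ℕ} {s : ι → ℝ≥0∞} {lam : ℝ}

lemma weight_eq_exp {s : ℝ≥0∞} (hs : s ≠ ∞) (v : ℂ) :
    weight s v = Real.exp (-(s.toReal * max 0 (Real.log ‖v‖))) := by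
  rw [weight, if_neg hs, Real.rpow_def_of_pos (by positivity)]
  congr 1
  have : Real.log (max 1 ‖v‖) = max 0 (Real.log ‖v‖) := by
    rcases le_total ‖v‖ 1 with h | h
    · rw [max_eq_left h, Real.log_one, max_eq_left (Real.log_nonpos (norm_nonneg _) h)]
    · rw [max_eq_right h, max_eq_right (Real.log_nonneg h)]
  rw [this]
  ring

/-- From exp(x) ≥ x for x = s log|v|. In this form s = ∞ needs no separate limit, and after
multiplying numerator and denominator by N the bound tends to 0 when λ = 0 and Re(z conj ξ) > 0. -/
lemma weight_le_div {s : ℝ≥0∞} (h0 : s ≠ 0) {v : ℂ} (hv : 1 < ‖v‖) :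
    weight s v ≤ invParam s / Real.log ‖v‖ := by
  have hlog : 0 < Real.log ‖v‖ := Real.log_pos hv
  by_cases hs : s = ∞
  · subst hs
    rw [weight, if_pos rfl, if_neg (by linarith)]
    exact div_nonneg (invParam_nonneg _) hlog.le
  · have hpos : 0 < s.toReal := ENNReal.toReal_pos h0 hs
    rw [weight_eq_exp hs, max_eq_right hlog.le, invParam, ENNReal.toReal_inv, Real.exp_neg,
      div_eq_mul_inv, ← mul_inv]
    refine inv_anti₀ (by positivity) ?_
    linarith [Real.add_one_le_exp (s.toReal * Real.log ‖v‖)]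

lemma tendsto_natCast_mul_log_norm (hN : Tendsto N l atTop) {ξ : ℂ} (hξ : ‖ξ‖ = 1) {z : ι → ℂ}
    {z₀ : ℂ} (hz : Tendsto z l (𝓝 z₀)) :
    Tendsto (fun i => (N i : ℝ) * Real.log ‖ξ + z i / N i‖) l (𝓝 (z₀ * conj ξ).re) := by
  have h := (Complex.continuous_re.tendsto _).comp
    (tendsto_natCast_mul_log hN (hz.mul_const (conj ξ)))
  refine h.congr fun i => ?_
  have e : ‖1 + z i * conj ξ / N i‖ = ‖ξ + z i / N i‖ := by
    have : 1 + z i * conj ξ / N i = (ξ + z i / N i) * conj ξ := by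
      rw [add_mul, mul_conj_of_norm_eq_one hξ]
      ring
    rw [this, norm_mul, RCLike.norm_conj, hξ, mul_one]
  simp only [Function.comp]
  rw [← Complex.ofReal_natCast, Complex.re_ofReal_mul, Complex.log_re, Complex.ofReal_natCast, e]

lemma tendsto_weight_of_pos (hN : Tendsto N l atTop)
    (hlam : Tendsto (fun i => (N i : ℝ) * invParam (s i)) l (𝓝 lam)) (h0 : 0 < lam)
    {ξ : ℂ} (hξ : ‖ξ‖ = 1) {z : ι → ℂ} {z₀ : ℂ} (hz : Tendsto z l (𝓝 z₀)) :
    Tendsto (fun i => weight (s i) (ξ + z i / N i)) l (𝓝 (omega lam (z₀ * conj ξ))) := by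
  have h1 := tendsto_natCast_mul_log_norm hN hξ hz
  have h2 : Tendsto (fun i => Real.exp (-(max 0 ((N i : ℝ) * Real.log ‖ξ + z i / N i‖) /
      (N i * invParam (s i))))) l (𝓝 (Real.exp (-(max 0 (z₀ * conj ξ).re / lam)))) :=
    (Real.continuous_exp.tendsto _).comp (((tendsto_const_nhds.max h1).div hlam h0.ne').neg)
  have e : omega lam (z₀ * conj ξ) = Real.exp (-(max 0 (z₀ * conj ξ).re / lam)) := by
    rw [omega, if_neg h0.ne']
    rcases le_total (z₀ * conj ξ).re 0 with h | h
    · rw [max_eq_left h, zero_div, neg_zero, Real.exp_zero, min_eq_left]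
      exact Real.one_le_exp (div_nonneg (by linarith) h0.le)
    · rw [max_eq_right h, neg_div, min_eq_right]
      exact Real.exp_le_one_iff.2 (neg_nonpos.2 (div_nonneg h h0.le))
  rw [e]
  refine h2.congr' ?_
  filter_upwards [hlam.eventually (lt_mem_nhds h0)] with i hi
  have hN0 : 0 < (N i : ℝ) := by
    by_contra h
    have : (N i : ℝ) = 0 := le_antisymm (not_lt.1 h) (Nat.cast_nonneg _)
    rw [this, zero_mul] at hi
    exact lt_irrefl _ hi
  have hinv : 0 < invParam (s i) := pos_of_mul_pos_right hi hN0.le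
  have htop : s i ≠ ∞ := by
    intro h
    rw [h, invParam_top] at hinv
    exact lt_irrefl _ hinv
  have hmax : max 0 ((N i : ℝ) * Real.log ‖ξ + z i / N i‖) =
      N i * max 0 (Real.log ‖ξ + z i / N i‖) := by
    rw [mul_max_of_nonneg _ _ hN0.le, mul_zero]
  rw [weight_eq_exp htop, hmax, mul_div_mul_left _ _ hN0.ne', invParam, ENNReal.toReal_inv,
    div_inv_eq_mul, mul_comm]

lemma tendsto_weight_of_re_pos (hN : Tendsto N l atTop) (hs : ∀ᶠ i in l, (N i : ℝ≥0∞) < s i)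
    (hlam : Tendsto (fun i => (N i : ℝ) * invParam (s i)) l (𝓝 0))
    {ξ : ℂ} (hξ : ‖ξ‖ = 1) {z : ι → ℂ} {z₀ : ℂ} (hz : Tendsto z l (𝓝 z₀))
    (hre : 0 < (z₀ * conj ξ).re) :
    Tendsto (fun i => weight (s i) (ξ + z i / N i)) l (𝓝 0) := by
  have h1 := tendsto_natCast_mul_log_norm hN hξ hz
  have h2 := hlam.div h1 hre.ne'
  rw [zero_div] at h2
  refine squeeze_zero' (Eventually.of_forall fun i => weight_nonneg _ _) ?_ h2
  filter_upwards [h1.eventually (lt_mem_nhds hre), hs, hN.eventually_ge_atTop 1] with i hi hsi hNi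
  have hN0 : 0 < (N i : ℝ) := by exact_mod_cast hNi
  have hlog : 0 < Real.log ‖ξ + z i / N i‖ := pos_of_mul_pos_right hi hN0.le
  have hv : 1 < ‖ξ + z i / N i‖ := (Real.log_pos_iff (norm_nonneg _)).1 hlog
  simp only [Pi.div_apply]
  rw [mul_div_mul_left _ _ hN0.ne']
  exact weight_le_div (pos_of_gt hsi).ne' hv

lemma tendsto_weight_of_re_neg (hN : Tendsto N l atTop)
    {ξ : ℂ} (hξ : ‖ξ‖ = 1) {z : ι → ℂ} {z₀ : ℂ} (hz : Tendsto z l (𝓝 z₀))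
    (hre : (z₀ * conj ξ).re < 0) :
    Tendsto (fun i => weight (s i) (ξ + z i / N i)) l (𝓝 1) := by
  have h1 := tendsto_natCast_mul_log_norm hN hξ hz
  refine tendsto_const_nhds.congr' ?_
  filter_upwards [h1.eventually (gt_mem_nhds hre)] with i hi
  refine (weight_eq_one _ ?_).symm
  by_contra h
  have : 0 ≤ Real.log ‖ξ + z i / N i‖ := Real.log_nonneg (not_le.1 h).le
  have := mul_nonneg (Nat.cast_nonneg (N i) : (0 : ℝ) ≤ N i) this
  linarith

/-- For λ = 0 a single weight may have no limit when Re(z_j conj ξ) = 0. This is harmless if another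
factor tends to 0, because all weights lie in [0, 1]; otherwise every real part must be negative. -/
lemma tendsto_prod_weight (hN : Tendsto N l atTop) (hs : ∀ᶠ i in l, (N i : ℝ≥0∞) < s i)
    (hlam : Tendsto (fun i => (N i : ℝ) * invParam (s i)) l (𝓝 lam)) (h0 : 0 ≤ lam)
    {ξ : ℂ} (hξ : ‖ξ‖ = 1) {n : ℕ} {z : ι → Fin n → ℂ} {z₀ : Fin n → ℂ}
    (hz : Tendsto z l (𝓝 z₀)) (hmem : z₀ ∈ regularSet ξ lam n) :
    Tendsto (fun i => ∏ j, weight (s i) (ξ + z i j / N i)) l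
      (𝓝 (∏ j, omega lam (z₀ j * conj ξ))) := by
  have hzj := tendsto_pi_nhds.1 hz
  rcases h0.eq_or_lt with h | h
  · subst h
    rcases hmem with h | ⟨j, hj⟩ | h
    · exact absurd h (lt_irrefl _)
    · rw [Finset.prod_eq_zero (Finset.mem_univ j) (by rw [omega, if_pos rfl, if_neg (by linarith)])]
      refine squeeze_zero (fun i => Finset.prod_nonneg fun _ _ => weight_nonneg _ _) (fun i => ?_)
        (tendsto_weight_of_re_pos hN hs hlam hξ (hzj j) hj)
      rw [← Finset.mul_prod_erase _ _ (Finset.mem_univ j)]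
      exact mul_le_of_le_one_right (weight_nonneg _ _)
        (Finset.prod_le_one (fun _ _ => weight_nonneg _ _) fun _ _ => weight_le_one _ _)
    · refine tendsto_finsetProd _ fun j _ => ?_
      rw [omega, if_pos rfl, if_pos (h j).le]
      exact tendsto_weight_of_re_neg hN hξ (hzj j) (h j)
  · exact tendsto_finsetProd _ fun j _ => tendsto_weight_of_pos hN hlam h hξ (hzj j)

end

/-! ### Pfaffians of block matrices -/

lemma blockPfaffian_smul {n : ℕ} (c : ℂ) (K : Fin n → Fin n → Matrix (Fin 2) (Fin 2) ℂ) :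
    blockPfaffian (fun j k => c • K j k) = c ^ n * blockPfaffian K := by
  simp only [blockPfaffian, Matrix.smul_apply, smul_eq_mul, Finset.prod_mul_distrib,
    Finset.prod_const, Finset.card_univ, Fintype.card_fin, Finset.mul_sum]
  exact Finset.sum_congr rfl fun σ _ => by ring

/-- Each permutation of the 2n indices uses every block exactly twice. -/
lemma blockPfaffian_mul_smul {n : ℕ} (φ : Fin n → ℂ)
    (K : Fin n → Fin n → Matrix (Fin 2) (Fin 2) ℂ) :
    blockPfaffian (fun j k => (φ j * φ k) • K j k) = (∏ j, φ j) ^ 2 * blockPfaffian K := by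
  have h : ∀ σ : Equiv.Perm (Fin n × Fin 2),
      ∏ i, φ (σ (i, 0)).1 * φ (σ (i, 1)).1 = (∏ j, φ j) ^ 2 := by
    intro σ
    have h1 := Equiv.prod_comp σ fun x => φ x.1
    rw [Fintype.prod_prod_type, Fintype.prod_prod_type] at h1
    simp only [Fin.prod_univ_two] at h1
    rw [h1, Finset.prod_mul_distrib, sq]
  simp only [blockPfaffian, Matrix.smul_apply, smul_eq_mul, Finset.prod_mul_distrib (f := fun i =>
    φ _ * φ _), h, Finset.mul_sum]
  exact Finset.sum_congr rfl fun σ _ => by ring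

lemma tendsto_blockPfaffian {ι : Type*} {l : Filter ι} {n : ℕ}
    {K : ι → Fin n → Fin n → Matrix (Fin 2) (Fin 2) ℂ}
    {L : Fin n → Fin n → Matrix (Fin 2) (Fin 2) ℂ}
    (h : ∀ j k, Tendsto (fun i => K i j k) l (𝓝 (L j k))) :
    Tendsto (fun i => blockPfaffian (K i)) l (𝓝 (blockPfaffian L)) := by
  refine Tendsto.const_mul _ (tendsto_finsetSum _ fun σ _ => Tendsto.const_mul _
    (tendsto_finsetProd _ fun i _ => ?_))
  exact tendsto_pi_nhds.1 (tendsto_pi_nhds.1 (h _ _) _) _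

/-- Each antisymmetrised factor is a signed sum over the permutations of its pair. Each of the 2^n
choices of swaps is absorbed by reindexing σ, and the signs match. -/
lemma sum_sign_mul_prod_sub {n : ℕ} (B : Fin n × Fin 2 → Fin n × Fin 2 → ℂ) :
    ∑ σ : Equiv.Perm (Fin n × Fin 2), ((Equiv.Perm.sign σ : ℤ) : ℂ) *
      ∏ i, (B (σ (i, 0)) (σ (i, 1)) - B (σ (i, 1)) (σ (i, 0))) =
    2 ^ n * ∑ σ : Equiv.Perm (Fin n × Fin 2), ((Equiv.Perm.sign σ : ℤ) : ℂ) *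
      ∏ i, B (σ (i, 0)) (σ (i, 1)) := by
  have hperm : (Finset.univ : Finset (Equiv.Perm (Fin 2))) = {1, Equiv.swap 0 1} := by decide
  have h1 : ∀ (σ : Equiv.Perm (Fin n × Fin 2)) (i : Fin n),
      B (σ (i, 0)) (σ (i, 1)) - B (σ (i, 1)) (σ (i, 0)) =
      ∑ e : Equiv.Perm (Fin 2), ((Equiv.Perm.sign e : ℤ) : ℂ) *
        B (σ (i, e 0)) (σ (i, e 1)) := by
    intro σ i
    rw [hperm, Finset.sum_pair (by decide)]
    simp [sub_eq_add_neg]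
  simp only [h1, Finset.prod_univ_sum, Fintype.piFinset_univ, Finset.mul_sum]
  rw [Finset.sum_comm]
  have h2 : ∀ e : Fin n → Equiv.Perm (Fin 2),
      ∑ σ : Equiv.Perm (Fin n × Fin 2), ((Equiv.Perm.sign σ : ℤ) : ℂ) *
        ∏ i, ((Equiv.Perm.sign (e i) : ℤ) : ℂ) * B (σ (i, e i 0)) (σ (i, e i 1)) =
      ∑ σ : Equiv.Perm (Fin n × Fin 2), ((Equiv.Perm.sign σ : ℤ) : ℂ) *
        ∏ i, B (σ (i, 0)) (σ (i, 1)) := by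
    intro e
    rw [← Equiv.sum_comp (Equiv.mulRight (Equiv.prodCongrRight e))
      (fun σ : Equiv.Perm (Fin n × Fin 2) => ((Equiv.Perm.sign σ : ℤ) : ℂ) *
        ∏ i, B (σ (i, 0)) (σ (i, 1)))]
    refine Finset.sum_congr rfl fun σ _ => ?_
    rw [Finset.prod_mul_distrib, Equiv.coe_mulRight, Equiv.Perm.sign_mul,
      Equiv.Perm.sign_prodCongrRight]
    simp only [Equiv.Perm.coe_mul, Function.comp, Equiv.prodCongrRight_apply]
    push_cast
    ring
  rw [Finset.sum_congr rfl fun e _ => h2 e, Finset.sum_const, Finset.card_univ, Fintype.card_fun,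
    Fintype.card_perm]
  simp [Finset.mul_sum]

/-- A term is nonzero only if σ preserves the second coordinate, so σ is a pair of permutations of
the n indices. For each choice of the first one, the sum over the second one is the determinant. -/
lemma sum_sign_mul_prod_eq {n : ℕ} (A : Matrix (Fin n) (Fin n) ℂ) :
    ∑ σ : Equiv.Perm (Fin n × Fin 2), ((Equiv.Perm.sign σ : ℤ) : ℂ) *
      ∏ i, (if (σ (i, 0)).2 = 0 ∧ (σ (i, 1)).2 = 1 then A (σ (i, 0)).1 (σ (i, 1)).1 else 0) =
    n.factorial * A.det := by
  have h1 : ∑ ρ : Fin 2 → Equiv.Perm (Fin n), ((∏ a, (Equiv.Perm.sign (ρ a) : ℤ) : ℤ) : ℂ) *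
      ∏ i, A (ρ 0 i) (ρ 1 i) = n.factorial * A.det := by
    rw [← Equiv.sum_comp (piFinTwoEquiv fun _ => Equiv.Perm (Fin n)).symm, Fintype.sum_prod_type]
    have h2 : ∀ ρ : Equiv.Perm (Fin n), ∑ τ : Equiv.Perm (Fin n),
        ((Equiv.Perm.sign ρ * Equiv.Perm.sign τ : ℤ) : ℂ) * ∏ i, A (ρ i) (τ i) = A.det := by
      intro ρ
      have h3 := Matrix.det_permute ρ A
      rw [← Matrix.det_transpose, Matrix.det_apply'] at h3
      simp only [Matrix.transpose_apply, Matrix.submatrix_apply, id] at h3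
      have h4 : ((Equiv.Perm.sign ρ : ℤ) : ℂ) * ((Equiv.Perm.sign ρ : ℤ) : ℂ) = 1 := by
        rw [← Int.cast_mul, ← Units.val_mul, Int.units_mul_self]; simp
      calc _ = ((Equiv.Perm.sign ρ : ℤ) : ℂ) * ∑ τ : Equiv.Perm (Fin n),
            ((Equiv.Perm.sign τ : ℤ) : ℂ) * ∏ i, A (ρ i) (τ i) := by
            rw [Finset.mul_sum]
            refine Finset.sum_congr rfl fun τ _ => ?_
            push_cast
            ring
        _ = _ := by rw [h3, ← mul_assoc, h4, one_mul]
    simp only [piFinTwoEquiv_symm_apply, Fin.prod_univ_two, Fin.cons_zero, Fin.cons_one]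
    rw [Finset.sum_congr rfl fun ρ _ => h2 ρ, Finset.sum_const, Finset.card_univ,
      Fintype.card_perm, Fintype.card_fin, nsmul_eq_mul]
  rw [← h1]
  symm
  refine Finset.sum_of_injOn Equiv.prodCongrLeft ?_ (fun _ _ => Finset.mem_univ _) ?_ ?_
  · intro ρ _ ρ' _ h
    funext a
    ext1 i
    have := congrArg (fun σ : Equiv.Perm (Fin n × Fin 2) => (σ (i, a)).1) h
    simpa [Equiv.prodCongrLeft_apply] using this
  · intro σ _ hσ
    by_contra hne
    apply hσ
    have hprod := right_ne_zero_of_mul hne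
    have hsnd : ∀ x, (σ x).2 = x.2 := by
      rintro ⟨i, a⟩
      have := Finset.prod_ne_zero_iff.1 hprod i (Finset.mem_univ i)
      have h := (ite_ne_right_iff.1 this).1
      fin_cases a
      · exact h.1
      · exact h.2
    have hsnd' : ∀ x, (σ.symm x).2 = x.2 := fun x => by
      have := hsnd (σ.symm x)
      rw [Equiv.apply_symm_apply] at this
      exact this.symm
    refine ⟨fun a => ⟨fun i => (σ (i, a)).1, fun i => (σ.symm (i, a)).1, fun i => ?_, fun i => ?_⟩,
      by simp, ?_⟩
    · have : ((σ (i, a)).1, a) = σ (i, a) := Prod.ext rfl (hsnd (i, a)).symm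
      dsimp only
      rw [this, Equiv.symm_apply_apply]
    · have : ((σ.symm (i, a)).1, a) = σ.symm (i, a) := Prod.ext rfl (hsnd' (i, a)).symm
      dsimp only
      rw [this, Equiv.apply_symm_apply]
    · ext1 ⟨i, a⟩
      exact Prod.ext rfl (hsnd (i, a)).symm
  · intro ρ _
    rw [Equiv.Perm.sign_prodCongrLeft]
    simp [Equiv.prodCongrLeft_apply]

theorem blockPfaffian_antidiagonal {n : ℕ} (A : Matrix (Fin n) (Fin n) ℂ) :
    blockPfaffian (fun j k => !![0, A j k; -A k j, 0]) = A.det := by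
  have h1 : ∀ p q : Fin n × Fin 2, (!![0, A p.1 q.1; -A q.1 p.1, 0] : Matrix (Fin 2) (Fin 2) ℂ)
      p.2 q.2 = (if p.2 = 0 ∧ q.2 = 1 then A p.1 q.1 else 0) -
        (if q.2 = 0 ∧ p.2 = 1 then A q.1 p.1 else 0) := by
    rintro ⟨i, a⟩ ⟨j, b⟩
    fin_cases a <;> fin_cases b <;> simp
  simp only [blockPfaffian, h1]
  rw [sum_sign_mul_prod_sub fun p q => if p.2 = 0 ∧ q.2 = 1 then A p.1 q.1 else 0,
    sum_sign_mul_prod_eq]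
  have : (n.factorial : ℂ) ≠ 0 := by exact_mod_cast n.factorial_ne_zero
  field_simp

/-! ### Scaling limits of the kernels -/

/-- Joint convergence in index and point forces the limit to be continuous on S: near x the values F
i y eventually lie in a closed neighbourhood of f x, hence so does f y. Both F i y and f y are then
close to f x. -/
lemma tendstoLocallyUniformlyOn_of_forall_tendsto {ι α β : Type*} [TopologicalSpace α]
    [UniformSpace β] {p : Filter ι} [p.NeBot] {F : ι → α → β} {f : α → β} {S : Set α}
    (h : ∀ x ∈ S, Tendsto (fun y : ι × α => F y.1 y.2) (p ×ˢ 𝓝[S] x) (𝓝 (f x))) :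
    TendstoLocallyUniformlyOn F f p S := by
  have hpt : ∀ x ∈ S, Tendsto (fun i => F i x) p (𝓝 (f x)) := fun x hx =>
    (h x hx).comp (tendsto_id.prodMk
      ((tendsto_const_pure (b := x)).mono_right (pure_le_nhdsWithin hx)))
  have hcont : ∀ x ∈ S, Tendsto f (𝓝[S] x) (𝓝 (f x)) := by
    intro x hx
    refine (closed_nhds_basis (f x)).tendsto_right_iff.2 fun V hV => ?_
    have h1 : ∀ᶠ y in 𝓝[S] x, ∀ᶠ i in p, F i y ∈ V :=
      ((h x hx).comp tendsto_prod_swap).eventually hV.1 |>.curry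
    filter_upwards [h1, self_mem_nhdsWithin] with y hy hyS
    exact hV.2.mem_of_tendsto (hpt y hyS) hy
  refine tendstoLocallyUniformlyOn_iff_forall_tendsto.2 fun x hx => ?_
  exact (((hcont x hx).comp tendsto_snd).prodMk_nhds (h x hx)).mono_right (nhds_le_uniformity _)

lemma omega_conj_mul (lam : ℝ) (w ζ : ℂ) : omega lam (conj w * ζ) = omega lam (w * conj ζ) := by
  have : (conj w * ζ).re = (w * conj ζ).re := by
    simp [Complex.mul_re]
  rw [omega, omega, this]

lemma limitMatrix_eq (ζ : ℂ) (lam : ℝ) (z w : ℂ) : limitMatrix ζ lam z w =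
    ((omega lam (z * conj ζ) : ℂ) * (omega lam (w * conj ζ) : ℂ)) •
      !![0, bareLimit ζ lam z w; -bareLimit ζ lam w z, 0] := by
  rw [limitMatrix, limitKernel_eq, limitKernel_eq, omega_conj_mul, omega_conj_mul]
  simp [mul_comm]

lemma blockPfaffian_limitMatrix (ζ : ℂ) (lam : ℝ) {n : ℕ} (z : Fin n → ℂ) :
    blockPfaffian (fun j k => limitMatrix ζ lam (z j) (z k)) =
      (Matrix.of fun j k => limitKernel ζ lam (z j) (z k)).det :=
  blockPfaffian_antidiagonal (Matrix.of fun j k => limitKernel ζ lam (z j) (z k))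

section

variable {ι : Type*} {l : Filter ι} [l.IsCountablyGenerated] {N : ι → ℕ} {s : ι → ℝ≥0∞} {lam : ℝ}
  {ζ : ℂ}

lemma tendsto_matrixKernel (hN : Tendsto N l atTop) (hs : ∀ᶠ i in l, (N i : ℝ≥0∞) < s i)
    (hlam : Tendsto (fun i => (N i : ℝ) * invParam (s i)) l (𝓝 lam)) (h0 : 0 ≤ lam)
    (hζ : ‖ζ‖ = 1) (hζ' : ζ.im ≠ 0) {p : ι → ℕ → Polynomial ℝ}
    (hp : ∀ i, ∀ n < N i, (p i n).Monic ∧ (p i n).natDegree = n)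
    {z w : ι → ℂ} {z₀ w₀ : ℂ} (hz : Tendsto z l (𝓝 z₀)) (hw : Tendsto w l (𝓝 w₀))
    (hmem : (z₀, w₀) ∈ regularPairs ζ lam) :
    Tendsto (fun i => ((N i : ℂ) ^ 2)⁻¹ •
      matrixKernel (s i) (N i) (p i) (ζ + z i / N i) (ζ + w i / N i)) l
      (𝓝 (limitMatrix ζ lam z₀ w₀)) := by
  have hzw : Tendsto (fun i => ![z i, w i]) l (𝓝 ![z₀, w₀]) := by
    refine tendsto_pi_nhds.2 fun j => ?_
    fin_cases j
    · exact hz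
    · exact hw
  have h1 := (Complex.continuous_ofReal.tendsto _).comp
    (tendsto_prod_weight hN hs hlam h0 hζ hzw hmem)
  simp only [Function.comp_def, Fin.prod_univ_two, Matrix.cons_val_zero, Matrix.cons_val_one,
    Complex.ofReal_mul] at h1
  rw [limitMatrix_eq]
  refine (h1.smul (tendsto_bareMatrix hN hs hlam hζ hζ' hz hw)).congr' ?_
  obtain ⟨_, h2⟩ := exists_tame hN hζ hζ' hz
  obtain ⟨_, h3⟩ := exists_tame hN hζ hζ' hw
  filter_upwards [h2, h3, hs] with i h2 h3 hsi
  rw [matrixKernel_eq hsi (p i) (hp i) h2.1.im_ne_zero h3.1.im_ne_zero, smul_comm]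

lemma tendsto_complexKernel (hN : Tendsto N l atTop) (hs : ∀ᶠ i in l, (N i : ℝ≥0∞) < s i)
    (hlam : Tendsto (fun i => (N i : ℝ) * invParam (s i)) l (𝓝 lam)) (h0 : 0 ≤ lam)
    (hζ : ‖ζ‖ = 1) {z w : ι → ℂ} {z₀ w₀ : ℂ} (hz : Tendsto z l (𝓝 z₀)) (hw : Tendsto w l (𝓝 w₀))
    (hmem : (z₀, w₀) ∈ regularPairs ζ lam) :
    Tendsto (fun i => ((N i : ℂ) ^ 2)⁻¹ *
      complexKernel (s i) (N i) (ζ + z i / N i) (ζ + w i / N i)) l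
      (𝓝 (limitKernel ζ lam z₀ w₀)) := by
  have hzw : Tendsto (fun i => ![z i, w i]) l (𝓝 ![z₀, w₀]) := by
    refine tendsto_pi_nhds.2 fun j => ?_
    fin_cases j
    · exact hz
    · exact hw
  have h1 := (Complex.continuous_ofReal.tendsto _).comp
    (tendsto_prod_weight hN hs hlam h0 hζ hzw hmem)
  simp only [Function.comp_def, Fin.prod_univ_two, Matrix.cons_val_zero, Matrix.cons_val_one,
    Complex.ofReal_mul] at h1
  rw [limitKernel_eq, omega_conj_mul]
  refine (h1.mul (tendsto_complexSum_scaled hN hs hlam hζ hz hw)).congr' ?_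
  filter_upwards [hs] with i hsi
  rw [complexKernel_eq hsi]
  ring

/-- The limit cannot be taken entrywise: for λ = 0 a tuple in `regularSet` may contain pairs outside
`regularPairs`, for which the weighted entries need not converge. Therefore the weights are pulled
out of the Pfaffian, and only their product passes to the limit. -/
lemma tendsto_blockPfaffian_matrixKernel (hN : Tendsto N l atTop)
    (hs : ∀ᶠ i in l, (N i : ℝ≥0∞) < s i)
    (hlam : Tendsto (fun i => (N i : ℝ) * invParam (s i)) l (𝓝 lam)) (h0 : 0 ≤ lam)
    (hζ : ‖ζ‖ = 1) (hζ' : ζ.im ≠ 0) {p : ι → ℕ → Polynomial ℝ}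
    (hp : ∀ i, ∀ n < N i, (p i n).Monic ∧ (p i n).natDegree = n)
    {n : ℕ} {z : ι → Fin n → ℂ} {z₀ : Fin n → ℂ} (hz : Tendsto z l (𝓝 z₀))
    (hmem : z₀ ∈ regularSet ζ lam n) :
    Tendsto (fun i => (((N i : ℂ) ^ 2)⁻¹) ^ n * blockPfaffian (fun j k =>
      matrixKernel (s i) (N i) (p i) (ζ + z i j / N i) (ζ + z i k / N i))) l
      (𝓝 (Matrix.of fun j k => limitKernel ζ lam (z₀ j) (z₀ k)).det) := by
  have hzj := tendsto_pi_nhds.1 hz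
  have h1 := (Complex.continuous_ofReal.tendsto _).comp (tendsto_prod_weight hN hs hlam h0 hζ hz hmem)
  have h2 := (h1.pow 2).mul (tendsto_blockPfaffian fun j k =>
    tendsto_bareMatrix hN hs hlam hζ hζ' (hzj j) (hzj k))
  simp only [Function.comp_def, Complex.ofReal_prod] at h2
  rw [← blockPfaffian_limitMatrix]
  simp only [limitMatrix_eq]
  rw [blockPfaffian_mul_smul fun j => (omega lam (z₀ j * conj ζ) : ℂ)]
  refine h2.congr' ?_
  choose C hC using fun j => exists_tame hN hζ hζ' (hzj j)
  filter_upwards [eventually_all.2 hC, hs] with i hi hsi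
  rw [← blockPfaffian_mul_smul, ← blockPfaffian_smul]
  congr 1
  funext j k
  rw [matrixKernel_eq hsi (p i) (hp i) (hi j).1.im_ne_zero (hi k).1.im_ne_zero, smul_comm]

/-- As for the Pfaffian, the weights leave the rows and columns as the square of their product
before the limit. -/
lemma tendsto_det_complexKernel (hN : Tendsto N l atTop)
    (hs : ∀ᶠ i in l, (N i : ℝ≥0∞) < s i)
    (hlam : Tendsto (fun i => (N i : ℝ) * invParam (s i)) l (𝓝 lam)) (h0 : 0 ≤ lam)
    (hζ : ‖ζ‖ = 1) {n : ℕ} {z : ι → Fin n → ℂ} {z₀ : Fin n → ℂ} (hz : Tendsto z l (𝓝 z₀))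
    (hmem : z₀ ∈ regularSet ζ lam n) :
    Tendsto (fun i => (((N i : ℂ) ^ 2)⁻¹) ^ n * (Matrix.of fun j k =>
      complexKernel (s i) (N i) (ζ + z i j / N i) (ζ + z i k / N i)).det) l
      (𝓝 (Matrix.of fun j k => limitKernel ζ lam (z₀ j) (z₀ k)).det) := by
  have hzj := tendsto_pi_nhds.1 hz
  have hdet : ∀ (φ : Fin n → ℂ) (A : Matrix (Fin n) (Fin n) ℂ),
      (Matrix.of fun j k => φ j * φ k * A j k).det = (∏ j, φ j) ^ 2 * A.det := by
    intro φ A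
    rw [sq, mul_assoc, ← Matrix.det_mul_row, ← Matrix.det_mul_column]
    simp only [Matrix.of_apply, mul_assoc]
  have h1 := (Complex.continuous_ofReal.tendsto _).comp (tendsto_prod_weight hN hs hlam h0 hζ hz hmem)
  have h3 : Tendsto (fun i => Matrix.of fun j k : Fin n => ((N i : ℂ) ^ 2)⁻¹ *
      complexSum (s i) (N i) (ζ + z i j / N i) (ζ + z i k / N i)) l
      (𝓝 (Matrix.of fun j k => bareLimit ζ lam (z₀ j) (z₀ k))) :=
    tendsto_pi_nhds.2 fun j => tendsto_pi_nhds.2 fun k =>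
      tendsto_complexSum_scaled hN hs hlam hζ (hzj j) (hzj k)
  have h2 := (h1.pow 2).mul ((continuous_id.matrix_det.tendsto _).comp h3)
  simp only [Function.comp_def, Complex.ofReal_prod, id] at h2
  simp only [limitKernel_eq, omega_conj_mul]
  rw [← hdet] at h2
  refine h2.congr' ?_
  filter_upwards [hs] with i hsi
  have hsmul := Matrix.det_smul (Matrix.of fun j k =>
    complexKernel (s i) (N i) (ζ + z i j / N i) (ζ + z i k / N i)) ((N i : ℂ) ^ 2)⁻¹
  rw [Fintype.card_fin] at hsmul
  rw [← hdet, ← hsmul]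
  congr 1
  ext j k
  simp only [Matrix.of_apply, Matrix.smul_apply, smul_eq_mul]
  rw [complexKernel_eq hsi]
  ring

end

/-! ### The theorem from continuous convergence -/

lemma im_ne_zero_of_norm_eq_one {ζ : ℂ} (hζ : ‖ζ‖ = 1) (h1 : ζ ≠ 1) (h2 : ζ ≠ -1) : ζ.im ≠ 0 := by
  intro him
  have h : |ζ.re| = 1 := by rw [Complex.abs_re_eq_norm.2 him, hζ]
  rcases eq_or_eq_neg_of_abs_eq h with h | h
  · exact h1 (Complex.ext (by simpa using h) (by simpa using him))
  · exact h2 (Complex.ext (by simpa using h) (by simpa using him))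

lemma natCast_mul_invParam (N : ℕ) (s : ℝ≥0∞) :
    (N : ℝ) * invParam s = ((N : ℝ≥0∞) / s).toReal := by
  rw [div_eq_mul_inv, ENNReal.toReal_mul, ENNReal.toReal_natCast, invParam]

end Mahler

theorem theorem2p2 (ζ : ℂ) (hζ : ‖ζ‖ = 1) (hζ1 : ζ ≠ 1) (hζ2 : ζ ≠ -1)
    (s : ℕ → ℝ≥0∞) (hs : ∀ N : ℕ, 1 ≤ N → (N : ℝ≥0∞) < s N)
    (lam : ℝ) (hlam : Tendsto (fun N : ℕ => ((N : ℝ≥0∞) / s N).toReal) atTop (𝓝 lam))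
    (p : ℕ → ℕ → Polynomial ℝ)
    (hp : ∀ N n : ℕ, n < N → (p N n).Monic ∧ (p N n).natDegree = n) :
    TendstoLocallyUniformlyOn
      (fun (N : ℕ) (q : ℂ × ℂ) =>
        ((N : ℂ) ^ 2)⁻¹ • Mahler.matrixKernel (s N) N (p N) (ζ + q.1 / N) (ζ + q.2 / N))
      (fun q : ℂ × ℂ => Mahler.limitMatrix ζ lam q.1 q.2)
      atTop (Mahler.regularPairs ζ lam) ∧
    TendstoLocallyUniformlyOn
      (fun (N : ℕ) (q : ℂ × ℂ) =>
        ((N : ℂ) ^ 2)⁻¹ * Mahler.complexKernel (s N) N (ζ + q.1 / N) (ζ + q.2 / N))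
      (fun q : ℂ × ℂ => Mahler.limitKernel ζ lam q.1 q.2)
      atTop (Mahler.regularPairs ζ lam) ∧
    ∀ n : ℕ,
      (∀ z : Fin n → ℂ,
        Mahler.blockPfaffian (fun j k => Mahler.limitMatrix ζ lam (z j) (z k)) =
          (Matrix.of fun j k => Mahler.limitKernel ζ lam (z j) (z k)).det) ∧
      TendstoLocallyUniformlyOn
        (fun (N : ℕ) (z : Fin n → ℂ) => (((N : ℂ) ^ 2)⁻¹) ^ n *
          Mahler.blockPfaffian (fun j k =>
            Mahler.matrixKernel (s N) N (p N) (ζ + z j / N) (ζ + z k / N)))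
        (fun z : Fin n → ℂ => (Matrix.of fun j k => Mahler.limitKernel ζ lam (z j) (z k)).det)
        atTop (Mahler.regularSet ζ lam n) ∧
      TendstoLocallyUniformlyOn
        (fun (N : ℕ) (z : Fin n → ℂ) => (((N : ℂ) ^ 2)⁻¹) ^ n *
          (Matrix.of fun j k =>
            Mahler.complexKernel (s N) N (ζ + z j / N) (ζ + z k / N)).det)
        (fun z : Fin n → ℂ => (Matrix.of fun j k => Mahler.limitKernel ζ lam (z j) (z k)).det)
        atTop (Mahler.regularSet ζ lam n) := by
  have him := Mahler.im_ne_zero_of_norm_eq_one hζ hζ1 hζ2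
  have hlam' : Tendsto (fun N : ℕ => (N : ℝ) * Mahler.invParam (s N)) atTop (𝓝 lam) :=
    hlam.congr fun N => (Mahler.natCast_mul_invParam N (s N)).symm
  have h0 : 0 ≤ lam := ge_of_tendsto' hlam fun N => ENNReal.toReal_nonneg
  have hs' : ∀ᶠ N : ℕ in atTop, (N : ℝ≥0∞) < s N :=
    (eventually_ge_atTop 1).mono fun N hN => hs N hN
  have hsnd : ∀ {α : Type} [TopologicalSpace α] {S : Set α} {x : α},
      Tendsto (Prod.snd : ℕ × α → α) (atTop ×ˢ 𝓝[S] x) (𝓝 x) := by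
    intro α _ S x
    exact tendsto_snd.mono_right nhdsWithin_le_nhds
  -- All four limits are taken along the filter of pairs (N, y) with N → ∞ and y → x inside the
  -- region; N is the first projection and the moving points are the second.
  refine ⟨?_, ?_, fun n => ⟨Mahler.blockPfaffian_limitMatrix ζ lam, ?_, ?_⟩⟩ <;>
    refine Mahler.tendstoLocallyUniformlyOn_of_forall_tendsto fun x hx => ?_
  · exact Mahler.tendsto_matrixKernel tendsto_fst (tendsto_fst.eventually hs')
      (hlam'.comp tendsto_fst) h0 hζ him (fun y => hp y.1)
      ((continuous_fst.tendsto x).comp hsnd) ((continuous_snd.tendsto x).comp hsnd) hx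
  · exact Mahler.tendsto_complexKernel tendsto_fst (tendsto_fst.eventually hs')
      (hlam'.comp tendsto_fst) h0 hζ
      ((continuous_fst.tendsto x).comp hsnd) ((continuous_snd.tendsto x).comp hsnd) hx
  · exact Mahler.tendsto_blockPfaffian_matrixKernel tendsto_fst (tendsto_fst.eventually hs')
      (hlam'.comp tendsto_fst) h0 hζ him (fun y => hp y.1) hsnd hx
  · exact Mahler.tendsto_det_complexKernel tendsto_fst (tendsto_fst.eventually hs')
      (hlam'.comp tendsto_fst) h0 hζ hsnd hx
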